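/- Let $\Gamma$ be a finite group. For $n\ge 0$ let $\widetilde S_n$ be the group generated by $z,t_1,\dots,t_{n-1}$ with relations $z^2=1$, $t_i^2=(t_it_{i+1})^3=z$, $t_it_j=zt_jt_i$ for $i>j+1$, $zt_i=t_iz$; let it act on $\Gamma^n$ through $\widetilde S_n\to S_n$, $z\mapsto 1$, $t_i\mapsto (i,i+1)$, by permuting the components, and put $G_n=\Gamma\wr\widetilde S_n=\Gamma^n\rtimes\widetilde S_n$. Let $d:G_n\to\mathbb Z/2$ be the parity homomorphism with $d(g,t_i)=1$, $d(g,z)=0$, and write $z=(1,z)\in G_n$. Let $R^-(G_n)$ be the complex vector space of spin super class functions on $G_n$, i.e. class functions $f:G_n\to\mathbb C$ with $f(zx)=-f(x)$ that vanish on the elements of odd parity, and let $R^-_\Gamma=\bigoplus_{n\ge0}R^-(G_n)$. Let $G_k\hat\times G_l$ be the spin product: the set $G_k\times G_l$ with the multiplication $(t,t')(s,s')=(tsz^{d(t')d(s)},t's')$, modulo $\{(1,1),(z,z)\}$, with central element $z=[(z,1)]$ and parity $d(t,s)=d(t)+d(s)$; define $R^-(G_k\hat\times G_l)$ in the same way.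 Then: (1) The canonical homomorphism $G_k\hat\times G_l\to G_{k+l}$, $((g,t_i),1)\mapsto(g,t_i)$, $(1,(g,t_j))\mapsto(g,t_{k+j})$ (with $\Gamma^k$ and $\Gamma^l$ placed in the first $k$ and the last $l$ components of $\Gamma^{k+l}$), is injective. (2) The linear map $\phi_{k,l}:R^-(G_k)\otimes R^-(G_l)\to R^-(G_k\hat\times G_l)$, $\phi_{k,l}(f\otimes g)([t,s])=f(t)g(s)$, is an isomorphism. It is given by the super outer tensor product: if $U$ and $V$ are finite-dimensional spin supermodules of $G_k$ and $G_l$ with characters $\chi_U$ and $\chi_V$, then $\phi_{k,l}(\chi_U\otimes\chi_V)$ is the character of the $G_k\hat\times G_l$-module $U\otimes V$ with the action $(t,s)(u\otimes v)=(-1)^{d(s)d(u)}\,tu\otimes sv$ for homogeneous $u$. (3) $R^-_\Gamma$ is a Hopf algebra over $\mathbb C$ with the multiplication $$R^-(G_k)\otimes R^-(G_l)\xrightarrow{\ \phi_{k,l}\ }R^-(G_k\hat\times G_l)\xrightarrow{\ \mathrm{Ind}\ }R^-(G_{k+l})$$ and the comultiplication $$R^-(G_n)\xrightarrow{\ \mathrm{Res}\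 }\bigoplus_{k+l=n}R^-(G_k\hat\times G_l)\xrightarrow{\ \oplus\phi_{k,l}^{-1}\ }\bigoplus_{k+l=n}R^-(G_k)\otimes R^-(G_l),$$ where $\mathrm{Ind}$ and $\mathrm{Res}$ are induction and restriction of class functions along the embeddings in (1). -/

import Mathlib

open scoped TensorProduct DirectSum

universe u v w

namespace SpinWreath

/-- A group `G` equipped with a central element `z` satisfying `z ^ 2 = 1` and a parity
homomorphism `d : G → ℤ/2` (written additively) such that `d z = 0`. -/
class SpinData (G : Type*) [Group G] where
  z : G
  z_mul_z : z * z = 1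
  z_comm : ∀ x : G, z * x = x * z
  d : G → ZMod 2
  d_mul : ∀ x y : G, d (x * y) = d x + d y
  d_z : d z = 0

open SpinData

section SpinData

variable {G : Type u} [Group G] [SpinData G]

theorem d_one : d (1 : G) = 0 := by
  have h := d_mul (1 : G) 1
  simpa using h

theorem d_inv (x : G) : d x⁻¹ = d x := by
  have h := d_mul x x⁻¹
  rw [mul_inv_cancel, d_one] at h
  have h2 : d x⁻¹ = - d x := by
    rw [eq_neg_iff_add_eq_zero, add_comm]; exact h.symm
  rw [h2, ZMod.neg_eq_self_mod_two]

/-- The power `z ^ e` of the central element, for an exponent `e` modulo `2`. -/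
def zpw (e : ZMod 2) : G := z ^ e.val

theorem zpw_zero : (zpw 0 : G) = 1 := by simp [zpw]

theorem zpw_one : (zpw 1 : G) = z := by simp [zpw, ZMod.val_one]

theorem zmod_two_cases (e : ZMod 2) : e = 0 ∨ e = 1 := by
  revert e; decide

theorem zpw_add (a b : ZMod 2) : (zpw (a + b) : G) = zpw a * zpw b := by
  have h11 : (1 : ZMod 2) + 1 = 0 := by decide
  rcases zmod_two_cases a with rfl | rfl <;> rcases zmod_two_cases b with rfl | rfl <;>
    simp [zpw_zero, zpw_one, z_mul_z, h11]

theorem zpw_comm (a : ZMod 2) (x : G) : zpw a * x = x * zpw a := by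
  rcases zmod_two_cases a with rfl | rfl <;> simp [zpw_zero, zpw_one, z_comm]

theorem d_zpw (a : ZMod 2) : d (zpw a : G) = 0 := by
  rcases zmod_two_cases a with rfl | rfl <;> simp [zpw_zero, zpw_one, d_one, d_z]

end SpinData

/-! ### The spin group -/

/-- Generators `z, t_1, …, t_{n-1}` of the spin group; `t i` (with `i + 1 < n`) stands for
the generator `t_{i+1}`. -/
inductive SpinGen (n : ℕ) : Type
  | z : SpinGen n
  | t (i : ℕ) (hi : i + 1 < n) : SpinGen n

/-- The defining relators: `z² = 1`, `t_i² = z`, `(t_i t_{i+1})³ = z`,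
`t_i t_j = z t_j t_i` for `i > j + 1`, and `z t_i = t_i z`. -/
inductive SpinRel (n : ℕ) : FreeGroup (SpinGen n) → Prop
  | z_sq : SpinRel n (FreeGroup.of .z ^ 2)
  | t_sq (i : ℕ) (hi : i + 1 < n) :
      SpinRel n (FreeGroup.of (.t i hi) ^ 2 * (FreeGroup.of .z)⁻¹)
  | braid (i : ℕ) (hi : i + 1 < n) (hi' : i + 1 + 1 < n) :
      SpinRel n ((FreeGroup.of (.t i hi) * FreeGroup.of (.t (i + 1) hi')) ^ 3 *
        (FreeGroup.of .z)⁻¹)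
  | far (i j : ℕ) (hi : i + 1 < n) (hj : j + 1 < n) (hij : j + 1 < i) :
      SpinRel n ((FreeGroup.of (.t i hi) * FreeGroup.of (.t j hj)) *
        (FreeGroup.of .z * FreeGroup.of (.t j hj) * FreeGroup.of (.t i hi))⁻¹)
  | comm (i : ℕ) (hi : i + 1 < n) :
      SpinRel n ((FreeGroup.of .z * FreeGroup.of (.t i hi)) *
        (FreeGroup.of (.t i hi) * FreeGroup.of .z)⁻¹)

/-- The spin group `S̃_n`, the double cover of the symmetric group given by generators and
relations. -/
abbrev SpinSym (n : ℕ) : Type := PresentedGroup {r | SpinRel n r}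

namespace SpinSym

variable {n : ℕ}

/-- The central generator of `S̃_n`. -/
def zz : SpinSym n := PresentedGroup.of .z

/-- The generator `t_{i+1}` of `S̃_n`. -/
def tt (i : ℕ) (hi : i + 1 < n) : SpinSym n := PresentedGroup.of (.t i hi)

theorem zz_sq : (zz : SpinSym n) ^ 2 = 1 :=
  (PresentedGroup.one_of_mem (rels := {r | SpinRel n r}) SpinRel.z_sq :)

theorem tt_sq (i : ℕ) (hi : i + 1 < n) : tt i hi ^ 2 = (zz : SpinSym n) :=
  mul_inv_eq_one.1
    (PresentedGroup.one_of_mem (rels := {r | SpinRel n r}) (SpinRel.t_sq i hi) :)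

theorem tt_braid (i : ℕ) (hi : i + 1 < n) (hi' : i + 1 + 1 < n) :
    (tt i hi * tt (i + 1) hi') ^ 3 = (zz : SpinSym n) :=
  mul_inv_eq_one.1
    (PresentedGroup.one_of_mem (rels := {r | SpinRel n r}) (SpinRel.braid i hi hi') :)

theorem tt_far (i j : ℕ) (hi : i + 1 < n) (hj : j + 1 < n) (hij : j + 1 < i) :
    tt i hi * tt j hj = (zz * tt j hj * tt i hi : SpinSym n) :=
  mul_inv_eq_one.1
    (PresentedGroup.one_of_mem (rels := {r | SpinRel n r}) (SpinRel.far i j hi hj hij) :)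

theorem zz_tt (i : ℕ) (hi : i + 1 < n) : zz * tt i hi = (tt i hi * zz : SpinSym n) :=
  mul_inv_eq_one.1
    (PresentedGroup.one_of_mem (rels := {r | SpinRel n r}) (SpinRel.comm i hi) :)

theorem zz_comm (x : SpinSym n) : zz * x = x * zz := by
  have hx : x ∈ Subgroup.centralizer {(zz : SpinSym n)} := by
    refine PresentedGroup.generated_by _ (Subgroup.centralizer {(zz : SpinSym n)}) ?_ x
    rintro (_ | ⟨i, hi⟩)
    · exact Subgroup.mem_centralizer_singleton_iff.2 rfl
    · exact Subgroup.mem_centralizer_singleton_iff.2 (zz_tt i hi).symm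
  exact (Subgroup.mem_centralizer_singleton_iff.1 hx).symm

/-- The homomorphism out of `S̃_n` determined by images of the generators that satisfy the
defining relations. -/
def lift {H : Type*} [Group H] (a : H) (b : ∀ i : ℕ, i + 1 < n → H) (h1 : a ^ 2 = 1)
    (h2 : ∀ i hi, b i hi ^ 2 = a)
    (h3 : ∀ i hi hi', (b i hi * b (i + 1) hi') ^ 3 = a)
    (h4 : ∀ i j hi hj, j + 1 < i → b i hi * b j hj = a * b j hj * b i hi)
    (h5 : ∀ i hi, a * b i hi = b i hi * a) : SpinSym n →* H :=
  PresentedGroup.toGroup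
    (f := fun x : SpinGen n => match x with | .z => a | .t i hi => b i hi) (by
      rintro r (_ | _ | _ | _ | _)
      · simpa using h1
      · simpa [mul_inv_eq_one] using h2 _ _
      · simpa [mul_inv_eq_one] using h3 _ _ _
      · rename_i i j hi hj hij
        rw [map_mul, map_inv, mul_inv_eq_one]
        simpa using h4 i j hi hj hij
      · rename_i i hi
        rw [map_mul, map_inv, mul_inv_eq_one]
        simpa using h5 i hi)

/-- The covering homomorphism `θ_n : S̃_n → S_n`, `z ↦ 1`, `t_i ↦ (i, i+1)`. -/
def theta (n : ℕ) : SpinSym n →* Equiv.Perm (Fin n) :=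
  lift 1 (fun i hi => Equiv.swap ⟨i, by omega⟩ ⟨i + 1, hi⟩)
    (by simp) (by simp [pow_two])
    (by
      intro i hi hi'
      have h := (Equiv.Perm.isThreeCycle_swap_mul_swap_same
        (a := (⟨i + 1, hi⟩ : Fin n)) (b := ⟨i, by omega⟩) (c := ⟨i + 1 + 1, hi'⟩)
        (by simp) (by simp) (by simp; omega)).orderOf
      rw [Equiv.swap_comm (⟨i, by omega⟩ : Fin n) ⟨i + 1, hi⟩, ← h]
      exact pow_orderOf_eq_one _)
    (by
      intro i j hi hj hij
      rw [one_mul]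
      refine (Equiv.Perm.Disjoint.commute (Equiv.Perm.disjoint_swap_swap ?_)).eq
      simp; omega)
    (by simp)

/-- The parity `d : S̃_n → ℤ/2`, `d(z) = 0`, `d(t_i) = 1`, as a homomorphism to the
multiplicative version of `ℤ/2`. -/
def parityHom (n : ℕ) : SpinSym n →* Multiplicative (ZMod 2) :=
  lift 1 (fun _ _ => Multiplicative.ofAdd 1) (by simp) (by intros; decide) (by intros; decide)
    (by intros; decide) (by intros; decide)

instance instSpinData (n : ℕ) : SpinData (SpinSym n) where
  z := zz
  z_mul_z := by rw [← pow_two]; exact zz_sq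
  z_comm := zz_comm
  d x := (parityHom n x).toAdd
  d_mul x y := by simp
  d_z := by
    rfl

theorem theta_zz : theta n zz = 1 := rfl

theorem theta_tt (i : ℕ) (hi : i + 1 < n) :
    theta n (tt i hi) = Equiv.swap ⟨i, by omega⟩ ⟨i + 1, hi⟩ := rfl

theorem d_tt (i : ℕ) (hi : i + 1 < n) : d (tt i hi : SpinSym n) = 1 := rfl

/-- The homomorphism `S̃_m → S̃_n`, `z ↦ z`, `t_j ↦ t_{k+j}`, for `k + m ≤ n`. -/
def shift (k m n : ℕ) (h : k + m ≤ n) : SpinSym m →* SpinSym n :=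
  lift zz (fun j hj => tt (k + j) (by omega)) zz_sq (fun _ _ => tt_sq _ _)
    (fun j _ _ => tt_braid (k + j) _ _)
    (fun _ _ _ _ hij => tt_far _ _ _ _ (by omega))
    (fun _ _ => zz_tt _ _)

theorem shift_zz (k m n : ℕ) (h : k + m ≤ n) : shift k m n h zz = zz := rfl

theorem shift_tt (k m n : ℕ) (h : k + m ≤ n) (j : ℕ) (hj : j + 1 < m) :
    shift k m n h (tt j hj) = tt (k + j) (by omega) := rfl

theorem hom_ext {H : Type*} [Group H] {f g : SpinSym n →* H} (hz : f zz = g zz)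
    (ht : ∀ i hi, f (tt i hi) = g (tt i hi)) : f = g := by
  refine PresentedGroup.ext ?_
  rintro (_ | ⟨i, hi⟩)
  · exact hz
  · exact ht i hi

theorem induction {p : SpinSym n → Prop} (hz : p zz) (ht : ∀ i hi, p (tt i hi)) (h1 : p 1)
    (hm : ∀ x y, p x → p y → p (x * y)) (hi : ∀ x, p x → p x⁻¹) (x : SpinSym n) : p x := by
  let K : Subgroup (SpinSym n) :=
    { carrier := {x | p x}, one_mem' := h1, mul_mem' := fun hx hy => hm _ _ hx hy,
      inv_mem' := fun hx => hi _ hx }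
  refine PresentedGroup.generated_by _ K ?_ x
  rintro (_ | ⟨i, hi⟩)
  · exact hz
  · exact ht i hi

theorem d_shift (k m n : ℕ) (h : k + m ≤ n) (x : SpinSym m) : d (shift k m n h x) = d x := by
  have : (parityHom n).comp (shift k m n h) = parityHom m := hom_ext rfl (fun _ _ => rfl)
  exact congrArg Multiplicative.toAdd (DFunLike.congr_fun this x)

/-! #### Finiteness of the spin group -/

/-- Equality up to a factor `z`. -/
def EqZ (x y : SpinSym n) : Prop := x = y ∨ x = zz * y

theorem zz_mul_zz : (zz * zz : SpinSym n) = 1 := by rw [← pow_two, zz_sq]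

theorem EqZ.trans {x y w : SpinSym n} (h : EqZ x y) (h' : EqZ y w) : EqZ x w := by
  rcases h with rfl | rfl <;> rcases h' with rfl | rfl
  · exact Or.inl rfl
  · exact Or.inr rfl
  · exact Or.inr rfl
  · left; rw [← mul_assoc, zz_mul_zz, one_mul]

theorem EqZ.mul_left (a : SpinSym n) {x y : SpinSym n} (h : EqZ x y) : EqZ (a * x) (a * y) := by
  rcases h with rfl | rfl
  · exact Or.inl rfl
  · right; rw [← mul_assoc, ← zz_comm, mul_assoc]

theorem EqZ.mul_right (a : SpinSym n) {x y : SpinSym n} (h : EqZ x y) : EqZ (x * a) (y * a) := by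
  rcases h with rfl | rfl
  · exact Or.inl rfl
  · right; rw [mul_assoc]

/-- The generator `t_{i+1}` extended by `1` to all indices. -/
def tot (n i : ℕ) : SpinSym n := if h : i + 1 < n then tt i h else 1

theorem tot_sq (i : ℕ) : EqZ (tot n i * tot n i) 1 := by
  unfold tot
  split_ifs with h
  · right; rw [← pow_two, tt_sq, mul_one]
  · left; simp

theorem tot_far {i j : ℕ} (h : j + 1 < i) : EqZ (tot n i * tot n j) (tot n j * tot n i) := by
  unfold tot
  split_ifs with h1 h2
  · right; rw [tt_far _ _ _ _ h, mul_assoc]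
  all_goals left; simp

theorem tot_braid {i : ℕ} (h : i + 1 + 1 < n) :
    EqZ (tot n (i + 1) * (tot n i * tot n (i + 1))) (tot n i * (tot n (i + 1) * tot n i)) := by
  have h' : i + 1 < n := by omega
  simp only [tot, h, h', dite_true]
  set a := (tt i h' : SpinSym n) with ha
  set b := (tt (i + 1) h : SpinSym n) with hb
  have e1 : a * a = zz := by rw [← pow_two]; exact tt_sq _ _
  have e2 : b * b = zz := by rw [← pow_two]; exact tt_sq _ _
  have e3 : (a * b) ^ 3 = zz := tt_braid _ _ _
  left
  have e4 : (a * (b * a)) * (b * (a * b)) = zz := by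
    rw [← e3]; simp only [pow_succ, pow_zero, one_mul, mul_assoc]
  have e5 : (b * (a * b)) * (b * (a * b)) = zz := by
    calc (b * (a * b)) * (b * (a * b)) = b * (a * ((b * b) * (a * b))) := by
          simp only [mul_assoc]
      _ = b * (a * (a * b)) * zz := by
          rw [e2, zz_comm]; simp only [mul_assoc]
      _ = b * ((a * a) * b) * zz := by simp only [mul_assoc]
      _ = zz := by
          rw [e1, zz_comm, ← mul_assoc b, e2, zz_mul_zz, one_mul]
  exact mul_right_cancel (e5.trans e4.symm)

/-- The element `t_n t_{n-1} ⋯ t_{n-j+1}` of `S̃_{n+1}`. -/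
def wrd (n : ℕ) : ℕ → SpinSym (n + 1)
  | 0 => 1
  | j + 1 => wrd n j * tot (n + 1) (n - 1 - j)

theorem wrd_low (j i : ℕ) (hj : j ≤ n) (h : i + j + 1 < n) :
    EqZ (wrd n j * tot (n + 1) i) (tot (n + 1) i * wrd n j) := by
  induction j with
  | zero => left; simp [wrd]
  | succ j ih =>
    have h1 : EqZ (wrd n j * (tot (n + 1) (n - 1 - j) * tot (n + 1) i))
        (wrd n j * (tot (n + 1) i * tot (n + 1) (n - 1 - j))) :=
      (tot_far (by omega)).mul_left _
    have h2 := (ih (by omega) (by omega)).mul_right (tot (n + 1) (n - 1 - j))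
    simp only [wrd, mul_assoc] at h1 h2 ⊢
    exact h1.trans h2

theorem wrd_high (j i : ℕ) (hj : j ≤ n) (h : n < i + j) (hi : i < n) :
    EqZ (wrd n j * tot (n + 1) i) (tot (n + 1) (i - 1) * wrd n j) := by
  induction j with
  | zero => omega
  | succ j ih =>
    by_cases hc : n < i + j
    · have h1 : EqZ (wrd n j * (tot (n + 1) (n - 1 - j) * tot (n + 1) i))
          (wrd n j * (tot (n + 1) i * tot (n + 1) (n - 1 - j))) := by
        refine EqZ.mul_left _ ?_
        rcases (tot_far (n := n + 1) (i := i) (j := n - 1 - j) (by omega)) with e | e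
        · exact Or.inl e.symm
        · right; rw [e, ← mul_assoc, zz_mul_zz, one_mul]
      have h2 := (ih (by omega) hc).mul_right (tot (n + 1) (n - 1 - j))
      simp only [wrd, mul_assoc] at h1 h2 ⊢
      exact h1.trans h2
    · obtain ⟨l, rfl⟩ : ∃ l, j = l + 1 := ⟨j - 1, by omega⟩
      obtain ⟨k, rfl⟩ : ∃ k, i = k + 1 := ⟨i - 1, by omega⟩
      have a1 : n - 1 - l = k + 1 := by omega
      have a2 : n - 1 - (l + 1) = k := by omega
      simp only [wrd, a1, a2, Nat.add_sub_cancel, mul_assoc]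
      refine (EqZ.mul_left _ (tot_braid (by omega))).trans ?_
      have h2 := (wrd_low l k (by omega) (by omega)).mul_right
        (tot (n + 1) (k + 1) * tot (n + 1) k)
      simpa only [mul_assoc] using h2

theorem finite_succ [Finite (SpinSym n)] : Finite (SpinSym (n + 1)) := by
  let K : Subgroup (SpinSym (n + 1)) := (shift 0 n (n + 1) (by omega)).range
  let X : Set (SpinSym (n + 1)) :=
    Set.range fun p : SpinSym n × Fin (n + 1) =>
      shift 0 n (n + 1) (by omega) p.1 * wrd n p.2
  have hK : ∀ (x : SpinSym (n + 1)) (j : ℕ), x ∈ K → j ≤ n → x * wrd n j ∈ X := by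
    rintro _ j ⟨y, rfl⟩ hj
    exact ⟨(y, ⟨j, by omega⟩), rfl⟩
  have hzK : zz ∈ K := ⟨zz, rfl⟩
  have hE : ∀ (x y : SpinSym (n + 1)) (j : ℕ), y ∈ K → j ≤ n → EqZ x (y * wrd n j) → x ∈ X := by
    rintro x y j hy hj (rfl | rfl)
    · exact hK _ _ hy hj
    · rw [← mul_assoc]; exact hK _ _ (K.mul_mem hzK hy) hj
  have htK : ∀ i, i + 1 < n → tot (n + 1) i ∈ K := by
    intro i hi
    refine ⟨tt i hi, ?_⟩
    rw [shift_tt]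
    have : i + 1 < n + 1 := by omega
    simp [tot, this]
  have hz : ∀ x ∈ X, x * zz ∈ X := by
    rintro _ ⟨⟨y, j⟩, rfl⟩
    rw [← zz_comm, ← mul_assoc]
    exact hK _ _ (K.mul_mem hzK ⟨y, rfl⟩) (by omega)
  have ht : ∀ i, i < n → ∀ x ∈ X, x * tot (n + 1) i ∈ X := by
    rintro i hi _ ⟨⟨y, ⟨j, hj⟩⟩, rfl⟩
    have hy : shift 0 n (n + 1) (by omega) y ∈ K := ⟨y, rfl⟩
    simp only
    rw [mul_assoc]
    rcases lt_trichotomy (i + j + 1) n with h | h | h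
    · refine hE _ _ j (K.mul_mem hy (htK i (by omega))) (by omega) ?_
      rw [mul_assoc]
      exact (wrd_low j i (by omega) h).mul_left _
    · refine hE _ _ (j + 1) hy (by omega) ?_
      left
      rw [wrd, show n - 1 - j = i by omega]
    · by_cases hc : n < i + j
      · refine hE _ _ j (K.mul_mem hy (htK (i - 1) (by omega))) (by omega) ?_
        rw [mul_assoc]
        exact (wrd_high j i (by omega) hc hi).mul_left _
      · obtain ⟨l, rfl⟩ : ∃ l, j = l + 1 := ⟨j - 1, by omega⟩
        refine hE _ _ l hy (by omega) (EqZ.mul_left _ ?_)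
        rw [wrd, show n - 1 - l = i by omega, mul_assoc]
        simpa using (tot_sq (n := n + 1) i).mul_left (wrd n l)
  have htinv : ∀ i (hi : i + 1 < n + 1), (tt i hi : SpinSym (n + 1))⁻¹ = tt i hi * zz := by
    intro i hi
    rw [inv_eq_iff_mul_eq_one, ← mul_assoc, ← pow_two, tt_sq, zz_mul_zz]
  have hzinv : (zz : SpinSym (n + 1))⁻¹ = zz := by
    rw [inv_eq_iff_mul_eq_one, zz_mul_zz]
  have ht' : ∀ i (hi : i + 1 < n + 1), ∀ x ∈ X, x * tt i hi ∈ X := by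
    intro i hi x hx
    have := ht i (by omega) x hx
    rwa [tot, dif_pos hi] at this
  have key : ∀ g : SpinSym (n + 1), (∀ x ∈ X, x * g ∈ X) ∧ (∀ x ∈ X, x * g⁻¹ ∈ X) := by
    intro g
    induction g using SpinSym.induction with
    | hz => exact ⟨hz, by rw [hzinv]; exact hz⟩
    | ht i hi =>
      refine ⟨ht' i hi, fun x hx => ?_⟩
      rw [htinv, ← mul_assoc]
      exact hz _ (ht' i hi x hx)
    | h1 => simp
    | hm a b ha hb =>
      refine ⟨fun x hx => ?_, fun x hx => ?_⟩
      · rw [← mul_assoc]; exact hb.1 _ (ha.1 _ hx)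
      · rw [mul_inv_rev, ← mul_assoc]; exact ha.2 _ (hb.2 _ hx)
    | hi a ha => exact ⟨ha.2, by simpa using ha.1⟩
  have h1X : (1 : SpinSym (n + 1)) ∈ X := by
    have := hK 1 0 K.one_mem (by omega)
    simpa [wrd] using this
  have huniv : X = Set.univ := by
    ext g
    simpa using (key g).1 1 h1X
  rw [← Set.finite_univ_iff, ← huniv]
  exact Set.finite_range _

instance instFinite (n : ℕ) : Finite (SpinSym n) := by
  induction n with
  | zero =>
    have key : ∀ g : SpinSym 0, EqZ g 1 := by
      intro g
      induction g using SpinSym.induction with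
      | hz => right; simp
      | ht i hi => omega
      | h1 => left; rfl
      | hm a b ha hb =>
        have := (ha.mul_right b).trans (by simpa using hb)
        exact this
      | hi a ha =>
        rcases ha with rfl | rfl
        · left; simp
        · right; rw [mul_one, inv_eq_iff_mul_eq_one, zz_mul_zz]
    have : (Set.univ : Set (SpinSym 0)) ⊆ {1, zz} := by
      intro g _
      rcases key g with h | h
      · left; exact h
      · right; simpa using h
    rw [← Set.finite_univ_iff]
    exact (Set.toFinite _).subset this
  | succ n ih => exact finite_succ

end SpinSym

/-! ### The spin wreath product -/

/-- The spin wreath product `Γ ≀ S̃_n = Γ^n ⋊ S̃_n`, where `S̃_n` acts on `Γ^n` through `θ_n` by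
`(σ • g) i = g (σ⁻¹ i)`. -/
abbrev SpinWr (Γ : Type u) [Group Γ] (n : ℕ) : Type u :=
  (Fin n → Γ) ⋊[(mulAutArrow (G := Equiv.Perm (Fin n)) (A := Fin n) (M := Γ)).comp
    (SpinSym.theta n)] SpinSym n

namespace SpinWr

variable {Γ : Type u} [Group Γ]

instance instFinite [Finite Γ] (n : ℕ) : Finite (SpinWr Γ n) :=
  Finite.of_equiv _ SemidirectProduct.equivProd.symm

/-- The central element is `(1, z)` and the parity is `d(g, t) = d(t)`. -/
instance instSpinData (n : ℕ) : SpinData (SpinWr Γ n) where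
  z := SemidirectProduct.inr SpinSym.zz
  z_mul_z := by rw [← map_mul, SpinSym.zz_mul_zz, map_one]
  z_comm x := by
    ext1
    · simp [SpinSym.theta_zz]
    · simp [SpinSym.zz_comm]
  d x := d x.right
  d_mul x y := by rw [SemidirectProduct.mul_right, d_mul]
  d_z := d_z (G := SpinSym n)

/-- The homomorphism `Γ^m → Γ^n` placing the `m` components at the positions `k, …, k + m - 1`
(counted from `0`) and `1` at all other positions. -/
def shiftBase (Γ : Type u) [Group Γ] (k m n : ℕ) : (Fin m → Γ) →* (Fin n → Γ) where
  toFun g i := if h : k ≤ i.1 ∧ i.1 < k + m then g ⟨i.1 - k, by omega⟩ else 1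
  map_one' := by ext i; simp
  map_mul' g g' := by
    ext i
    simp only [Pi.mul_apply]
    split_ifs <;> simp

theorem theta_shift_in (k m n : ℕ) (h : k + m ≤ n) (t : SpinSym m) :
    (∀ j : Fin m, SpinSym.theta n (SpinSym.shift k m n h t) ⟨k + j.1, by omega⟩ =
      ⟨k + (SpinSym.theta m t j).1, by omega⟩) ∧
    ∀ i : Fin n, ¬ (k ≤ i.1 ∧ i.1 < k + m) →
      SpinSym.theta n (SpinSym.shift k m n h t) i = i := by
  induction t using SpinSym.induction with
  | hz => simp [SpinSym.shift_zz, SpinSym.theta_zz]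
  | ht a ha =>
    simp only [SpinSym.shift_tt, SpinSym.theta_tt]
    refine ⟨fun j => ?_, fun i hi => ?_⟩
    · simp only [Equiv.swap_apply_def, Fin.ext_iff]
      split_ifs <;> simp_all <;> omega
    · refine Equiv.swap_apply_of_ne_of_ne ?_ ?_ <;>
      · intro e
        rw [Fin.ext_iff] at e
        simp only at e
        omega
  | h1 => simp
  | hm x y hx hy =>
    refine ⟨fun j => ?_, fun i hi => ?_⟩
    · simp only [map_mul, Equiv.Perm.mul_apply, hy.1, hx.1]
    · rw [map_mul, map_mul, Equiv.Perm.mul_apply, hy.2 i hi, hx.2 i hi]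
  | hi x hx =>
    refine ⟨fun j => ?_, fun i hi => ?_⟩
    · simp only [map_inv, Equiv.Perm.inv_eq_iff_eq, hx.1]
      simp
    · rw [map_inv, map_inv, Equiv.Perm.inv_eq_iff_eq, hx.2 i hi]

/-- The homomorphism `Γ ≀ S̃_m → Γ ≀ S̃_n` for `k + m ≤ n`, shifting all indices by `k`:
`(g, z) ↦ (g, z)`, `(g, t_j) ↦ (g, t_{k+j})` with `g` placed at the positions
`k + 1, …, k + m`. -/
def shift (Γ : Type u) [Group Γ] (k m n : ℕ) (h : k + m ≤ n) : SpinWr Γ m →* SpinWr Γ n :=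
  SemidirectProduct.map (shiftBase Γ k m n) (SpinSym.shift k m n h) (by
    intro t
    ext g i
    have h1 := theta_shift_in k m n h t⁻¹
    simp only [MonoidHom.comp_apply, MulEquiv.coe_toMonoidHom, mulAutArrow_apply_apply,
      shiftBase, MonoidHom.coe_mk, OneHom.coe_mk]
    change (if h : k ≤ i.1 ∧ i.1 < k + m then g ((SpinSym.theta m t)⁻¹ ⟨i.1 - k, by omega⟩)
      else 1) = (fun i : Fin n => if h : k ≤ i.1 ∧ i.1 < k + m then g ⟨i.1 - k, by omega⟩ else 1)
        ((SpinSym.theta n (SpinSym.shift k m n h t))⁻¹ i)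
    rw [← map_inv, ← map_inv, ← map_inv]
    by_cases hi : k ≤ i.1 ∧ i.1 < k + m
    · have h2 := h1.1 ⟨i.1 - k, by omega⟩
      have e : (⟨k + (i.1 - k), by omega⟩ : Fin n) = i := by
        ext; simp only; omega
      simp only [e] at h2
      rw [dif_pos hi]
      simp only [h2]
      rw [dif_pos (by simp)]
      congr 1
      ext
      simp
    · rw [dif_neg hi, h1.2 i hi]
      simp only [dif_neg hi])

theorem shift_z (k m n : ℕ) (h : k + m ≤ n) : shift Γ k m n h z = z := by
  change shift Γ k m n h (SemidirectProduct.inr SpinSym.zz) = SemidirectProduct.inr SpinSym.zz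
  rw [shift, SemidirectProduct.map_inr, SpinSym.shift_zz]

theorem d_shift (k m n : ℕ) (h : k + m ≤ n) (x : SpinWr Γ m) : d (shift Γ k m n h x) = d x :=
  SpinSym.d_shift k m n h x.right

end SpinWr

/-! ### The spin product of two groups -/

/-- The twisted direct product `G ×̃ H`: the set `G × H` with the multiplication
`(t, t') (s, s') = (t s z^{d(t') d(s)}, t' s')`. -/
@[ext]
structure TwistedProd (G : Type u) (H : Type v) where
  fst : G
  snd : H

namespace TwistedProd

variable {G : Type u} {H : Type v} [Group G] [Group H] [SpinData G] [SpinData H]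

instance : Mul (TwistedProd G H) :=
  ⟨fun x y => ⟨x.fst * y.fst * zpw (d x.snd * d y.fst), x.snd * y.snd⟩⟩

instance {G : Type u} {H : Type v} [Group G] [Group H] : One (TwistedProd G H) := ⟨⟨1, 1⟩⟩

instance : Inv (TwistedProd G H) := ⟨fun x => ⟨x.fst⁻¹ * zpw (d x.snd * d x.fst), x.snd⁻¹⟩⟩

theorem mul_def (x y : TwistedProd G H) :
    x * y = ⟨x.fst * y.fst * zpw (d x.snd * d y.fst), x.snd * y.snd⟩ := rfl

theorem one_def {G : Type u} {H : Type v} [Group G] [Group H] :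
    (1 : TwistedProd G H) = ⟨1, 1⟩ := rfl

theorem inv_def (x : TwistedProd G H) :
    x⁻¹ = ⟨x.fst⁻¹ * zpw (d x.snd * d x.fst), x.snd⁻¹⟩ := rfl

instance : Group (TwistedProd G H) :=
  Group.ofLeftAxioms
    (by
      intro x y w
      ext
      · simp only [mul_def, d_mul, d_zpw, add_zero]
        have e : x.fst * y.fst * zpw (d x.snd * d y.fst) * w.fst *
            zpw ((d x.snd + d y.snd) * d w.fst) =
          x.fst * y.fst * w.fst * (zpw (d x.snd * d y.fst) *
            zpw ((d x.snd + d y.snd) * d w.fst)) := by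
          rw [mul_assoc (x.fst * y.fst), zpw_comm (d x.snd * d y.fst) w.fst]
          simp only [mul_assoc]
        rw [e, ← zpw_add]
        simp only [← mul_assoc]
        rw [mul_assoc (x.fst * y.fst * w.fst), ← zpw_add]
        congr 2
        ring
      · simp [mul_def, mul_assoc])
    (by intro x; ext <;> simp [mul_def, one_def, d_one, zpw_zero])
    (by
      intro x
      ext
      · simp only [mul_def, inv_def, one_def, d_inv]
        rw [mul_assoc x.fst⁻¹, zpw_comm, ← mul_assoc, inv_mul_cancel, one_mul, ← zpw_add]
        have : ∀ a : ZMod 2, a + a = 0 := by decide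
        rw [this, zpw_zero]
      · simp [mul_def, inv_def, one_def])

instance [Finite G] [Finite H] : Finite (TwistedProd G H) :=
  Finite.of_injective (fun x => (x.fst, x.snd)) (by
    intro x y h
    rw [Prod.mk.injEq] at h
    exact TwistedProd.ext h.1 h.2)

/-- The subgroup `{(1, 1), (z, z)}`. -/
def diagZ (G : Type u) (H : Type v) [Group G] [Group H] [SpinData G] [SpinData H] :
    Subgroup (TwistedProd G H) where
  carrier := {⟨1, 1⟩, ⟨z, z⟩}
  one_mem' := Or.inl rfl
  mul_mem' := by
    rintro _ _ (rfl | rfl) (rfl | rfl) <;>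
      simp [mul_def, d_one, d_z, zpw_zero, z_mul_z]
  inv_mem' := by
    have h1 : (z : G)⁻¹ = z := inv_eq_of_mul_eq_one_left z_mul_z
    have h2 : (z : H)⁻¹ = z := inv_eq_of_mul_eq_one_left z_mul_z
    rintro _ (rfl | rfl) <;> simp [inv_def, d_one, d_z, zpw_zero, h1, h2]

theorem z_z_comm (x : TwistedProd G H) : ⟨z, z⟩ * x = x * ⟨z, z⟩ := by
  simp [mul_def, d_z, zpw_zero, z_comm]

instance : (diagZ G H).Normal where
  conj_mem := by
    rintro _ (rfl | rfl) x
    · left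
      change x * 1 * x⁻¹ = 1
      group
    · right
      rw [← z_z_comm, mul_inv_cancel_right]
      rfl

end TwistedProd

/-- The spin product `G ×̂ H = (G ×̃ H) / {(1, 1), (z, z)}`. -/
abbrev SpinProd (G : Type u) (H : Type v) [Group G] [Group H] [SpinData G] [SpinData H] :
    Type (max u v) :=
  TwistedProd G H ⧸ TwistedProd.diagZ G H

namespace SpinProd

variable {G : Type u} {H : Type v} [Group G] [Group H] [SpinData G] [SpinData H]

/-- The class of `(t, s)` in the spin product. -/
def mk (t : G) (s : H) : SpinProd G H := QuotientGroup.mk ⟨t, s⟩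

/-- The parity `d(t, s) = d(t) + d(s)` of the twisted product. -/
def parityHom (G : Type u) (H : Type v) [Group G] [Group H] [SpinData G] [SpinData H] :
    TwistedProd G H →* Multiplicative (ZMod 2) where
  toFun x := Multiplicative.ofAdd (d x.fst + d x.snd)
  map_one' := by simp [TwistedProd.one_def, d_one]
  map_mul' x y := by
    rw [← ofAdd_add, TwistedProd.mul_def]
    simp only [d_mul, d_zpw, add_zero]
    congr 1
    ring

/-- The central element is the class of `(z, 1)`, which is also the class of `(1, z)`; the parity is
`d(t, s) = d(t) + d(s)`. -/
instance instSpinData : SpinData (SpinProd G H) where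
  z := mk z 1
  z_mul_z := by
    change ((⟨z, 1⟩ * ⟨z, 1⟩ : TwistedProd G H) : SpinProd G H) = ((1 : TwistedProd G H) : _)
    simp [TwistedProd.mul_def, TwistedProd.one_def, d_one, zpw_zero, z_mul_z]
  z_comm x := by
    induction x using QuotientGroup.induction_on with
    | H x =>
      change ((⟨z, 1⟩ * x : TwistedProd G H) : SpinProd G H) = ((x * ⟨z, 1⟩ : TwistedProd G H) : _)
      simp [TwistedProd.mul_def, d_one, d_z, zpw_zero, z_comm]
  d x := (QuotientGroup.lift (TwistedProd.diagZ G H) (parityHom G H) (by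
    rintro _ (rfl | rfl) <;> simp [parityHom, d_one, d_z]) x).toAdd
  d_mul x y := by simp
  d_z := by
    change d z + d 1 = 0
    simp [d_z, d_one]

theorem d_mk (t : G) (s : H) : d (mk t s) = d t + d s := rfl

theorem z_mul_mk (t : G) (s : H) : z * mk t s = mk (z * t) s := by
  change ((⟨z, 1⟩ * ⟨t, s⟩ : TwistedProd G H) : SpinProd G H) = _
  simp [TwistedProd.mul_def, d_one, zpw_zero, mk]

end SpinProd

/-! ### The embedding of the spin product of spin wreath products -/

section SuperCommute

variable {G : Type u} [Group G] [SpinData G]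

/-- `a` and `b` commute up to the factor `z ^ (d(a) d(b))`. -/
def SuperCommute (a b : G) : Prop := a * b = b * a * zpw (d a * d b)

theorem zpw_mul_self (e : ZMod 2) : (zpw e * zpw e : G) = 1 := by
  rw [← zpw_add]
  have : ∀ a : ZMod 2, a + a = 0 := by decide
  rw [this, zpw_zero]

theorem SuperCommute.symm {a b : G} (h : SuperCommute a b) : SuperCommute b a := by
  unfold SuperCommute at h ⊢
  rw [h, mul_assoc, mul_comm (d b), zpw_mul_self, mul_one]

theorem SuperCommute.z_right (a : G) : SuperCommute a z := by
  simp [SuperCommute, d_z, zpw_zero, z_comm]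

theorem SuperCommute.one_right (a : G) : SuperCommute a 1 := by
  simp [SuperCommute, d_one, zpw_zero]

theorem SuperCommute.mul_right {a b c : G} (h : SuperCommute a b) (h' : SuperCommute a c) :
    SuperCommute a (b * c) := by
  unfold SuperCommute at h h' ⊢
  rw [← mul_assoc, h, mul_assoc (b * a), zpw_comm, ← mul_assoc, mul_assoc b, h', d_mul, mul_add,
    zpw_add, zpw_comm (d a * d b) (zpw (d a * d c))]
  simp only [mul_assoc]

theorem SuperCommute.inv_right {a b : G} (h : SuperCommute a b) : SuperCommute a b⁻¹ := by
  unfold SuperCommute at h ⊢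
  rw [d_inv]
  have h1 : a * b * zpw (d a * d b) = b * a := by
    rw [h, mul_assoc, zpw_mul_self, mul_one]
  have h2 : b⁻¹ * (a * b * zpw (d a * d b)) * b⁻¹ = a * b⁻¹ := by
    rw [h1]; group
  rw [← h2, mul_assoc b⁻¹, mul_assoc (a * b), zpw_comm]
  group

end SuperCommute

namespace SpinSym

theorem superCommute_of_gen {n m : ℕ} (f : SpinSym m →* SpinSym n) (hf : f zz = zz)
    (a : SpinSym n) (h : ∀ i hi, SuperCommute a (f (tt i hi))) (x : SpinSym m) :
    SuperCommute a (f x) := by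
  induction x using SpinSym.induction with
  | hz => rw [hf]; exact SuperCommute.z_right a
  | ht i hi => exact h i hi
  | h1 => rw [map_one]; exact SuperCommute.one_right a
  | hm x y hx hy => rw [map_mul]; exact hx.mul_right hy
  | hi x hx => rw [map_inv]; exact hx.inv_right

theorem superCommute_shift (k l n : ℕ) (h : k + l ≤ n) (y : SpinSym l) (x : SpinSym k) :
    SuperCommute (shift k l n h y) (shift 0 k n (by omega) x) := by
  refine superCommute_of_gen _ rfl _ (fun i hi => ?_) x
  refine (superCommute_of_gen _ rfl _ (fun j hj => ?_) y).symm
  refine SuperCommute.symm ?_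
  rw [SuperCommute, shift_tt, shift_tt, d_tt, d_tt, mul_one, zpw_one, ← z_comm, ← mul_assoc]
  exact tt_far _ _ _ _ (by omega)

end SpinSym

namespace SpinWr

variable (Γ : Type u) [Group Γ]

theorem inr_zpw (n : ℕ) (e : ZMod 2) :
    (SemidirectProduct.inr (zpw e) : SpinWr Γ n) = zpw e := by
  rcases zmod_two_cases e with rfl | rfl
  · rw [zpw_zero, zpw_zero, map_one]
  · rw [zpw_one, zpw_one]; rfl

theorem superCommute_shift (k l n : ℕ) (h : k + l ≤ n) (y : SpinWr Γ l) (x : SpinWr Γ k) :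
    SuperCommute (shift Γ k l n h y) (shift Γ 0 k n (by omega) x) := by
  unfold SuperCommute
  rw [d_shift, d_shift, ← inr_zpw]
  have hcomm := SpinSym.superCommute_shift k l n h y.right x.right
  rw [SuperCommute, SpinSym.d_shift, SpinSym.d_shift] at hcomm
  have hy := theta_shift_in k l n h y.right⁻¹
  have hx := theta_shift_in 0 k n (by omega) x.right⁻¹
  ext1
  · ext i
    have e1 : (SpinSym.theta n (SpinSym.shift k l n h y.right))⁻¹ =
      SpinSym.theta n (SpinSym.shift k l n h y.right⁻¹) := by rw [map_inv, map_inv]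
    have e2 : (SpinSym.theta n (SpinSym.shift 0 k n (by omega) x.right))⁻¹ =
      SpinSym.theta n (SpinSym.shift 0 k n (by omega) x.right⁻¹) := by rw [map_inv, map_inv]
    rw [SemidirectProduct.mul_left, SemidirectProduct.mul_left, SemidirectProduct.mul_left,
      SemidirectProduct.left_inr, map_one, mul_one]
    change shiftBase Γ k l n y.left i * shiftBase Γ 0 k n x.left
        ((SpinSym.theta n (SpinSym.shift k l n h y.right))⁻¹ i) =
      shiftBase Γ 0 k n x.left i * shiftBase Γ k l n y.left
        ((SpinSym.theta n (SpinSym.shift 0 k n (by omega) x.right))⁻¹ i)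
    rw [e1, e2]
    by_cases c1 : i.1 < k
    · rw [hy.2 i (by omega)]
      have c2 := hx.1 ⟨i.1, c1⟩
      have c3 : (⟨0 + i.1, by omega⟩ : Fin n) = i := by ext; simp
      simp only [c3] at c2
      rw [c2]
      have c4 : ∀ j : Fin n, j.1 < k → shiftBase Γ k l n y.left j = 1 := by
        intro j hj
        exact dif_neg (by omega)
      rw [c4 i c1, c4 _ (by simp), one_mul, mul_one]
    · have c4 : ∀ j : Fin n, k ≤ j.1 → shiftBase Γ 0 k n x.left j = 1 := by
        intro j hj
        exact dif_neg (by omega)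
      rw [hx.2 i (by omega), c4 i (by omega), one_mul, c4, mul_one]
      by_cases c5 : i.1 < k + l
      · have c2 := hy.1 ⟨i.1 - k, by omega⟩
        have c3 : (⟨k + (i.1 - k), by omega⟩ : Fin n) = i := by ext; simp; omega
        simp only [c3] at c2
        rw [c2]
        simp
      · rw [hy.2 i (by omega)]
        omega
  · rw [SemidirectProduct.mul_right, SemidirectProduct.mul_right, SemidirectProduct.mul_right,
      SemidirectProduct.right_inr]
    exact hcomm

/-- The map `(Γ ≀ S̃_k) ×̃ (Γ ≀ S̃_l) → Γ ≀ S̃_n`, for `k + l = n`, given by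
`((g, t_i), 1) ↦ (g, t_i)` and `(1, (g, t_j)) ↦ (g, t_{k+j})`. -/
def preEmb (k l n : ℕ) (h : k + l = n) :
    TwistedProd (SpinWr Γ k) (SpinWr Γ l) →* SpinWr Γ n where
  toFun x := shift Γ 0 k n (by omega) x.fst * shift Γ k l n h.le x.snd
  map_one' := by simp [TwistedProd.one_def]
  map_mul' x y := by
    have hc := superCommute_shift Γ k l n h.le x.snd y.fst
    rw [SuperCommute, d_shift, d_shift] at hc
    have hz : ∀ e : ZMod 2, shift Γ 0 k n (by omega) (zpw e) = zpw e := by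
      intro e
      rcases zmod_two_cases e with rfl | rfl
      · rw [zpw_zero, zpw_zero, map_one]
      · rw [zpw_one, zpw_one, shift_z]
    rw [TwistedProd.mul_def]
    simp only [map_mul, hz]
    rw [mul_assoc (shift Γ 0 k n _ x.fst) (shift Γ k l n _ x.snd),
      ← mul_assoc (shift Γ k l n _ x.snd), hc]
    simp only [mul_assoc]
    rw [zpw_comm, zpw_comm]
    simp only [mul_assoc]

/-- The canonical embedding `(Γ ≀ S̃_k) ×̂ (Γ ≀ S̃_l) → Γ ≀ S̃_n` for `k + l = n`. -/
def emb (k l n : ℕ) (h : k + l = n) : SpinProd (SpinWr Γ k) (SpinWr Γ l) →* SpinWr Γ n :=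
  QuotientGroup.lift _ (preEmb Γ k l n h) (by
    rintro _ (rfl | rfl)
    · exact map_one _
    · change shift Γ 0 k n _ z * shift Γ k l n _ z = 1
      rw [shift_z, shift_z, z_mul_z])

theorem emb_z (k l n : ℕ) (h : k + l = n) : emb Γ k l n h z = z := by
  change shift Γ 0 k n _ z * shift Γ k l n _ 1 = z
  rw [shift_z, map_one, mul_one]

theorem d_emb (k l n : ℕ) (h : k + l = n) (x : SpinProd (SpinWr Γ k) (SpinWr Γ l)) :
    d (emb Γ k l n h x) = d x := by
  induction x using QuotientGroup.induction_on with
  | H x =>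
    change d (shift Γ 0 k n _ x.fst * shift Γ k l n _ x.snd) = d x.fst + d x.snd
    rw [d_mul, d_shift, d_shift]

end SpinWr

/-! ### Spin super class functions -/

/-- The space `R⁻(G)` of spin super class functions: class functions `f : G → ℂ` with
`f (z x) = - f x` that vanish on the odd elements of `G`. (A spin class function vanishes
automatically at every `x` that is conjugate to `z x`.) -/
def SpinSuper (G : Type u) [Group G] [SpinData G] : Submodule ℂ (G → ℂ) where
  carrier := {f | (∀ x y, f (y * x * y⁻¹) = f x) ∧ (∀ x, f (z * x) = - f x) ∧
    ∀ x, d x = 1 → f x = 0}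
  zero_mem' := by simp
  add_mem' := by
    rintro f g ⟨f1, f2, f3⟩ ⟨g1, g2, g3⟩
    refine ⟨fun x y => ?_, fun x => ?_, fun x hx => ?_⟩
    · simp [f1, g1]
    · simp [f2, g2]; ring
    · simp [f3 x hx, g3 x hx]
  smul_mem' := by
    rintro c f ⟨f1, f2, f3⟩
    refine ⟨fun x y => ?_, fun x => ?_, fun x hx => ?_⟩
    · simp [f1]
    · simp [f2]
    · simp [f3 x hx]

section Operations

variable {G : Type u} {H : Type v} [Group G] [Group H] [SpinData G] [SpinData H]

/-- Restriction of spin super class functions along a homomorphism preserving `z` and the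
parity. -/
def res (ι : H →* G) (hz : ι z = z) (hd : ∀ x, d (ι x) = d x) : SpinSuper G →ₗ[ℂ] SpinSuper H where
  toFun f := ⟨fun x => f.1 (ι x), fun x y => by simp [f.2.1],
    fun x => by simp [hz, f.2.2.1], fun x hx => f.2.2.2 _ (by rw [hd, hx])⟩
  map_add' _ _ := rfl
  map_smul' _ _ := rfl

open Classical in
/-- The values of the induced class function along `ι : H → G`:
`(Ind f)(x) = |H|⁻¹ ∑_{g ∈ G} ∑_{h ∈ H, ι h = g⁻¹ x g} f h`. -/
noncomputable def indFun (ι : H →* G) (f : H → ℂ) (x : G) : ℂ :=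
  (Nat.card H : ℂ)⁻¹ * ∑ᶠ p : G × H, if ι p.2 = p.1⁻¹ * x * p.1 then f p.2 else 0

/-- Induction of spin super class functions along a homomorphism of finite groups preserving `z`
and the parity. -/
noncomputable def ind [Finite G] [Finite H] (ι : H →* G) (hz : ι z = z)
    (hd : ∀ x, d (ι x) = d x) : SpinSuper H →ₗ[ℂ] SpinSuper G where
  toFun f := ⟨indFun ι f.1, by
    refine ⟨fun x y => ?_, fun x => ?_, fun x hx => ?_⟩
    · unfold indFun
      congr 1
      refine finsum_eq_of_bijective
        (fun p : G × H => (y⁻¹ * p.1, p.2)) ?_ ?_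
      · exact ((Equiv.mulLeft y⁻¹).prodCongr (Equiv.refl H)).bijective
      · rintro ⟨g, h⟩
        have e : g⁻¹ * (y * x * y⁻¹) * g = (y⁻¹ * g)⁻¹ * x * (y⁻¹ * g) := by group
        dsimp only
        rw [e]
    · unfold indFun
      rw [← mul_neg, ← finsum_neg_distrib]
      congr 1
      refine finsum_eq_of_bijective
        (fun p : G × H => (p.1, z * p.2)) ?_ ?_
      · exact ((Equiv.refl G).prodCongr (Equiv.mulLeft z)).bijective
      · rintro ⟨g, h⟩
        have e : g⁻¹ * (z * x) * g = z * (g⁻¹ * x * g) := by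
          rw [← mul_assoc g⁻¹, ← z_comm]; simp only [mul_assoc]
        have e2 : ι h = z * (g⁻¹ * x * g) ↔ ι (z * h) = g⁻¹ * x * g := by
          rw [map_mul, hz]
          constructor
          · intro h'; rw [h', ← mul_assoc, z_mul_z, one_mul]
          · intro h'; rw [← h', ← mul_assoc, z_mul_z, one_mul]
        dsimp only
        rw [f.2.2.1, e]
        split_ifs with c1 c2 c2
        · exact (neg_neg _).symm
        · exact absurd (e2.1 c1) c2
        · exact absurd (e2.2 c2) c1
        · exact neg_zero.symm
    · unfold indFun
      rw [finsum_eq_zero_of_forall_eq_zero, mul_zero]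
      rintro ⟨g, h⟩
      simp only
      split_ifs with hh
      · refine f.2.2.2 _ ?_
        rw [← hd, hh, d_mul, d_mul, d_inv, hx]
        have : ∀ a : ZMod 2, a + 1 + a = 1 := by decide
        exact this _
      · rfl⟩
  map_add' f f' := by
    ext x
    simp only [indFun, Submodule.coe_add, Pi.add_apply]
    rw [← mul_add, ← finsum_add_distrib (Set.toFinite _) (Set.toFinite _)]
    congr 1
    refine finsum_congr fun p => ?_
    split_ifs <;> simp
  map_smul' c f := by
    ext x
    simp only [indFun, Submodule.coe_smul, Pi.smul_apply, smul_eq_mul, RingHom.id_apply]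
    rw [mul_left_comm, ← smul_eq_mul (a := c), smul_finsum]
    congr 1
    refine finsum_congr fun p => ?_
    split_ifs <;> simp

/-- The outer product of two spin super class functions: the function on the spin product with
`[t, s] ↦ f t * g s`. -/
def outerFun (f : SpinSuper G) (g : SpinSuper H) : SpinSuper (SpinProd G H) :=
  ⟨fun x => Quotient.liftOn' x (fun p => f.1 p.fst * g.1 p.snd) (by
      intro a b hab
      rw [QuotientGroup.leftRel_apply] at hab
      obtain ⟨w, rfl⟩ : ∃ w, b = a * w := ⟨a⁻¹ * b, by group⟩
      rw [inv_mul_cancel_left] at hab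
      rcases hab with rfl | rfl
      · simp [TwistedProd.mul_def, d_one, zpw_zero]
      · simp [TwistedProd.mul_def, d_z, zpw_zero, ← z_comm, f.2.2.1, g.2.2.1]), by
    have hodd : ∀ (t : G) (s : H), (d t ≠ 0 ∨ d s ≠ 0) → f.1 t * g.1 s = 0 := by
      rintro t s (h | h)
      · rw [f.2.2.2 t ((zmod_two_cases _).resolve_left h), zero_mul]
      · rw [g.2.2.2 s ((zmod_two_cases _).resolve_left h), mul_zero]
    refine ⟨fun x y => ?_, fun x => ?_, fun x hx => ?_⟩
    · induction x using QuotientGroup.induction_on with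
      | H x =>
      induction y using QuotientGroup.induction_on with
      | H y =>
      change f.1 (y * x * y⁻¹).fst * g.1 (y * x * y⁻¹).snd = f.1 x.fst * g.1 x.snd
      have hd2 : d (y * x * y⁻¹).snd = d x.snd := by
        simp only [TwistedProd.mul_def, TwistedProd.inv_def, d_mul, d_inv]
        have : ∀ a b : ZMod 2, a + b + a = b := by decide
        exact this _ _
      have hd1 : d (y * x * y⁻¹).fst = d x.fst := by
        simp only [TwistedProd.mul_def, TwistedProd.inv_def, d_mul, d_inv, d_zpw]
        have : ∀ a b : ZMod 2, a + b + 0 + (a + 0) + 0 = b := by decide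
        exact this _ _
      by_cases hx : d x.fst = 0 ∧ d x.snd = 0
      · have e1 : (y * x * y⁻¹).fst = y.fst * x.fst * y.fst⁻¹ := by
          simp only [TwistedProd.mul_def, TwistedProd.inv_def, d_mul, d_inv, d_zpw, hx.1, hx.2,
            mul_zero, add_zero, zpw_zero, mul_one]
          rw [mul_assoc, mul_assoc y.fst⁻¹, zpw_mul_self, mul_one]
        have e2 : (y * x * y⁻¹).snd = y.snd * x.snd * y.snd⁻¹ := rfl
        rw [e1, e2, f.2.1, g.2.1]
      · rw [hodd, hodd]
        · tauto
        · rw [hd1, hd2]; tauto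
    · induction x using QuotientGroup.induction_on with
      | H x =>
      rw [show ((x : TwistedProd G H) : SpinProd G H) = SpinProd.mk x.fst x.snd from rfl,
        SpinProd.z_mul_mk]
      change f.1 (z * x.fst) * g.1 x.snd = - (f.1 x.fst * g.1 x.snd)
      rw [f.2.2.1, neg_mul]
    · induction x using QuotientGroup.induction_on with
      | H x =>
      change d x.fst + d x.snd = 1 at hx
      refine hodd _ _ ?_
      by_contra! hc
      rw [hc.1, hc.2] at hx
      exact absurd hx (by decide)⟩

variable (G H) in
/-- The map `φ : R⁻(G) ⊗ R⁻(H) → R⁻(G ×̂ H)`, `φ(f ⊗ g)([t, s]) = f t * g s`. -/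
noncomputable def phi : SpinSuper G ⊗[ℂ] SpinSuper H →ₗ[ℂ] SpinSuper (SpinProd G H) :=
  TensorProduct.lift (LinearMap.mk₂ ℂ outerFun
    (by
      intro f f' g; ext x
      induction x using QuotientGroup.induction_on with
      | H x => exact add_mul _ _ _)
    (by
      intro c f g; ext x
      induction x using QuotientGroup.induction_on with
      | H x => exact mul_assoc _ _ _)
    (by
      intro f g g'; ext x
      induction x using QuotientGroup.induction_on with
      | H x => exact mul_add _ _ _)
    (by
      intro c f g; ext x
      induction x using QuotientGroup.induction_on with
      | H x => exact mul_left_comm _ _ _))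

theorem phi_tmul_mk (f : SpinSuper G) (g : SpinSuper H) (t : G) (s : H) :
    (phi G H (f ⊗ₜ g)).1 (SpinProd.mk t s) = f.1 t * g.1 s := rfl

end Operations

/-! ### Spin supermodules and their super tensor product -/

/-- A spin supermodule of `G` on the complex vector space `V`: a
`ℤ/2`-grading `V = V_0 ⊕ V_1` and a representation of `G` on `V` with `g V_i ⊆ V_{d(g)+i}` in
which `z` acts as `-1`. -/
structure SpinSupermodule (G : Type u) [Group G] [SpinData G] (V : Type w) [AddCommGroup V]
    [Module ℂ V] where
  rep : Representation ℂ G V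
  deg : ZMod 2 → Submodule ℂ V
  isCompl : IsCompl (deg 0) (deg 1)
  rep_mem : ∀ (g : G) (i : ZMod 2), ∀ v ∈ deg i, rep g v ∈ deg (d g + i)
  rep_z : ∀ v, rep z v = - v

namespace SpinSupermodule

variable {G : Type u} {H : Type v} [Group G] [Group H] [SpinData G] [SpinData H]
  {U V : Type w} [AddCommGroup U] [Module ℂ U] [AddCommGroup V] [Module ℂ V]

/-- The sign `(-1) ^ e` for an exponent `e` modulo `2`. -/
def sgn (e : ZMod 2) : ℂ := (-1) ^ e.val

theorem sgn_zero : sgn 0 = 1 := by simp [sgn]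

theorem sgn_one : sgn 1 = -1 := by simp [sgn, ZMod.val_one]

theorem sgn_add (a b : ZMod 2) : sgn (a + b) = sgn a * sgn b := by
  have h11 : (1 : ZMod 2) + 1 = 0 := by decide
  rcases zmod_two_cases a with rfl | rfl <;> rcases zmod_two_cases b with rfl | rfl <;>
    simp [sgn_zero, sgn_one, h11]

theorem rep_zpw (M : SpinSupermodule G U) (e : ZMod 2) (u : U) :
    M.rep (zpw e) u = sgn e • u := by
  rcases zmod_two_cases e with rfl | rfl
  · simp [zpw_zero, sgn_zero]
  · simp [zpw_one, sgn_one, M.rep_z]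

/-- The operator `u ↦ (-1) ^ (e d(u)) u` (for homogeneous `u`). -/
noncomputable def par (M : SpinSupermodule G U) (e : ZMod 2) : U →ₗ[ℂ] U :=
  LinearMap.ofIsCompl M.isCompl (M.deg 0).subtype (sgn e • (M.deg 1).subtype)

theorem par_apply (M : SpinSupermodule G U) (e i : ZMod 2) {u : U} (hu : u ∈ M.deg i) :
    M.par e u = sgn (e * i) • u := by
  rcases zmod_two_cases i with rfl | rfl
  · rw [par, show u = ((⟨u, hu⟩ : M.deg 0) : U) from rfl, LinearMap.ofIsCompl_apply_left]
    simp [sgn_zero]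
  · rw [par, show u = ((⟨u, hu⟩ : M.deg 1) : U) from rfl, LinearMap.ofIsCompl_apply_right]
    simp

theorem hom_ext_deg (M : SpinSupermodule G U) {W : Type*} [AddCommGroup W] [Module ℂ W]
    {f g : U →ₗ[ℂ] W} (h : ∀ i, ∀ u ∈ M.deg i, f u = g u) : f = g := by
  ext u
  have hu : u ∈ M.deg 0 ⊔ M.deg 1 := by rw [M.isCompl.sup_eq_top]; trivial
  obtain ⟨a, ha, b, hb, rfl⟩ := Submodule.mem_sup.1 hu
  rw [map_add, map_add, h 0 a ha, h 1 b hb]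

theorem par_zero (M : SpinSupermodule G U) : M.par 0 = LinearMap.id :=
  M.hom_ext_deg fun i u hu => by rw [par_apply M 0 i hu]; simp [sgn_zero]

theorem par_par (M : SpinSupermodule G U) (e e' : ZMod 2) :
    M.par e ∘ₗ M.par e' = M.par (e + e') :=
  M.hom_ext_deg fun i u hu => by
    rw [LinearMap.comp_apply, par_apply M e' i hu, map_smul, par_apply M e i hu,
      par_apply M _ i hu, smul_smul, ← sgn_add]
    congr 2; ring

theorem par_rep (M : SpinSupermodule G U) (e : ZMod 2) (g : G) :
    M.par e ∘ₗ M.rep g = sgn (e * d g) • (M.rep g ∘ₗ M.par e) :=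
  M.hom_ext_deg fun i u hu => by
    rw [LinearMap.comp_apply, par_apply M e _ (M.rep_mem g i u hu), LinearMap.smul_apply,
      LinearMap.comp_apply, par_apply M e i hu, map_smul, smul_smul, ← sgn_add, ← mul_add]

/-- The character of a spin supermodule, as a spin super class function. -/
noncomputable def character (M : SpinSupermodule G U) : SpinSuper G :=
  ⟨fun x => LinearMap.trace ℂ U (M.rep x), by
    refine ⟨fun x y => ?_, fun x => ?_, fun x hx => ?_⟩
    · beta_reduce
      rw [map_mul, LinearMap.trace_mul_comm, ← map_mul]
      congr 2
      group
    · have : M.rep (z * x) = - M.rep x := by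
        ext u
        rw [map_mul, Module.End.mul_apply, M.rep_z]
        rfl
      beta_reduce
      rw [this, map_neg]
    · have h1 := M.par_rep 1 x
      rw [hx, mul_one, sgn_one] at h1
      have h11 : (1 : ZMod 2) + 1 = 0 := by decide
      have h2 : (M.par 1 * (M.rep x * M.par 1) : Module.End ℂ U) = - M.rep x := by
        have : (M.par 1 * M.rep x : Module.End ℂ U) = (-1 : ℂ) • (M.rep x * M.par 1) := h1
        rw [← mul_assoc, this, smul_mul_assoc, mul_assoc,
          show (M.par 1 * M.par 1 : Module.End ℂ U) = 1 by
            have := M.par_par 1 1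
            rw [h11, par_zero] at this
            exact this]
        simp
      have h3 := congrArg (LinearMap.trace ℂ U) h2
      rw [LinearMap.trace_mul_comm, mul_assoc,
          show (M.par 1 * M.par 1 : Module.End ℂ U) = 1 by
            have := M.par_par 1 1
            rw [h11, par_zero] at this
            exact this, mul_one, map_neg] at h3
      exact self_eq_neg.1 h3⟩

/-- The operator by which `(t, s)` acts on the super tensor product: for homogeneous `u`,
`(t, s) (u ⊗ v) = (-1) ^ (d(s) d(u)) (t u ⊗ s v)`. -/
noncomputable def tensorOp (M : SpinSupermodule G U) (N : SpinSupermodule H V)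
    (p : TwistedProd G H) : Module.End ℂ (U ⊗[ℂ] V) :=
  TensorProduct.map (M.rep p.fst ∘ₗ M.par (d p.snd)) (N.rep p.snd)

theorem tensorOp_tmul (M : SpinSupermodule G U) (N : SpinSupermodule H V)
    (p : TwistedProd G H) (i : ZMod 2) {u : U} (hu : u ∈ M.deg i) (v : V) :
    M.tensorOp N p (u ⊗ₜ v) = sgn (d p.snd * i) • (M.rep p.fst u ⊗ₜ[ℂ] N.rep p.snd v) := by
  rw [tensorOp, TensorProduct.map_tmul, LinearMap.comp_apply, par_apply M _ i hu, map_smul,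
    TensorProduct.smul_tmul']

/-- The super (outer) tensor product of spin supermodules of `G` and `H`, a representation of the
spin product `G ×̂ H`. -/
noncomputable def superTensor (M : SpinSupermodule G U) (N : SpinSupermodule H V) :
    Representation ℂ (SpinProd G H) (U ⊗[ℂ] V) :=
  QuotientGroup.lift (TwistedProd.diagZ G H)
    { toFun := M.tensorOp N
      map_one' := by
        simp only [tensorOp, TwistedProd.one_def, map_one, d_one, par_zero]
        exact TensorProduct.map_id
      map_mul' := by
        intro p q
        rw [TwistedProd.mul_def]
        simp only [tensorOp]
        rw [Module.End.mul_eq_comp, ← TensorProduct.map_comp, map_mul N.rep]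
        congr 1
        refine M.hom_ext_deg fun i u hu => ?_
        simp only [LinearMap.comp_apply, map_mul, Module.End.mul_apply, d_mul]
        rw [par_apply M _ i hu, par_apply M _ i hu, rep_zpw]
        simp only [map_smul]
        rw [par_apply M _ _ (M.rep_mem q.fst i u hu)]
        simp only [map_smul, smul_smul, ← sgn_add]
        congr 2
        ring }
    (by
      rintro _ (rfl | rfl)
      · exact map_one _
      · change M.tensorOp N ⟨z, z⟩ = 1
        refine TensorProduct.ext' fun u v => ?_
        simp [tensorOp, d_z, par_zero, M.rep_z, N.rep_z, TensorProduct.neg_tmul,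
          TensorProduct.tmul_neg])

end SpinSupermodule

/-! ### The space `R⁻_Γ` and its operations -/

section Hopf

variable (Γ : Type u) [Group Γ]

/-- `R⁻_Γ = ⨁_{n ≥ 0} R⁻(Γ ≀ S̃_n)`. -/
abbrev RMinus (Γ : Type u) [Group Γ] : Type u := ⨁ n : ℕ, SpinSuper (SpinWr Γ n)

/-- The inclusion of `R⁻(Γ ≀ S̃_n)` in `R⁻_Γ`. -/
noncomputable abbrev incl (n : ℕ) : SpinSuper (SpinWr Γ n) →ₗ[ℂ] RMinus Γ :=
  DirectSum.lof ℂ ℕ (fun n => SpinSuper (SpinWr Γ n)) n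

/-- Induction from the spin product to `Γ ≀ S̃_n`. -/
noncomputable def indEmb [Finite Γ] (k l n : ℕ) (h : k + l = n) :
    SpinSuper (SpinProd (SpinWr Γ k) (SpinWr Γ l)) →ₗ[ℂ] SpinSuper (SpinWr Γ n) :=
  ind (SpinWr.emb Γ k l n h) (SpinWr.emb_z Γ k l n h) (SpinWr.d_emb Γ k l n h)

/-- Restriction from `Γ ≀ S̃_n` to the spin product. -/
def resEmb (k l n : ℕ) (h : k + l = n) :
    SpinSuper (SpinWr Γ n) →ₗ[ℂ] SpinSuper (SpinProd (SpinWr Γ k) (SpinWr Γ l)) :=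
  res (SpinWr.emb Γ k l n h) (SpinWr.emb_z Γ k l n h) (SpinWr.d_emb Γ k l n h)

/-- The multiplication `R⁻_Γ ⊗ R⁻_Γ → R⁻_Γ`, given on `R⁻(Γ ≀ S̃_k) ⊗ R⁻(Γ ≀ S̃_l)` by `φ`
followed by induction. -/
noncomputable def mulMap [Finite Γ] : RMinus Γ ⊗[ℂ] RMinus Γ →ₗ[ℂ] RMinus Γ :=
  TensorProduct.lift (DirectSum.toModule ℂ ℕ _ fun k =>
    LinearMap.flip (DirectSum.toModule ℂ ℕ _ fun l =>
      LinearMap.flip (TensorProduct.curry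
        (incl Γ (k + l) ∘ₗ indEmb Γ k l (k + l) rfl ∘ₗ phi (SpinWr Γ k) (SpinWr Γ l)))))

theorem mulMap_incl [Finite Γ] (k l : ℕ) (f : SpinSuper (SpinWr Γ k)) (g : SpinSuper (SpinWr Γ l)) :
    mulMap Γ (incl Γ k f ⊗ₜ incl Γ l g) =
      incl Γ (k + l) (indEmb Γ k l (k + l) rfl (phi (SpinWr Γ k) (SpinWr Γ l) (f ⊗ₜ g))) := by
  simp [mulMap]

/-- The comultiplication `R⁻_Γ → R⁻_Γ ⊗ R⁻_Γ`, given on `R⁻(Γ ≀ S̃_n)` by restriction to the spin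
products `(Γ ≀ S̃_k) ×̂ (Γ ≀ S̃_l)`, `k + l = n`, followed by the inverse of `φ`. -/
noncomputable def comulMap
    (hphi : ∀ k l : ℕ, Function.Bijective (phi (SpinWr Γ k) (SpinWr Γ l))) :
    RMinus Γ →ₗ[ℂ] RMinus Γ ⊗[ℂ] RMinus Γ :=
  DirectSum.toModule ℂ ℕ _ fun n =>
    ∑ p : Finset.HasAntidiagonal.antidiagonal n,
      TensorProduct.map (incl Γ p.1.1) (incl Γ p.1.2) ∘ₗ
        (LinearEquiv.ofBijective _ (hphi p.1.1 p.1.2)).symm.toLinearMap ∘ₗ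
          resEmb Γ p.1.1 p.1.2 n (Finset.HasAntidiagonal.mem_antidiagonal.1 p.2)

theorem comulMap_incl (hphi : ∀ k l : ℕ, Function.Bijective (phi (SpinWr Γ k) (SpinWr Γ l)))
    (n : ℕ) (f : SpinSuper (SpinWr Γ n)) :
    comulMap Γ hphi (incl Γ n f) = ∑ p : Finset.HasAntidiagonal.antidiagonal n,
      TensorProduct.map (incl Γ p.1.1) (incl Γ p.1.2)
        ((LinearEquiv.ofBijective _ (hphi p.1.1 p.1.2)).symm
          (resEmb Γ p.1.1 p.1.2 n (Finset.HasAntidiagonal.mem_antidiagonal.1 p.2) f)) := by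
  simp [comulMap]

end Hopf

end SpinWreath

open SpinWreath

/-!
Write `G_n = Γ ≀ S̃_n` and `R = R⁻_Γ`.

The group-theoretic input is the structure of `S̃_n`. The assignment `z ↦ -1`,
`t_i ↦ e_i - e_{i+1}` is a representation in the units of a Clifford algebra (`SpinSym.clifford`),
so `z ≠ 1`; a normal form shows that the kernel of `S̃_n → S_n` is `{1, z}`. Hence an element of
`S̃_n` is determined by its permutation and its Clifford image, which gives the conjugation rule
`SpinSym.mul_shift_eq`: a lift `w` of a permutation that translates a block of points translates
the elements `x` of the spin group of this block, up to the sign `z ^ (d w * d x)`. It follows that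
the spin product of `G_k` and `G_l` embeds in `G_{k+l}`, with image the elements whose permutation
preserves the first `k` points (`SpinWr.emb_injective`, `SpinWr.mem_range_emb`).

A spin super class function on a spin product vanishes at `[t, s]` unless `t` and `s` are both even:
a pair of odd elements is conjugate to its product with `z`. Therefore its sections are spin super
class functions on the factors, and `phi` is bijective (`phi_bijective`).

Evaluation functionals `ev x` on `R` separate points, and so do their tensor products on tensor
powers of `R`. The comultiplication `Δ` satisfies `(ev a ⊗ ev b) ∘ Δ = ev (emb (a, b))`
(`dd_ev_comulR`), so the coalgebra axioms reduce to associativity and unit laws of `emb`. By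
Frobenius reciprocity the multiplication is dual to `Δ` for the nondegenerate pairing
`|G_n|⁻¹ ∑ f g` (`pairing_mulMap`), so the algebra axioms follow from the coalgebra axioms.

For the compatibility of `Δ` with products, the formula for induced class functions gives the value
of a product at `c` as a sum over the subsets `A` of `{1, …, n}` preserved by `c`, the term being
computed from the restrictions of `c` to `A` and to its complement (`ev_mulMap`). At
`c = emb (a, b)` the subsets `A` are the unions of a subset for `a` and a subset for `b`. The two
ways of splitting `c` into four parts differ by a lift of a block permutation, and the conjugation
rule shows that the resulting sign is trivial whenever the term is nonzero (`emb_emb_mul_inr`,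
`splitAt_joinSet`). This proves `comulR_mul`, a form of the Mackey formula.

Finally `R` is graded with one-dimensional component of degree `0`, so `1 - id` is locally nilpotent
for the convolution product, and the antipode is the geometric series of its powers (`antipodeR`).
-/

namespace SpinWreath

open SpinData

/-! ### The Clifford representation of the spin group -/

namespace SpinSym

variable {n : ℕ}

/-- The quadratic form `-½ ∑ xᵢ²` on `ℂⁿ`. The factor is chosen so that the vectors `eᵢ - eᵢ₊₁`
square to `-1` in the Clifford algebra, without square roots. -/
noncomputable def cliffordForm (n : ℕ) : QuadraticForm ℂ (Fin n → ℂ) :=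
  QuadraticMap.weightedSumSquares ℂ fun _ : Fin n => (-1 / 2 : ℂ)

/-- The image in the Clifford algebra of the `i`-th standard basis vector. -/
noncomputable def cliffordVec (i : Fin n) : CliffordAlgebra (cliffordForm n) :=
  CliffordAlgebra.ι (cliffordForm n) (Pi.single i 1)

theorem cliffordVec_add_self_mul (i : Fin n) :
    cliffordVec i * cliffordVec i + cliffordVec i * cliffordVec i = -1 := by
  rw [cliffordVec, CliffordAlgebra.ι_sq_scalar, ← map_add,
    ← map_one (algebraMap ℂ (CliffordAlgebra (cliffordForm n))), ← map_neg]
  congr 1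
  simp [cliffordForm, QuadraticMap.weightedSumSquares_apply, Pi.single_apply]

theorem cliffordVec_anticomm {i j : Fin n} (h : i ≠ j) :
    cliffordVec i * cliffordVec j = -(cliffordVec j * cliffordVec i) := by
  rw [eq_neg_iff_add_eq_zero, cliffordVec, cliffordVec, CliffordAlgebra.ι_mul_ι_add_swap,
    ← map_zero (algebraMap ℂ _)]
  congr 1
  simp only [QuadraticMap.polar, cliffordForm, QuadraticMap.weightedSumSquares_apply,
    ← Finset.sum_sub_distrib]
  refine Finset.sum_eq_zero fun k _ => ?_
  simp only [Pi.add_apply, Pi.single_apply, smul_eq_mul]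
  split_ifs with h1 h2
  · exact absurd (h1.symm.trans h2) h
  all_goals norm_num

theorem cliffordVec_sq_comm (i j : Fin n) :
    cliffordVec i * cliffordVec i = cliffordVec j * cliffordVec j := by
  simp only [cliffordVec, CliffordAlgebra.ι_sq_scalar]
  congr 1
  simp [cliffordForm, QuadraticMap.weightedSumSquares_apply, Pi.single_apply]

/-- The vector `eᵢ - eⱼ` in the Clifford algebra. -/
noncomputable def cliffordRoot (i j : Fin n) : CliffordAlgebra (cliffordForm n) :=
  cliffordVec i - cliffordVec j

theorem cliffordRoot_sq {i j : Fin n} (h : i ≠ j) : cliffordRoot i j * cliffordRoot i j = -1 := by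
  have h1 := cliffordVec_anticomm h
  have h2 := cliffordVec_sq_comm j i
  have h3 := cliffordVec_add_self_mul i
  simp only [cliffordRoot, mul_sub, sub_mul]
  rw [h1, h2, ← h3]
  abel

theorem cliffordRoot_mul_vec {i j k : Fin n} (h : i ≠ j) :
    cliffordRoot i j * cliffordVec k = -(cliffordVec (Equiv.swap i j k) * cliffordRoot i j) := by
  have h0 := cliffordVec_anticomm h
  have h2 := cliffordVec_sq_comm j i
  by_cases hi : k = i
  · subst hi
    rw [Equiv.swap_apply_left]
    simp only [cliffordRoot, mul_sub, sub_mul, h2]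
    abel
  · by_cases hj : k = j
    · subst hj
      rw [Equiv.swap_apply_right]
      simp only [cliffordRoot, mul_sub, sub_mul, h2]
      abel
    · rw [Equiv.swap_apply_of_ne_of_ne hi hj]
      simp only [cliffordRoot, mul_sub, sub_mul]
      rw [cliffordVec_anticomm hi, cliffordVec_anticomm hj]
      abel

theorem cliffordRoot_braid {i j k : Fin n} (hij : i ≠ j) (hik : i ≠ k) (hjk : j ≠ k) :
    (cliffordRoot i j * cliffordRoot j k) ^ 3 = -1 := by
  have h1 : cliffordRoot j k * cliffordRoot i j = 1 - cliffordRoot i j * cliffordRoot j k := by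
    rw [eq_sub_iff_add_eq]
    simp only [cliffordRoot, mul_sub, sub_mul]
    rw [cliffordVec_anticomm hij, cliffordVec_anticomm hik, cliffordVec_anticomm hjk,
      show (1 : CliffordAlgebra (cliffordForm n)) = -(-1) by simp,
      ← cliffordVec_add_self_mul j]
    abel
  have ha := cliffordRoot_sq hij
  have hb := cliffordRoot_sq hjk
  set a := cliffordRoot i j
  set b := cliffordRoot j k
  have h2 : (a * b) * (a * b) = a * b - 1 := by
    calc (a * b) * (a * b) = a * (b * a) * b := by simp only [mul_assoc]
      _ = a * b - (a * a) * (b * b) := by rw [h1]; noncomm_ring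
      _ = a * b - 1 := by rw [ha, hb]; noncomm_ring
  rw [pow_succ, pow_two, h2, sub_mul, h2]
  noncomm_ring

theorem cliffordRoot_anticomm {i j k l : Fin n} (hik : i ≠ k) (hil : i ≠ l) (hjk : j ≠ k)
    (hjl : j ≠ l) :
    cliffordRoot i j * cliffordRoot k l = -(cliffordRoot k l * cliffordRoot i j) := by
  simp only [cliffordRoot, mul_sub, sub_mul]
  rw [cliffordVec_anticomm hik, cliffordVec_anticomm hil, cliffordVec_anticomm hjk,
    cliffordVec_anticomm hjl]
  abel

/-- The invertible element `eᵢ - eⱼ` of the Clifford algebra. -/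
noncomputable def cliffordUnit (i j : Fin n) (h : i ≠ j) : (CliffordAlgebra (cliffordForm n))ˣ where
  val := cliffordRoot i j
  inv := -cliffordRoot i j
  val_inv := by rw [mul_neg, cliffordRoot_sq h, neg_neg]
  inv_val := by rw [neg_mul, cliffordRoot_sq h, neg_neg]

/-- The spin representation `S̃_n → Cl_nˣ`, `z ↦ -1`, `t_i ↦ e_i - e_{i+1}`. -/
noncomputable def clifford (n : ℕ) : SpinSym n →* (CliffordAlgebra (cliffordForm n))ˣ :=
  lift (-1) (fun i hi => cliffordUnit ⟨i, by omega⟩ ⟨i + 1, hi⟩ (by simp)) (by simp)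
    (fun i hi => Units.ext (by
      rw [pow_two]
      exact cliffordRoot_sq (by simp)))
    (fun i hi hi' => Units.ext (cliffordRoot_braid (by simp) (by simp; omega) (by simp)))
    (fun i j hi hj hij => Units.ext (by
      refine (cliffordRoot_anticomm ?_ ?_ ?_ ?_).trans ?_
      iterate 4 simp; omega
      simp [cliffordUnit]))
    (fun i hi => by simp)

theorem clifford_zz : clifford n zz = -1 := by
  unfold clifford lift zz
  exact PresentedGroup.toGroup.of _

theorem clifford_tt (i : ℕ) (hi : i + 1 < n) :
    (clifford n (tt i hi) : CliffordAlgebra (cliffordForm n)) =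
      cliffordRoot ⟨i, by omega⟩ ⟨i + 1, hi⟩ := by
  refine congrArg Units.val (a₂ := cliffordUnit _ _ (by simp)) ?_
  unfold clifford lift tt
  exact PresentedGroup.toGroup.of _

theorem clifford_zz_ne_one : clifford n zz ≠ 1 := by
  intro h1
  have h2 : (-1 : CliffordAlgebra (cliffordForm n)) = 1 := by
    rw [clifford_zz] at h1
    exact congrArg Units.val h1
  have h3 : (2 : CliffordAlgebra (cliffordForm n)) = 0 := by
    rw [← one_add_one_eq_two]
    nth_rw 1 [← h2]
    simp
  have : Nontrivial (CliffordAlgebra (cliffordForm n)) := inferInstance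
  have : CharZero (CliffordAlgebra (cliffordForm n)) := algebraRat.charZero _
  exact two_ne_zero h3

theorem zz_ne_one : (zz : SpinSym n) ≠ 1 := fun h => clifford_zz_ne_one (by rw [h, map_one])

/-- The spin group acts on vectors by twisted conjugation through signed permutations. -/
theorem clifford_mul_vec (x : SpinSym n) (i : Fin n) :
    (clifford n x : CliffordAlgebra (cliffordForm n)) * cliffordVec i =
      SpinSupermodule.sgn (d x) • (cliffordVec (theta n x i) * clifford n x) := by
  revert i
  induction x using SpinSym.induction with
  | hz =>
    intro i
    have : d (zz : SpinSym n) = 0 := rfl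
    simp [clifford_zz, this, SpinSupermodule.sgn_zero, theta_zz]
  | ht a ha =>
    intro i
    rw [clifford_tt, d_tt, SpinSupermodule.sgn_one, theta_tt, cliffordRoot_mul_vec (by simp)]
    simp
  | h1 => simp [d_one, SpinSupermodule.sgn_zero]
  | hm x y hx hy =>
    intro i
    rw [map_mul, Units.val_mul, mul_assoc, hy, mul_smul_comm, ← mul_assoc, hx, smul_mul_assoc,
      smul_smul, d_mul, add_comm, SpinSupermodule.sgn_add, map_mul, Equiv.Perm.mul_apply, mul_assoc]
  | hi x hx =>
    intro i
    have h := hx ((theta n x)⁻¹ i)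
    rw [← Equiv.Perm.mul_apply, mul_inv_cancel, Equiv.Perm.one_apply] at h
    have h1 : SpinSupermodule.sgn (d x) * SpinSupermodule.sgn (d x) = 1 := by
      rw [← SpinSupermodule.sgn_add, show ∀ a : ZMod 2, a + a = 0 by decide,
        SpinSupermodule.sgn_zero]
    rw [map_inv, map_inv, d_inv, Units.inv_mul_eq_iff_eq_mul, mul_smul_comm, ← mul_assoc, h,
      smul_mul_assoc, smul_smul, h1, one_smul, Units.mul_inv_cancel_right]

/-! ### The kernel of the covering homomorphism -/

/-- Normal form: every element of `S̃_{n+1}` is a product of an element of `S̃_n` and of one of the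
`n + 1` coset representatives `wrd n j`. -/
theorem exists_eq_shift_mul_wrd (g : SpinSym (n + 1)) :
    ∃ (x : SpinSym n) (j : ℕ), j ≤ n ∧ g = shift 0 n (n + 1) (by omega) x * wrd n j := by
  let K : Subgroup (SpinSym (n + 1)) := (shift 0 n (n + 1) (by omega)).range
  let X : Set (SpinSym (n + 1)) := {g | ∃ y ∈ K, ∃ j ≤ n, EqZ g (y * wrd n j)}
  have hzK : zz ∈ K := ⟨zz, rfl⟩
  have hE : ∀ (x y : SpinSym (n + 1)) (j : ℕ), y ∈ K → j ≤ n → EqZ x (y * wrd n j) → x ∈ X :=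
    fun x y j hy hj h => ⟨y, hy, j, hj, h⟩
  have htK : ∀ i, i + 1 < n → tot (n + 1) i ∈ K := by
    intro i hi
    refine ⟨tt i hi, ?_⟩
    rw [shift_tt]
    have : i + 1 < n + 1 := by omega
    simp [tot, this]
  have hz : ∀ x ∈ X, x * zz ∈ X := by
    rintro x ⟨y, hy, j, hj, h⟩
    refine ⟨y, hy, j, hj, EqZ.trans (y := x) ?_ h⟩
    right; rw [zz_comm]
  have ht : ∀ i, i < n → ∀ x ∈ X, x * tot (n + 1) i ∈ X := by
    rintro i hi x ⟨y, hy, j, hj, h0⟩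
    have h0' := h0.mul_right (tot (n + 1) i)
    rw [mul_assoc] at h0'
    rcases lt_trichotomy (i + j + 1) n with h | h | h
    · refine hE _ _ j (K.mul_mem hy (htK i (by omega))) (by omega) (h0'.trans ?_)
      rw [mul_assoc]
      exact (wrd_low j i (by omega) h).mul_left _
    · refine hE _ _ (j + 1) hy (by omega) (h0'.trans ?_)
      left
      rw [wrd, show n - 1 - j = i by omega]
    · by_cases hc : n < i + j
      · refine hE _ _ j (K.mul_mem hy (htK (i - 1) (by omega))) (by omega) (h0'.trans ?_)
        rw [mul_assoc]
        exact (wrd_high j i (by omega) hc hi).mul_left _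
      · obtain ⟨l, rfl⟩ : ∃ l, j = l + 1 := ⟨j - 1, by omega⟩
        refine hE _ _ l hy (by omega) (h0'.trans (EqZ.mul_left _ ?_))
        rw [wrd, show n - 1 - l = i by omega, mul_assoc]
        simpa using (tot_sq (n := n + 1) i).mul_left (wrd n l)
  have htinv : ∀ i (hi : i + 1 < n + 1), (tt i hi : SpinSym (n + 1))⁻¹ = tt i hi * zz := by
    intro i hi
    rw [inv_eq_iff_mul_eq_one, ← mul_assoc, ← pow_two, tt_sq, zz_mul_zz]
  have hzinv : (zz : SpinSym (n + 1))⁻¹ = zz := by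
    rw [inv_eq_iff_mul_eq_one, zz_mul_zz]
  have ht' : ∀ i (hi : i + 1 < n + 1), ∀ x ∈ X, x * tt i hi ∈ X := by
    intro i hi x hx
    have := ht i (by omega) x hx
    rwa [tot, dif_pos hi] at this
  have key : ∀ g : SpinSym (n + 1), (∀ x ∈ X, x * g ∈ X) ∧ (∀ x ∈ X, x * g⁻¹ ∈ X) := by
    intro g
    induction g using SpinSym.induction with
    | hz => exact ⟨hz, by rw [hzinv]; exact hz⟩
    | ht i hi =>
      refine ⟨ht' i hi, fun x hx => ?_⟩
      rw [htinv, ← mul_assoc]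
      exact hz _ (ht' i hi x hx)
    | h1 => simp
    | hm a b ha hb =>
      refine ⟨fun x hx => ?_, fun x hx => ?_⟩
      · rw [← mul_assoc]; exact hb.1 _ (ha.1 _ hx)
      · rw [mul_inv_rev, ← mul_assoc]; exact ha.2 _ (hb.2 _ hx)
    | hi a ha => exact ⟨ha.2, by simpa using ha.1⟩
  have h1X : (1 : SpinSym (n + 1)) ∈ X := ⟨1, K.one_mem, 0, by omega, Or.inl (by simp [wrd])⟩
  have hg : g ∈ X := by simpa using (key g).1 1 h1X
  obtain ⟨_, ⟨x, rfl⟩, j, hj, h | h⟩ := hg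
  · exact ⟨x, j, hj, h⟩
  · exact ⟨zz * x, j, hj, by rw [h, map_mul, shift_zz, mul_assoc]⟩

theorem theta_tot (i : ℕ) (hi : i + 1 < n) :
    theta n (tot n i) = Equiv.swap ⟨i, by omega⟩ ⟨i + 1, hi⟩ := by
  rw [tot, dif_pos hi, theta_tt]

theorem theta_wrd_apply (j : ℕ) (hj : j ≤ n) :
    theta (n + 1) (wrd n j) ⟨n - j, by omega⟩ = ⟨n, by omega⟩ := by
  induction j with
  | zero => simp [wrd]
  | succ j ih =>
    rw [wrd, map_mul, Equiv.Perm.mul_apply, theta_tot _ (by omega)]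
    have e : (⟨n - (j + 1), by omega⟩ : Fin (n + 1)) = ⟨n - 1 - j, by omega⟩ := by
      ext; simp only; omega
    have e' : (⟨n - 1 - j + 1, by omega⟩ : Fin (n + 1)) = ⟨n - j, by omega⟩ := by
      ext; simp only; omega
    rw [e, Equiv.swap_apply_left, e']
    exact ih (by omega)

/-- The kernel of `θ` is generated by `z`: compare the normal form of an element with the action on
the last point, and use induction on `n`. -/
theorem eq_one_or_zz_of_theta_eq_one (x : SpinSym n) (h : theta n x = 1) : x = 1 ∨ x = zz := by
  induction n with
  | zero =>
    clear h
    induction x using SpinSym.induction with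
    | hz => exact Or.inr rfl
    | ht i hi => omega
    | h1 => exact Or.inl rfl
    | hm a b ha hb => rcases ha with rfl | rfl <;> rcases hb with rfl | rfl <;> simp [zz_mul_zz]
    | hi a ha =>
      rcases ha with rfl | rfl
      · simp
      · right; rw [inv_eq_iff_mul_eq_one, zz_mul_zz]
  | succ n ih =>
    obtain ⟨y, j, hj, rfl⟩ := exists_eq_shift_mul_wrd x
    have hs := SpinWr.theta_shift_in 0 n (n + 1) (by omega) y
    -- The factor `wrd n j` moves `n - j` to `n`, and `y` fixes `n`; hence `j = 0`.
    have h1 := theta_wrd_apply j hj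
    have h2 : theta (n + 1) (shift 0 n (n + 1) (by omega) y * wrd n j) ⟨n - j, by omega⟩ =
        ⟨n, by omega⟩ := by
      rw [map_mul, Equiv.Perm.mul_apply, h1]
      exact hs.2 _ (by simp)
    rw [h, Equiv.Perm.one_apply, Fin.mk.injEq] at h2
    obtain rfl : j = 0 := by omega
    have hw : wrd n 0 = 1 := rfl
    rw [hw, mul_one] at h ⊢
    have h3 : theta n y = 1 := by
      ext i
      have := hs.1 i
      rw [h, Equiv.Perm.one_apply, Fin.mk.injEq] at this
      simp only [Equiv.Perm.one_apply]
      omega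
    rcases ih y h3 with rfl | rfl
    · left; exact map_one _
    · right; exact shift_zz _ _ _ _

theorem theta_surjective : Function.Surjective (theta n) := by
  cases n with
  | zero => intro σ; exact ⟨1, Subsingleton.elim _ _⟩
  | succ n =>
    intro σ
    have h : σ ∈ Submonoid.closure
        (Set.range fun i : Fin n ↦ Equiv.swap i.castSucc i.succ) := by
      rw [Equiv.Perm.mclosure_swap_castSucc_succ]; trivial
    have h2 : Submonoid.closure (Set.range fun i : Fin n ↦ Equiv.swap i.castSucc i.succ) ≤
        MonoidHom.mrange (theta (n + 1)) := by
      rw [Submonoid.closure_le]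
      rintro _ ⟨i, rfl⟩
      exact ⟨tt i.1 (by omega), theta_tt _ _⟩
    exact h2 h

theorem eqZ_of_theta_eq {x y : SpinSym n} (h : theta n x = theta n y) : EqZ x y := by
  rcases eq_one_or_zz_of_theta_eq_one (x * y⁻¹) (by rw [map_mul, map_inv, h, mul_inv_cancel])
    with h | h
  · exact Or.inl (mul_inv_eq_one.1 h)
  · exact Or.inr (mul_inv_eq_iff_eq_mul.1 h)

/-- The permutation and the Clifford representation together determine an element of `S̃_n`. -/
theorem eq_of_theta_eq_of_clifford_eq {x y : SpinSym n} (h : theta n x = theta n y)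
    (h' : clifford n x = clifford n y) : x = y := by
  rcases eqZ_of_theta_eq h with h | h
  · exact h
  · rw [h, map_mul, mul_eq_right] at h'
    exact absurd h' clifford_zz_ne_one

end SpinSym

/-! ### Shifts and conjugation -/

namespace SpinSym

variable {n : ℕ}

theorem shift_shift (a b l m n : ℕ) (h : a + l ≤ m) (h' : b + m ≤ n) (x : SpinSym l) :
    shift b m n h' (shift a l m h x) = shift (b + a) l n (by omega) x := by
  refine DFunLike.congr_fun (f := (shift b m n h').comp (shift a l m h))
    (g := shift (b + a) l n (by omega)) (hom_ext rfl ?_) x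
  intro i hi
  rw [MonoidHom.comp_apply, shift_tt, shift_tt, shift_tt]
  simp only [add_assoc]

theorem shift_self (x : SpinSym n) : shift 0 n n (by omega) x = x := by
  refine DFunLike.congr_fun (f := shift 0 n n (by omega)) (g := MonoidHom.id _) (hom_ext rfl ?_) x
  intro i hi
  rw [MonoidHom.id_apply, shift_tt]
  simp only [zero_add]

theorem clifford_zpw (e : ZMod 2) :
    (clifford n (zpw e) : CliffordAlgebra (cliffordForm n)) = SpinSupermodule.sgn e • 1 := by
  rcases zmod_two_cases e with rfl | rfl
  · simp [zpw_zero, SpinSupermodule.sgn_zero]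
  · have : (z : SpinSym n) = zz := rfl
    simp [zpw_one, SpinSupermodule.sgn_one, this, clifford_zz]

/-- Conjugation by a lift `w` of a permutation that translates the block `[a, a + m)` to
`[b, b + m)` translates the elements of `S̃_m` placed at this block, up to the sign rule. -/
theorem mul_shift_eq (a b m : ℕ) (ha : a + m ≤ n) (hb : b + m ≤ n) (w : SpinSym n)
    (hw : ∀ j : Fin m, theta n w ⟨a + j.1, by omega⟩ = ⟨b + j.1, by omega⟩) (x : SpinSym m) :
    w * shift a m n ha x = shift b m n hb x * w * zpw (d w * d x) := by
  induction x using SpinSym.induction with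
  | hz =>
    have h0 : d (zz : SpinSym m) = 0 := rfl
    rw [shift_zz, shift_zz, h0, mul_zero, zpw_zero, mul_one, zz_comm]
  | ht i hi =>
    rw [shift_tt, shift_tt, d_tt, mul_one]
    have h1 := hw ⟨i, by omega⟩
    have h2 := hw ⟨i + 1, hi⟩
    simp only at h1 h2
    refine eq_of_theta_eq_of_clifford_eq ?_ (Units.ext ?_)
    · have h3 : theta n (zpw (d w)) = 1 := by
        rcases zmod_two_cases (d w) with h | h <;> rw [h]
        · rw [zpw_zero, map_one]
        · rw [zpw_one]; exact theta_zz
      rw [map_mul, map_mul, map_mul, h3, mul_one, theta_tt, theta_tt, Equiv.mul_swap_eq_swap_mul]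
      simp only [add_assoc] at h1 h2 ⊢
      rw [h1, h2]
    · rw [map_mul, map_mul, map_mul, Units.val_mul, Units.val_mul, Units.val_mul, clifford_tt,
        clifford_tt, clifford_zpw, cliffordRoot, cliffordRoot, mul_sub, clifford_mul_vec,
        clifford_mul_vec]
      simp only [add_assoc] at h1 h2 ⊢
      rw [h1, h2, sub_mul, mul_smul_comm, mul_one, smul_sub]
  | h1 => simp [d_one, zpw_zero]
  | hm x y hx hy =>
    rw [map_mul, map_mul, ← mul_assoc, hx, mul_assoc _ (zpw _), zpw_comm, d_mul, mul_add,
      ← mul_assoc, mul_assoc _ w, hy, add_comm, zpw_add]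
    simp only [mul_assoc]
  | hi x hx =>
    rw [map_inv, map_inv, d_inv, mul_inv_eq_iff_eq_mul, mul_assoc, mul_assoc, zpw_comm,
      ← mul_assoc w, hx, mul_assoc, zpw_mul_self, mul_one, inv_mul_cancel_left]

end SpinSym

namespace SpinWr

variable {Γ : Type u} [Group Γ] {n : ℕ}

theorem mul_left_apply (x y : SpinWr Γ n) (i : Fin n) :
    (x * y).left i = x.left i * y.left ((SpinSym.theta n x.right)⁻¹ i) := rfl

theorem shift_left (k m : ℕ) (h : k + m ≤ n) (x : SpinWr Γ m) :
    (shift Γ k m n h x).left = shiftBase Γ k m n x.left := rfl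

theorem shift_right (k m : ℕ) (h : k + m ≤ n) (x : SpinWr Γ m) :
    (shift Γ k m n h x).right = SpinSym.shift k m n h x.right := rfl

theorem z_left : (z : SpinWr Γ n).left = 1 := rfl

theorem z_right : (z : SpinWr Γ n).right = SpinSym.zz := rfl

theorem zpw_left (e : ZMod 2) : (zpw e : SpinWr Γ n).left = 1 := by
  rw [← inr_zpw]; rfl

theorem zpw_right (e : ZMod 2) : (zpw e : SpinWr Γ n).right = zpw e := by
  rw [← inr_zpw]; rfl

theorem shiftBase_in (k m : ℕ) (g : Fin m → Γ) (i : Fin n) (hi : k ≤ i.1) (hi' : i.1 < k + m) :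
    shiftBase Γ k m n g i = g ⟨i.1 - k, by omega⟩ := dif_pos ⟨hi, hi'⟩

theorem shiftBase_out (k m : ℕ) (g : Fin m → Γ) (i : Fin n) (hi : ¬(k ≤ i.1 ∧ i.1 < k + m)) :
    shiftBase Γ k m n g i = 1 := dif_neg hi

theorem shift_shift (a b l m n : ℕ) (h : a + l ≤ m) (h' : b + m ≤ n) (x : SpinWr Γ l) :
    shift Γ b m n h' (shift Γ a l m h x) = shift Γ (b + a) l n (by omega) x := by
  ext1
  · ext i
    simp only [shift_left]
    by_cases hi : b + a ≤ i.1 ∧ i.1 < b + a + l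
    · rw [shiftBase_in _ _ _ _ (by omega) (by omega), shiftBase_in _ _ _ _ (by simp; omega)
        (by simp; omega), shiftBase_in _ _ _ _ (by omega) (by omega)]
      exact congrArg x.left (Fin.ext (by simp only; omega))
    · rw [shiftBase_out _ _ _ i hi]
      by_cases hi' : b ≤ i.1 ∧ i.1 < b + m
      · rw [shiftBase_in _ _ _ _ hi'.1 hi'.2, shiftBase_out]
        simp only
        omega
      · exact shiftBase_out _ _ _ i hi'
  · exact SpinSym.shift_shift _ _ _ _ _ _ _ _

theorem shift_self (x : SpinWr Γ n) : shift Γ 0 n n (by omega) x = x := by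
  ext1
  · ext i
    rw [shift_left, shiftBase_in _ _ _ _ (by omega) (by omega)]
    rfl
  · exact SpinSym.shift_self _

/-- The analogue of `SpinSym.mul_shift_eq` in the wreath product. -/
theorem inr_mul_shift_eq (a b m : ℕ) (ha : a + m ≤ n) (hb : b + m ≤ n) (w : SpinSym n)
    (hw : ∀ j : Fin m, SpinSym.theta n w ⟨a + j.1, by omega⟩ = ⟨b + j.1, by omega⟩)
    (x : SpinWr Γ m) :
    (SemidirectProduct.inr w : SpinWr Γ n) * shift Γ a m n ha x =
      shift Γ b m n hb x * SemidirectProduct.inr w * zpw (d w * d x) := by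
  ext1
  · ext i
    simp only [mul_left_apply, SemidirectProduct.left_inr, zpw_left, shift_left, Pi.one_apply,
      one_mul, mul_one, SemidirectProduct.right_inr]
    by_cases hi : b ≤ i.1 ∧ i.1 < b + m
    · have h1 := hw ⟨i.1 - b, by omega⟩
      have e : (⟨b + (i.1 - b), by omega⟩ : Fin n) = i := by ext; simp; omega
      simp only [e] at h1
      rw [← h1, Equiv.Perm.inv_def, Equiv.symm_apply_apply, h1,
        shiftBase_in _ _ _ _ (by simp) (by simp; omega), shiftBase_in _ _ _ _ hi.1 hi.2]
      simp
    · rw [shiftBase_out _ _ _ _ hi, shiftBase_out]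
      intro hc
      apply hi
      have h1 := hw ⟨((SpinSym.theta n w)⁻¹ i).1 - a, by omega⟩
      have e : (⟨a + (((SpinSym.theta n w)⁻¹ i).1 - a), by omega⟩ : Fin n) =
        (SpinSym.theta n w)⁻¹ i := by ext; simp only; omega
      simp only [e] at h1
      rw [← Equiv.Perm.mul_apply, mul_inv_cancel, Equiv.Perm.one_apply, Fin.ext_iff] at h1
      simp only at h1
      omega
  · simp only [SemidirectProduct.mul_right, SemidirectProduct.right_inr, shift_right, zpw_right]
    exact SpinSym.mul_shift_eq a b m ha hb w hw x.right

end SpinWr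

/-! ### The embedding of the spin product -/

namespace SpinWr

variable {Γ : Type u} [Group Γ] {n : ℕ}

/-- The permutation of `{0, …, n - 1}` underlying an element of `Γ ≀ S̃_n`. -/
def perm (Γ : Type u) [Group Γ] (n : ℕ) : SpinWr Γ n →* Equiv.Perm (Fin n) :=
  (SpinSym.theta n).comp SemidirectProduct.rightHom

theorem perm_apply (x : SpinWr Γ n) : perm Γ n x = SpinSym.theta n x.right := rfl

theorem perm_inr (w : SpinSym n) :
    perm Γ n (SemidirectProduct.inr w) = SpinSym.theta n w := rfl

theorem emb_mk (k l : ℕ) (h : k + l = n) (x : SpinWr Γ k) (y : SpinWr Γ l) :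
    emb Γ k l n h (SpinProd.mk x y) = shift Γ 0 k n (by omega) x * shift Γ k l n h.le y := rfl

theorem perm_emb_left {k l : ℕ} (h : k + l = n) (x : SpinWr Γ k) (y : SpinWr Γ l) (i : Fin k) :
    perm Γ n (emb Γ k l n h (SpinProd.mk x y)) ⟨i.1, by omega⟩ = ⟨(perm Γ k x i).1, by omega⟩ := by
  rw [emb_mk, map_mul, Equiv.Perm.mul_apply, perm_apply, perm_apply, shift_right, shift_right,
    (theta_shift_in k l n h.le y.right).2 _ (by simp)]
  have h1 := (theta_shift_in 0 k n (by omega) x.right).1 i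
  simp only [zero_add] at h1
  exact h1

theorem perm_emb_right {k l : ℕ} (h : k + l = n) (x : SpinWr Γ k) (y : SpinWr Γ l) (j : Fin l) :
    perm Γ n (emb Γ k l n h (SpinProd.mk x y)) ⟨k + j.1, by omega⟩ =
      ⟨k + (perm Γ l y j).1, by omega⟩ := by
  rw [emb_mk, map_mul, Equiv.Perm.mul_apply, perm_apply, perm_apply, shift_right, shift_right,
    (theta_shift_in k l n h.le y.right).1 j]
  exact (theta_shift_in 0 k n (by omega) x.right).2 _ (by simp)

theorem perm_emb_lt_iff {k l : ℕ} (h : k + l = n) (q : SpinProd (SpinWr Γ k) (SpinWr Γ l))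
    (i : Fin n) : (perm Γ n (emb Γ k l n h q) i).1 < k ↔ i.1 < k := by
  induction q using QuotientGroup.induction_on with
  | H q =>
    obtain ⟨x, y⟩ := q
    change (perm Γ n (emb Γ k l n h (SpinProd.mk x y)) i).1 < k ↔ i.1 < k
    by_cases hi : i.1 < k
    · have := perm_emb_left h x y ⟨i.1, hi⟩
      simp only [Fin.eta] at this
      rw [this]
      simp [hi]
    · have := perm_emb_right h x y ⟨i.1 - k, by omega⟩
      have e : (⟨k + (i.1 - k), by omega⟩ : Fin n) = i := by ext; simp; omega
      simp only [e] at this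
      rw [this]
      simp [hi]

theorem eq_one_or_z_of_left_of_right {x : SpinWr Γ n} (h : x.left = 1)
    (h' : SpinSym.theta n x.right = 1) : x = 1 ∨ x = z := by
  rcases SpinSym.eq_one_or_zz_of_theta_eq_one _ h' with h1 | h1
  · exact Or.inl (SemidirectProduct.ext h h1)
  · exact Or.inr (SemidirectProduct.ext h h1)

theorem z_ne_one : (z : SpinWr Γ n) ≠ 1 := fun h =>
  SpinSym.zz_ne_one (congrArg SemidirectProduct.right h)

theorem emb_left_left {k l : ℕ} (h : k + l = n) (x : SpinWr Γ k) (y : SpinWr Γ l) (i : Fin k) :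
    (emb Γ k l n h (SpinProd.mk x y)).left ⟨i.1, by omega⟩ = x.left i := by
  rw [emb_mk, mul_left_apply, shift_left, shift_left, shift_right, shiftBase_in _ _ _ _ (by simp)
    (by simp), shiftBase_out, mul_one]
  · rfl
  · have h1 := (theta_shift_in 0 k n (by omega) x.right⁻¹).1 i
    simp only [zero_add, map_inv] at h1
    rw [h1]
    simp

theorem emb_left_right {k l : ℕ} (h : k + l = n) (x : SpinWr Γ k) (y : SpinWr Γ l) (j : Fin l) :
    (emb Γ k l n h (SpinProd.mk x y)).left ⟨k + j.1, by omega⟩ = y.left j := by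
  have h1 := (theta_shift_in 0 k n (by omega) x.right⁻¹).2 ⟨k + j.1, by omega⟩ (by simp)
  rw [map_inv, map_inv] at h1
  rw [emb_mk, mul_left_apply, shift_left, shift_left, shift_right, shiftBase_out _ _ _ _ (by simp),
    one_mul, h1, shiftBase_in _ _ _ _ (by simp) (by simp)]
  exact congrArg y.left (Fin.ext (by simp))

theorem emb_injective (k l n : ℕ) (h : k + l = n) : Function.Injective (emb Γ k l n h) := by
  rw [injective_iff_map_eq_one]
  intro q hq
  induction q using QuotientGroup.induction_on with
  | H q =>
    obtain ⟨x, y⟩ := q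
    change emb Γ k l n h (SpinProd.mk x y) = 1 at hq
    have hx1 : x.left = 1 := by
      ext i; rw [← emb_left_left h x y i, hq]; rfl
    have hy1 : y.left = 1 := by
      ext i; rw [← emb_left_right h x y i, hq]; rfl
    have hx2 : SpinSym.theta k x.right = 1 := by
      ext i
      have := perm_emb_left h x y i
      rw [hq, map_one, Equiv.Perm.one_apply, Fin.mk.injEq] at this
      exact this.symm
    have hy2 : SpinSym.theta l y.right = 1 := by
      ext i
      have := perm_emb_right h x y i
      rw [hq, map_one, Equiv.Perm.one_apply, Fin.mk.injEq] at this
      exact (Nat.add_left_cancel this).symm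
    rw [emb_mk] at hq
    refine (QuotientGroup.eq_one_iff _).2 ?_
    rcases eq_one_or_z_of_left_of_right hx1 hx2 with rfl | rfl <;>
      rcases eq_one_or_z_of_left_of_right hy1 hy2 with rfl | rfl
    · exact Or.inl rfl
    · rw [map_one, one_mul, shift_z] at hq
      exact absurd hq z_ne_one
    · rw [map_one, mul_one, shift_z] at hq
      exact absurd hq z_ne_one
    · exact Or.inr rfl

/-- A permutation that preserves an initial segment splits into two permutations. -/
theorem exists_perm_of_lt {k l : ℕ} (h : k + l = n) (σ : Equiv.Perm (Fin n))
    (hσ : ∀ i : Fin n, i.1 < k → (σ i).1 < k) :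
    ∃ (σ₁ : Equiv.Perm (Fin k)) (σ₂ : Equiv.Perm (Fin l)),
      (∀ i : Fin k, σ ⟨i.1, by omega⟩ = ⟨(σ₁ i).1, by omega⟩) ∧
      ∀ j : Fin l, σ ⟨k + j.1, by omega⟩ = ⟨k + (σ₂ j).1, by omega⟩ := by
  subst h
  have hm : finSumFinEquiv.symm.permCongr σ ∈ (Equiv.Perm.sumCongrHom (Fin k) (Fin l)).range := by
    refine Equiv.Perm.mem_sumCongrHom_range_of_perm_mapsTo_inl ?_
    rintro _ ⟨i, rfl⟩
    refine ⟨⟨(σ (Fin.castAdd l i)).1, hσ _ i.2⟩, ?_⟩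
    rw [Equiv.permCongr_apply, Equiv.eq_symm_apply]
    rfl
  obtain ⟨⟨σ₁, σ₂⟩, hs⟩ := hm
  refine ⟨σ₁, σ₂, fun i => ?_, fun j => ?_⟩
  · have := congrArg finSumFinEquiv (DFunLike.congr_fun hs (Sum.inl i))
    rw [Equiv.permCongr_apply, Equiv.apply_symm_apply] at this
    exact this.symm
  · have := congrArg finSumFinEquiv (DFunLike.congr_fun hs (Sum.inr j))
    rw [Equiv.permCongr_apply, Equiv.apply_symm_apply] at this
    exact this.symm

/-- The image of the embedding is the stabilizer of the initial segment of length `k`. -/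
theorem mem_range_emb {k l : ℕ} (h : k + l = n) (c : SpinWr Γ n)
    (hc : ∀ i : Fin n, i.1 < k → (perm Γ n c i).1 < k) :
    ∃ x y, emb Γ k l n h (SpinProd.mk x y) = c := by
  obtain ⟨σ₁, σ₂, h1, h2⟩ := exists_perm_of_lt h _ hc
  obtain ⟨t₁, rfl⟩ := SpinSym.theta_surjective σ₁
  obtain ⟨t₂, rfl⟩ := SpinSym.theta_surjective σ₂
  let x : SpinWr Γ k := ⟨fun i => c.left ⟨i.1, by omega⟩, t₁⟩
  let y : SpinWr Γ l := ⟨fun j => c.left ⟨k + j.1, by omega⟩, t₂⟩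
  have hleft : (emb Γ k l n h (SpinProd.mk x y)).left = c.left := by
    ext i
    by_cases hi : i.1 < k
    · exact emb_left_left h x y ⟨i.1, hi⟩
    · have := emb_left_right h x y ⟨i.1 - k, by omega⟩
      have e : (⟨k + (i.1 - k), by omega⟩ : Fin n) = i := by ext; simp; omega
      simp only [y, e] at this
      exact this
  have hperm : SpinSym.theta n c.right =
      SpinSym.theta n (emb Γ k l n h (SpinProd.mk x y)).right := by
    ext i
    by_cases hi : i.1 < k
    · have e1 := perm_emb_left h x y ⟨i.1, hi⟩
      have e2 := h1 ⟨i.1, hi⟩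
      exact congrArg Fin.val (e2.trans e1.symm)
    · have e1 := perm_emb_right h x y ⟨i.1 - k, by omega⟩
      have e2 := h2 ⟨i.1 - k, by omega⟩
      have e : (⟨k + (i.1 - k), by omega⟩ : Fin n) = i := by ext; simp; omega
      simp only [e] at e1 e2
      exact congrArg Fin.val (e2.trans e1.symm)
  rcases SpinSym.eqZ_of_theta_eq hperm with hr | hr
  · exact ⟨x, y, SemidirectProduct.ext hleft hr.symm⟩
  · refine ⟨z * x, y, ?_⟩
    rw [← SpinProd.z_mul_mk, map_mul, emb_z]
    refine SemidirectProduct.ext ?_ hr.symm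
    rw [← hleft, SemidirectProduct.mul_left, z_left, z_right, one_mul]
    simp [SpinSym.theta_zz]

end SpinWr

/-! ### Spin super class functions on a spin product -/

section Outer

variable {G : Type u} {H : Type v} [Group G] [Group H] [SpinData G] [SpinData H]

theorem SpinProd.exists_mk (q : SpinProd G H) : ∃ x y, q = SpinProd.mk x y := by
  induction q using QuotientGroup.induction_on with
  | H q => exact ⟨q.fst, q.snd, rfl⟩

theorem SpinProd.mk_mul_mk (t s : G) (t' s' : H) :
    SpinProd.mk t t' * SpinProd.mk s s' = SpinProd.mk (t * s * zpw (d t' * d s)) (t' * s') := rfl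

theorem SpinProd.mk_inv (t : G) (t' : H) :
    (SpinProd.mk t t')⁻¹ = SpinProd.mk (t⁻¹ * zpw (d t' * d t)) t'⁻¹ := rfl

/-- The element `z` may be moved from one component to the other, as `(z, z)` is trivial. -/
theorem SpinProd.mk_z_right (t : G) (s : H) : SpinProd.mk t (z * s) = z * SpinProd.mk t s := by
  rw [SpinProd.z_mul_mk]
  refine QuotientGroup.eq.2 (Or.inr (inv_mul_eq_iff_eq_mul.2 ?_))
  rw [TwistedProd.mul_def, d_z, mul_zero, zpw_zero, mul_one, ← z_comm, ← z_comm, ← mul_assoc z z,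
    z_mul_z, one_mul]

/-- A spin super class function vanishes on a pair of odd elements: such a pair is conjugate to its
product with `z`. -/
theorem SpinSuper.apply_mk_odd (F : SpinSuper (SpinProd G H)) (t : G) (s : H) (ht : d t = 1)
    (hs : d s = 1) : F.1 (SpinProd.mk t s) = 0 := by
  have h := F.2.1 (SpinProd.mk t s) (SpinProd.mk t 1)
  have e : SpinProd.mk t 1 * SpinProd.mk t s * (SpinProd.mk t (1 : H))⁻¹ =
      z * SpinProd.mk t s := by
    rw [SpinProd.mk_inv, SpinProd.mk_mul_mk, SpinProd.mk_mul_mk, SpinProd.z_mul_mk]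
    simp [d_one, zpw_zero, hs, ht, d_inv, zpw_one, z_comm, mul_assoc]
  rw [e, F.2.2.1] at h
  exact self_eq_neg.1 h.symm

theorem SpinSuper.apply_mk_odd_left (F : SpinSuper (SpinProd G H)) (t : G) (s : H) (ht : d t = 1) :
    F.1 (SpinProd.mk t s) = 0 := by
  rcases zmod_two_cases (d s) with hs | hs
  · exact F.2.2.2 _ (by rw [SpinProd.d_mk, ht, hs, add_zero])
  · exact SpinSuper.apply_mk_odd F t s ht hs

theorem SpinSuper.apply_mk_odd_right (F : SpinSuper (SpinProd G H)) (t : G) (s : H)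
    (hs : d s = 1) : F.1 (SpinProd.mk t s) = 0 := by
  rcases zmod_two_cases (d t) with ht | ht
  · exact F.2.2.2 _ (by rw [SpinProd.d_mk, ht, hs, zero_add])
  · exact SpinSuper.apply_mk_odd F t s ht hs

/-- The partial function `t ↦ F [t, s]`. -/
def SpinSuper.sectionLeft (F : SpinSuper (SpinProd G H)) (s : H) : SpinSuper G :=
  ⟨fun t => F.1 (SpinProd.mk t s), by
    refine ⟨fun x y => ?_, fun x => ?_, fun x hx => SpinSuper.apply_mk_odd_left F x s hx⟩
    · beta_reduce
      rcases zmod_two_cases (d s) with hs | hs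
      · rw [← F.2.1 (SpinProd.mk x s) (SpinProd.mk y 1), SpinProd.mk_inv, SpinProd.mk_mul_mk,
          SpinProd.mk_mul_mk]
        simp [d_one, zpw_zero, hs]
      · rw [SpinSuper.apply_mk_odd_right F _ _ hs, SpinSuper.apply_mk_odd_right F _ _ hs]
    · beta_reduce
      rw [← SpinProd.z_mul_mk, F.2.2.1]⟩

/-- The partial function `s ↦ F [t, s]`. -/
def SpinSuper.sectionRight (F : SpinSuper (SpinProd G H)) (t : G) : SpinSuper H :=
  ⟨fun s => F.1 (SpinProd.mk t s), by
    refine ⟨fun x y => ?_, fun x => ?_, fun x hx => SpinSuper.apply_mk_odd_right F t x hx⟩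
    · beta_reduce
      rcases zmod_two_cases (d t) with ht | ht
      · rw [← F.2.1 (SpinProd.mk t x) (SpinProd.mk 1 y), SpinProd.mk_inv, SpinProd.mk_mul_mk,
          SpinProd.mk_mul_mk]
        simp [d_one, zpw_zero, ht]
      · rw [SpinSuper.apply_mk_odd_left F _ _ ht, SpinSuper.apply_mk_odd_left F _ _ ht]
    · beta_reduce
      rw [SpinProd.mk_z_right, F.2.2.1]⟩

/-- Linear functionals that separate the points of two spaces separate the points of their tensor
product. -/
theorem tensor_eq_of_dualDistrib {V W : Type*} [AddCommMonoid V] [Module ℂ V] [AddCommMonoid W]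
    [Module ℂ W] (P : Set (Module.Dual ℂ V)) (Q : Set (Module.Dual ℂ W))
    (hP : ∀ v v', (∀ p ∈ P, p v = p v') → v = v') (hQ : ∀ w w', (∀ q ∈ Q, q w = q w') → w = w')
    {t t' : V ⊗[ℂ] W} (h : ∀ p ∈ P, ∀ q ∈ Q, TensorProduct.dualDistrib ℂ V W (p ⊗ₜ q) t =
      TensorProduct.dualDistrib ℂ V W (p ⊗ₜ q) t') : t = t' := by
  let _ : AddCommGroup V := Module.addCommMonoidToAddCommGroup ℂ
  let _ : AddCommGroup W := Module.addCommMonoidToAddCommGroup ℂ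
  replace hP : ∀ v, (∀ p ∈ P, p v = 0) → v = 0 := fun v hv => hP v 0 (by simpa using hv)
  replace hQ : ∀ w, (∀ q ∈ Q, q w = 0) → w = 0 := fun w hw => hQ w 0 (by simpa using hw)
  rw [← sub_eq_zero]
  replace h : ∀ p ∈ P, ∀ q ∈ Q, TensorProduct.dualDistrib ℂ V W (p ⊗ₜ q) (t - t') = 0 :=
    fun p hp q hq => by rw [map_sub, h p hp q hq, sub_self]
  generalize t - t' = t at h ⊢
  let b := Module.Free.chooseBasis ℂ V
  let E := TensorProduct.equivFinsuppOfBasisLeft (N := W) b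
  have ht : t = E.symm (E t) := (E.symm_apply_apply t).symm
  rw [TensorProduct.equivFinsuppOfBasisLeft_symm_apply] at ht
  have h0 : E t = 0 := by
    ext i
    refine hQ _ fun q hq => ?_
    have h1 : (E t).sum (fun i w => q w • b i) = 0 := by
      refine hP _ fun p hp => ?_
      have := h p hp q hq
      rw [ht, Finsupp.sum, map_sum] at this
      rw [Finsupp.sum, map_sum, ← this]
      refine Finset.sum_congr rfl fun i _ => ?_
      rw [TensorProduct.dualDistrib_apply, map_smul, smul_eq_mul, mul_comm]
    by_contra hne
    have hi : i ∈ (E t).support := by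
      rw [Finsupp.mem_support_iff]
      intro h0
      exact hne (by rw [h0, map_zero])
    exact hne (linearIndependent_iff'.1 b.linearIndependent (E t).support
      (fun i => q (E t i)) h1 i hi)
  rw [ht, h0, Finsupp.sum_zero_index]

/-- Evaluation of a spin super class function. -/
def evalAt (x : G) : Module.Dual ℂ (SpinSuper G) :=
  (LinearMap.proj x : (G → ℂ) →ₗ[ℂ] ℂ) ∘ₗ (SpinSuper G).subtype

theorem phi_mk (t : SpinSuper G ⊗[ℂ] SpinSuper H) (x : G) (y : H) :
    (phi G H t).1 (SpinProd.mk x y) =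
      TensorProduct.dualDistrib ℂ _ _ (evalAt x ⊗ₜ evalAt y) t := by
  induction t with
  | zero => simp
  | tmul f g => rfl
  | add t t' ht ht' => rw [map_add, map_add, ← ht, ← ht']; rfl

theorem phi_injective : Function.Injective (phi G H) := by
  intro t t' ht
  refine tensor_eq_of_dualDistrib (Set.range evalAt) (Set.range evalAt) ?_ ?_ ?_
  · intro f f' hf
    ext x
    exact hf _ ⟨x, rfl⟩
  · intro f f' hf
    ext x
    exact hf _ ⟨x, rfl⟩
  · rintro _ ⟨x, rfl⟩ _ ⟨y, rfl⟩
    rw [← phi_mk, ht, phi_mk]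

theorem phi_surjective [Finite G] : Function.Surjective (phi G H) := by
  classical
  cases nonempty_fintype G
  intro F
  let b := Module.finBasis ℂ (SpinSuper G)
  -- The coordinates of the sections `t ↦ F [t, s]` are linear combinations of the values of `F`,
  -- hence spin super class functions of `s`.
  choose c hc using fun i => LinearMap.exists_extend (b.coord i)
  refine ⟨∑ i, b i ⊗ₜ ∑ t : G, c i (Pi.single t 1) • SpinSuper.sectionRight F t, ?_⟩
  ext q
  obtain ⟨x, y, rfl⟩ := SpinProd.exists_mk q
  rw [phi_mk, map_sum]
  have h1 := congrArg (evalAt x) (b.sum_repr (SpinSuper.sectionLeft F y))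
  rw [map_sum] at h1
  refine Eq.trans ?_ h1
  refine Finset.sum_congr rfl fun i _ => ?_
  rw [TensorProduct.dualDistrib_apply, map_smul, mul_comm, smul_eq_mul]
  congr 1
  rw [← Module.Basis.coord_apply, ← hc i, LinearMap.comp_apply, map_sum]
  have h2 : (SpinSuper.sectionLeft F y).1 =
      ∑ t : G, F.1 (SpinProd.mk t y) • Pi.single t (1 : ℂ) := by
    ext t
    simp [Finset.sum_apply, Pi.single_apply, SpinSuper.sectionLeft]
  rw [Submodule.subtype_apply, h2, map_sum]
  refine Finset.sum_congr rfl fun t _ => ?_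
  rw [map_smul, map_smul, smul_eq_mul, smul_eq_mul, mul_comm]
  rfl

theorem phi_bijective [Finite G] : Function.Bijective (phi G H) :=
  ⟨phi_injective, phi_surjective⟩

/-- The sign in the action of `[t, s]` on `U ⊗ V` matters only if `s` is odd, and then both sides
vanish because the character of `V` does. -/
theorem phi_character {U V : Type w} [AddCommGroup U] [Module ℂ U] [FiniteDimensional ℂ U]
    [AddCommGroup V] [Module ℂ V] [FiniteDimensional ℂ V] (M : SpinSupermodule G U)
    (N : SpinSupermodule H V) (x : SpinProd G H) :
    (phi G H (M.character ⊗ₜ[ℂ] N.character)).1 x =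
      LinearMap.trace ℂ (U ⊗[ℂ] V) (M.superTensor N x) := by
  obtain ⟨t, s, rfl⟩ := SpinProd.exists_mk x
  rw [phi_tmul_mk]
  change M.character.1 t * N.character.1 s =
    LinearMap.trace ℂ (U ⊗[ℂ] V) (TensorProduct.map (M.rep t ∘ₗ M.par (d s)) (N.rep s))
  rw [LinearMap.trace_tensorProduct']
  rcases zmod_two_cases (d s) with hs | hs
  · rw [hs, M.par_zero]
    rfl
  · have h := N.character.2.2.2 s hs
    have h' : LinearMap.trace ℂ V (N.rep s) = 0 := h
    rw [h, h', mul_zero, mul_zero]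

end Outer

/-! ### The coalgebra structure -/

section DualDistrib

variable {V W V' W' X : Type*} [AddCommMonoid V] [Module ℂ V] [AddCommMonoid W] [Module ℂ W]
  [AddCommMonoid V'] [Module ℂ V'] [AddCommMonoid W'] [Module ℂ W'] [AddCommMonoid X] [Module ℂ X]

theorem dualDistrib_map (α : Module.Dual ℂ V') (β : Module.Dual ℂ W') (f : V →ₗ[ℂ] V')
    (g : W →ₗ[ℂ] W') (t : V ⊗[ℂ] W) :
    TensorProduct.dualDistrib ℂ V' W' (α ⊗ₜ β) (TensorProduct.map f g t) =
      TensorProduct.dualDistrib ℂ V W ((α ∘ₗ f) ⊗ₜ (β ∘ₗ g)) t := by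
  induction t with
  | zero => simp
  | tmul v w => simp
  | add t t' ht ht' => simp only [map_add, ht, ht']

theorem dualDistrib_assoc (α : Module.Dual ℂ V) (β : Module.Dual ℂ W) (γ : Module.Dual ℂ X)
    (t : (V ⊗[ℂ] W) ⊗[ℂ] X) :
    TensorProduct.dualDistrib ℂ V (W ⊗[ℂ] X) (α ⊗ₜ TensorProduct.dualDistrib ℂ W X (β ⊗ₜ γ))
        (TensorProduct.assoc ℂ V W X t) =
      TensorProduct.dualDistrib ℂ (V ⊗[ℂ] W) X (TensorProduct.dualDistrib ℂ V W (α ⊗ₜ β) ⊗ₜ γ)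
        t := by
  have h : TensorProduct.dualDistrib ℂ V (W ⊗[ℂ] X)
        (α ⊗ₜ TensorProduct.dualDistrib ℂ W X (β ⊗ₜ γ)) ∘ₗ
        (TensorProduct.assoc ℂ V W X).toLinearMap =
      TensorProduct.dualDistrib ℂ (V ⊗[ℂ] W) X
        (TensorProduct.dualDistrib ℂ V W (α ⊗ₜ β) ⊗ₜ γ) := by
    refine TensorProduct.ext_threefold fun v w x => ?_
    simp [mul_assoc]
  exact LinearMap.congr_fun h t

end DualDistrib

section Coalgebra

variable {Γ : Type u} [Group Γ]

namespace SpinWr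

theorem emb_assoc {p q r n m m' : ℕ} (h : p + q = m) (h' : m + r = n) (k : q + r = m')
    (k' : p + m' = n) (a : SpinWr Γ p) (b : SpinWr Γ q) (c : SpinWr Γ r) :
    emb Γ m r n h' (SpinProd.mk (emb Γ p q m h (SpinProd.mk a b)) c) =
      emb Γ p m' n k' (SpinProd.mk a (emb Γ q r m' k (SpinProd.mk b c))) := by
  subst h
  simp only [emb_mk, map_mul, shift_shift, mul_assoc, zero_add, add_zero]

theorem emb_one_left {n : ℕ} (h : 0 + n = n) (b : SpinWr Γ n) :
    emb Γ 0 n n h (SpinProd.mk 1 b) = b := by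
  rw [emb_mk, map_one, one_mul, shift_self]

theorem emb_one_right {n : ℕ} (h : n + 0 = n) (a : SpinWr Γ n) :
    emb Γ n 0 n h (SpinProd.mk a 1) = a := by
  rw [emb_mk, map_one, mul_one, shift_self]

end SpinWr

/-- The functional on `R⁻_Γ` that evaluates the component of degree `n` at `x`. -/
noncomputable def ev {n : ℕ} (x : SpinWr Γ n) : Module.Dual ℂ (RMinus Γ) :=
  evalAt x ∘ₗ DirectSum.component ℂ ℕ (fun n => SpinSuper (SpinWr Γ n)) n

theorem ev_apply {n : ℕ} (x : SpinWr Γ n) (f : RMinus Γ) : ev x f = (f n).1 x := rfl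

theorem incl_apply_self {n : ℕ} (f : SpinSuper (SpinWr Γ n)) : (incl Γ n f : RMinus Γ) n = f :=
  DirectSum.lof_apply (R := ℂ) (M := fun n => SpinSuper (SpinWr Γ n)) n f

theorem ev_incl {n : ℕ} (x : SpinWr Γ n) (f : SpinSuper (SpinWr Γ n)) :
    ev x (incl Γ n f) = f.1 x := by
  rw [ev_apply, incl_apply_self]

theorem incl_apply_of_ne {m n : ℕ} (h : m ≠ n) (f : SpinSuper (SpinWr Γ m)) :
    (incl Γ m f : RMinus Γ) n = 0 :=
  DirectSum.of_eq_of_ne _ _ _ h.symm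

theorem ev_incl_of_ne {m n : ℕ} (h : m ≠ n) (x : SpinWr Γ n) (f : SpinSuper (SpinWr Γ m)) :
    ev x (incl Γ m f) = 0 := by
  rw [ev_apply, incl_apply_of_ne h]
  rfl

theorem ev_comp_incl {n : ℕ} (x : SpinWr Γ n) : ev x ∘ₗ incl Γ n = evalAt x :=
  LinearMap.ext fun f => ev_incl x f

theorem ev_comp_incl_of_ne {m n : ℕ} (h : m ≠ n) (x : SpinWr Γ n) : ev x ∘ₗ incl Γ m = 0 :=
  LinearMap.ext fun f => ev_incl_of_ne h x f

theorem ev_of_odd {n : ℕ} (x : SpinWr Γ n) (hx : d x = 1) : ev x = 0 :=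
  LinearMap.ext fun f => (f n).2.2.2 x hx

variable (Γ) in
/-- The set of all evaluation functionals. -/
def evSet : Set (Module.Dual ℂ (RMinus Γ)) := {p | ∃ (n : ℕ) (x : SpinWr Γ n), p = ev x}

theorem eq_of_evSet (f g : RMinus Γ) (h : ∀ p ∈ evSet Γ, p f = p g) : f = g := by
  refine DFinsupp.ext fun n => ?_
  ext x
  exact h _ ⟨n, x, rfl⟩

/-- The tensor product of two functionals on `R⁻_Γ`. -/
noncomputable abbrev dd (α β : Module.Dual ℂ (RMinus Γ)) : Module.Dual ℂ (RMinus Γ ⊗[ℂ] RMinus Γ) :=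
  TensorProduct.dualDistrib ℂ _ _ (α ⊗ₜ β)

variable (Γ) in
/-- The set of tensor products of two evaluation functionals. -/
def evSet₂ : Set (Module.Dual ℂ (RMinus Γ ⊗[ℂ] RMinus Γ)) :=
  {p | ∃ (m n : ℕ) (x : SpinWr Γ m) (y : SpinWr Γ n), p = dd (ev x) (ev y)}

theorem eq_of_evSet₂ (t t' : RMinus Γ ⊗[ℂ] RMinus Γ) (h : ∀ p ∈ evSet₂ Γ, p t = p t') :
    t = t' := by
  refine tensor_eq_of_dualDistrib _ _ eq_of_evSet eq_of_evSet ?_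
  rintro _ ⟨m, x, rfl⟩ _ ⟨n, y, rfl⟩
  exact h _ ⟨m, n, x, y, rfl⟩

theorem dd_ev_map_incl {p q : ℕ} (a : SpinWr Γ p) (b : SpinWr Γ q)
    (t : SpinSuper (SpinWr Γ p) ⊗[ℂ] SpinSuper (SpinWr Γ q)) :
    dd (ev a) (ev b) (TensorProduct.map (incl Γ p) (incl Γ q) t) =
      (phi (SpinWr Γ p) (SpinWr Γ q) t).1 (SpinProd.mk a b) := by
  rw [dualDistrib_map, ev_comp_incl, ev_comp_incl, ← phi_mk]

theorem dd_ev_map_incl_of_ne {p q k l : ℕ} (h : ¬(k = p ∧ l = q)) (a : SpinWr Γ p)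
    (b : SpinWr Γ q) (t : SpinSuper (SpinWr Γ k) ⊗[ℂ] SpinSuper (SpinWr Γ l)) :
    dd (ev a) (ev b) (TensorProduct.map (incl Γ k) (incl Γ l) t) = 0 := by
  rw [dualDistrib_map]
  by_cases hk : k = p
  · have hl : l ≠ q := fun hl => h ⟨hk, hl⟩
    rw [ev_comp_incl_of_ne hl, TensorProduct.tmul_zero, map_zero, LinearMap.zero_apply]
  · rw [ev_comp_incl_of_ne hk, TensorProduct.zero_tmul, map_zero, LinearMap.zero_apply]

theorem phi_symm_apply {G : Type u} {H : Type v} [Group G] [Group H] [SpinData G] [SpinData H]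
    (h : Function.Bijective (phi G H)) (F : SpinSuper (SpinProd G H)) :
    phi G H ((LinearEquiv.ofBijective _ h).symm F) = F :=
  (LinearEquiv.ofBijective _ h).apply_symm_apply F

variable [Finite Γ]

variable (Γ) in
/-- The comultiplication of `R⁻_Γ`. -/
noncomputable def comulR : RMinus Γ →ₗ[ℂ] RMinus Γ ⊗[ℂ] RMinus Γ :=
  comulMap Γ fun _ _ => phi_bijective

theorem comulR_incl (n : ℕ) (f : SpinSuper (SpinWr Γ n)) :
    comulR Γ (incl Γ n f) = ∑ p : Finset.HasAntidiagonal.antidiagonal n,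
      TensorProduct.map (incl Γ p.1.1) (incl Γ p.1.2)
        ((LinearEquiv.ofBijective _ phi_bijective).symm
          (resEmb Γ p.1.1 p.1.2 n (Finset.HasAntidiagonal.mem_antidiagonal.1 p.2) f)) :=
  comulMap_incl Γ _ n f

/-- The comultiplication is dual to the multiplication `(a, b) ↦ emb (a, b)` of evaluation
points. -/
theorem dd_ev_comulR {p q n : ℕ} (h : p + q = n) (a : SpinWr Γ p) (b : SpinWr Γ q)
    (f : RMinus Γ) :
    dd (ev a) (ev b) (comulR Γ f) = ev (SpinWr.emb Γ p q n h (SpinProd.mk a b)) f := by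
  induction f using DirectSum.induction_on with
  | zero => simp only [map_zero]
  | add f g hf hg => rw [map_add, map_add, map_add, hf, hg]
  | of m f =>
    change dd (ev a) (ev b) (comulR Γ (incl Γ m f)) = ev _ (incl Γ m f)
    rw [comulR_incl, map_sum]
    by_cases hm : m = n
    · subst hm
      rw [Finset.sum_eq_single ⟨(p, q), Finset.HasAntidiagonal.mem_antidiagonal.2 h⟩]
      · rw [dd_ev_map_incl, phi_symm_apply, ev_incl]
        rfl
      · rintro ⟨⟨k, l⟩, hkl⟩ _ hne
        refine dd_ev_map_incl_of_ne ?_ _ _ _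
        rintro ⟨rfl, rfl⟩
        exact hne rfl
      · intro h0
        exact absurd (Finset.mem_univ _) h0
    · rw [ev_incl_of_ne hm]
      refine Finset.sum_eq_zero ?_
      rintro ⟨⟨k, l⟩, hkl⟩ _
      refine dd_ev_map_incl_of_ne ?_ _ _ _
      rintro ⟨rfl, rfl⟩
      exact hm ((Finset.HasAntidiagonal.mem_antidiagonal.1 hkl).symm.trans h)

theorem dd_ev_comp_comulR {p q n : ℕ} (h : p + q = n) (a : SpinWr Γ p) (b : SpinWr Γ q) :
    dd (ev a) (ev b) ∘ₗ comulR Γ = ev (SpinWr.emb Γ p q n h (SpinProd.mk a b)) :=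
  LinearMap.ext fun f => dd_ev_comulR h a b f

/-- The counit is the evaluation at `1` of the component of degree `0`. As the comultiplication is
dual to `emb` on evaluation functionals, the axioms follow from `SpinWr.emb_assoc`,
`SpinWr.emb_one_left` and `SpinWr.emb_one_right`. -/
noncomputable instance instCoalgebra : Coalgebra ℂ (RMinus Γ) where
  comul := comulR Γ
  counit := ev (1 : SpinWr Γ 0)
  coassoc := by
    refine LinearMap.ext fun f => ?_
    refine tensor_eq_of_dualDistrib (evSet Γ) (evSet₂ Γ) eq_of_evSet eq_of_evSet₂ ?_
    rintro _ ⟨p, a, rfl⟩ _ ⟨q, r, b, c, rfl⟩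
    rw [LinearMap.comp_apply, LinearMap.comp_apply, LinearEquiv.coe_coe,
      dualDistrib_assoc, LinearMap.rTensor, dualDistrib_map, LinearMap.comp_id,
      dd_ev_comp_comulR rfl, LinearMap.comp_apply, LinearMap.lTensor, dualDistrib_map,
      LinearMap.comp_id, dd_ev_comp_comulR rfl]
    have h1 := LinearMap.congr_fun (dd_ev_comp_comulR (n := p + (q + r)) (by omega)
      (SpinWr.emb Γ p q _ rfl (SpinProd.mk a b)) c) f
    have h2 := LinearMap.congr_fun (dd_ev_comp_comulR (n := p + (q + r)) rfl a
      (SpinWr.emb Γ q r _ rfl (SpinProd.mk b c))) f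
    refine h1.trans (Eq.trans ?_ h2.symm)
    rw [SpinWr.emb_assoc]
  rTensor_counit_comp_comul := by
    refine LinearMap.ext fun f => ?_
    refine tensor_eq_of_dualDistrib {LinearMap.id} (evSet Γ) ?_ eq_of_evSet ?_
    · intro c c' hc
      exact hc _ rfl
    · rintro _ rfl _ ⟨n, x, rfl⟩
      rw [LinearMap.comp_apply, LinearMap.rTensor, dualDistrib_map,
        LinearMap.comp_id, LinearMap.id_comp]
      refine (LinearMap.congr_fun (dd_ev_comp_comulR (zero_add n) 1 x) f).trans ?_
      rw [SpinWr.emb_one_left]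
      simp
  lTensor_counit_comp_comul := by
    refine LinearMap.ext fun f => ?_
    refine tensor_eq_of_dualDistrib (evSet Γ) {LinearMap.id} eq_of_evSet ?_ ?_
    · intro c c' hc
      exact hc _ rfl
    · rintro _ ⟨n, x, rfl⟩ _ rfl
      rw [LinearMap.comp_apply, LinearMap.lTensor, dualDistrib_map,
        LinearMap.comp_id, LinearMap.id_comp]
      refine (LinearMap.congr_fun (dd_ev_comp_comulR (add_zero n) x 1) f).trans ?_
      rw [SpinWr.emb_one_right]
      simp

end Coalgebra

/-! ### Frobenius reciprocity and the ring structure -/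

section Frobenius

variable {G : Type u} {H : Type v} [Group G] [Group H] [SpinData G] [SpinData H]

/-- Frobenius reciprocity for the bilinear pairings `(f, g) ↦ |G|⁻¹ ∑ f g`. -/
theorem frobenius [Fintype G] [Fintype H] (ι : H →* G) (hz : ι z = z) (hd : ∀ x, d (ι x) = d x)
    (F : SpinSuper H) (w : SpinSuper G) :
    (Nat.card G : ℂ)⁻¹ * ∑ c, (ind ι hz hd F).1 c * w.1 c =
      (Nat.card H : ℂ)⁻¹ * ∑ q, F.1 q * w.1 (ι q) := by
  classical
  have h1 : ∀ c, (ind ι hz hd F).1 c = (Nat.card H : ℂ)⁻¹ *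
      ∑ u : G, ∑ q : H, if c = u * ι q * u⁻¹ then F.1 q else 0 := by
    intro c
    change indFun ι F.1 c = _
    rw [indFun, finsum_eq_sum_of_fintype, Fintype.sum_prod_type]
    refine congrArg _ (Finset.sum_congr rfl fun u _ => Finset.sum_congr rfl fun q _ => ?_)
    have : ι q = u⁻¹ * c * u ↔ c = u * ι q * u⁻¹ := by
      constructor
      · intro h; rw [h]; group
      · intro h; rw [h]; group
    simp only [this]
  have h2 : ∑ c, (ind ι hz hd F).1 c * w.1 c =
      (Nat.card H : ℂ)⁻¹ * ((Nat.card G : ℂ) * ∑ q, F.1 q * w.1 (ι q)) := by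
    calc ∑ c, (ind ι hz hd F).1 c * w.1 c
        = (Nat.card H : ℂ)⁻¹ * ∑ c, ∑ u : G, ∑ q : H,
            if c = u * ι q * u⁻¹ then F.1 q * w.1 c else 0 := by
          rw [Finset.mul_sum]
          refine Finset.sum_congr rfl fun c _ => ?_
          rw [h1, mul_assoc, Finset.sum_mul]
          refine congrArg _ (Finset.sum_congr rfl fun u _ => ?_)
          rw [Finset.sum_mul]
          refine Finset.sum_congr rfl fun q _ => ?_
          rw [ite_mul, zero_mul]
      _ = (Nat.card H : ℂ)⁻¹ * ∑ u : G, ∑ q : H, F.1 q * w.1 (ι q) := by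
          rw [Finset.sum_comm]
          refine congrArg _ (Finset.sum_congr rfl fun u _ => ?_)
          rw [Finset.sum_comm]
          refine Finset.sum_congr rfl fun q _ => ?_
          rw [Finset.sum_ite_eq' Finset.univ, if_pos (Finset.mem_univ _), w.2.1]
      _ = _ := by
          rw [Finset.sum_const, Finset.card_univ, nsmul_eq_mul,
            Nat.card_eq_fintype_card (α := G)]
  have hG : (Nat.card G : ℂ) ≠ 0 := by
    rw [Nat.card_eq_fintype_card]
    exact_mod_cast Fintype.card_ne_zero
  rw [h2]
  field_simp

/-- The average over a spin product is the average over pairs. -/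
theorem average_spinProd [Fintype G] [Fintype H] [Fintype (SpinProd G H)]
    (Φ : SpinProd G H → ℂ) :
    (Nat.card (SpinProd G H) : ℂ)⁻¹ * ∑ q, Φ q =
      (Nat.card G : ℂ)⁻¹ * (Nat.card H : ℂ)⁻¹ * ∑ x : G, ∑ y : H, Φ (SpinProd.mk x y) := by
  classical
  let e : TwistedProd G H ≃ G × H :=
    { toFun := fun p => (p.fst, p.snd), invFun := fun p => ⟨p.1, p.2⟩,
      left_inv := fun _ => rfl, right_inv := fun _ => rfl }
  let _ : Fintype (TwistedProd G H) := Fintype.ofEquiv _ e.symm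
  let π : TwistedProd G H →* SpinProd G H := QuotientGroup.mk' (TwistedProd.diagZ G H)
  let N : ℕ := (Finset.univ.filter fun t => π t = 1).card
  have hfib : ∀ q, (Finset.univ.filter fun t => π t = q).card = N := fun q =>
    MonoidHom.card_fiber_eq_of_mem_range π (QuotientGroup.mk'_surjective _ q) ⟨1, map_one _⟩
  have key : ∀ Ψ : SpinProd G H → ℂ, ∑ t, Ψ (π t) = N * ∑ q, Ψ q := by
    intro Ψ
    rw [← Finset.sum_fiberwise Finset.univ π, Finset.mul_sum]
    refine Finset.sum_congr rfl fun q _ => ?_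
    rw [← hfib q, ← nsmul_eq_mul, ← Finset.sum_const]
    refine Finset.sum_congr rfl fun t ht => ?_
    rw [(Finset.mem_filter.1 ht).2]
  have hcard : (Nat.card G : ℂ) * Nat.card H = N * Nat.card (SpinProd G H) := by
    have h1 := key fun _ => 1
    rw [Finset.sum_const, Finset.sum_const, nsmul_one, nsmul_one, Finset.card_univ,
      Finset.card_univ, Fintype.card_congr e, Fintype.card_prod] at h1
    rw [Nat.card_eq_fintype_card, Nat.card_eq_fintype_card, Nat.card_eq_fintype_card, ← h1]
    push_cast
    rfl
  have hsum : ∑ x : G, ∑ y : H, Φ (SpinProd.mk x y) = N * ∑ q, Φ q := by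
    rw [← key, ← Fintype.sum_prod_type']
    exact (Fintype.sum_equiv e _ _ fun _ => rfl).symm
  have hG : (Nat.card G : ℂ) ≠ 0 := by
    rw [Nat.card_eq_fintype_card]; exact_mod_cast Fintype.card_ne_zero
  have hH : (Nat.card H : ℂ) ≠ 0 := by
    rw [Nat.card_eq_fintype_card]; exact_mod_cast Fintype.card_ne_zero
  have hN : (N : ℂ) ≠ 0 := by
    intro h0
    rw [h0, zero_mul] at hcard
    exact mul_ne_zero hG hH hcard
  rw [hsum, ← mul_inv, hcard, mul_inv, mul_assoc, mul_left_comm (_⁻¹) (_⁻¹), ← mul_assoc (N : ℂ)⁻¹,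
    ← mul_assoc, mul_assoc, inv_mul_cancel₀ hN, one_mul]

end Frobenius

section Ring

variable {Γ : Type u} [Group Γ]

theorem SpinWr.eq_one_or_z (c : SpinWr Γ 0) : c = 1 ∨ c = z :=
  SpinWr.eq_one_or_z_of_left_of_right (Subsingleton.elim _ _) (Subsingleton.elim _ _)

variable [Finite Γ]

noncomputable instance SpinWr.instFintype (n : ℕ) : Fintype (SpinWr Γ n) := Fintype.ofFinite _

noncomputable instance SpinProd.instFintype (k l : ℕ) :
    Fintype (SpinProd (SpinWr Γ k) (SpinWr Γ l)) := Fintype.ofFinite _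

variable (Γ) in
/-- The bilinear form on `R⁻_Γ` whose restriction to degree `n` is `|G_n|⁻¹ ∑ f g` and for which
different degrees are orthogonal, as a map to the dual space. -/
noncomputable def pairing : RMinus Γ →ₗ[ℂ] Module.Dual ℂ (RMinus Γ) :=
  DirectSum.toModule ℂ ℕ _ fun n =>
    (Nat.card (SpinWr Γ n) : ℂ)⁻¹ • ∑ x : SpinWr Γ n, (evalAt x).smulRight (ev x)

theorem pairing_incl {n : ℕ} (f : SpinSuper (SpinWr Γ n)) (g : RMinus Γ) :
    pairing Γ (incl Γ n f) g =
      (Nat.card (SpinWr Γ n) : ℂ)⁻¹ * ∑ x : SpinWr Γ n, f.1 x * (g n).1 x := by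
  rw [pairing, DirectSum.toModule_lof, LinearMap.smul_apply, LinearMap.smul_apply,
    LinearMap.sum_apply, LinearMap.sum_apply]
  rfl

theorem pairing_apply_incl {n : ℕ} (f : RMinus Γ) (g : SpinSuper (SpinWr Γ n)) :
    pairing Γ f (incl Γ n g) =
      (Nat.card (SpinWr Γ n) : ℂ)⁻¹ * ∑ x : SpinWr Γ n, (f n).1 x * g.1 x := by
  induction f using DirectSum.induction_on with
  | zero => simp
  | add f f' hf hf' =>
    rw [map_add, LinearMap.add_apply, hf, hf', ← mul_add, ← Finset.sum_add_distrib]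
    simp only [← add_mul]
    rfl
  | of m f =>
    change pairing Γ (incl Γ m f) _ = _ * ∑ x, ((incl Γ m f : RMinus Γ) n).1 x * g.1 x
    rw [pairing_incl]
    by_cases h : m = n
    · subst h
      rw [incl_apply_self, incl_apply_self]
    · rw [incl_apply_of_ne h, incl_apply_of_ne (Ne.symm h)]
      simp

/-- Pairing `f - g` with its complex conjugate shows that the bilinear form is nondegenerate. -/
theorem pairing_injective : Function.Injective (pairing Γ) := by
  intro f g hfg
  refine DFinsupp.ext fun n => ?_
  let h : SpinSuper (SpinWr Γ n) := f n - g n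
  let hbar : SpinSuper (SpinWr Γ n) :=
    ⟨fun x => star (h.1 x), fun x y => by beta_reduce; rw [h.2.1],
      fun x => by beta_reduce; rw [h.2.2.1, star_neg],
      fun x hx => by beta_reduce; rw [h.2.2.2 x hx, star_zero]⟩
  have h1 := LinearMap.congr_fun hfg (incl Γ n hbar)
  rw [pairing_apply_incl, pairing_apply_incl, mul_eq_mul_left_iff, ← sub_eq_zero,
    ← Finset.sum_sub_distrib] at h1
  have hG : (Nat.card (SpinWr Γ n) : ℂ)⁻¹ ≠ 0 := by
    rw [Nat.card_eq_fintype_card]; exact inv_ne_zero (by exact_mod_cast Fintype.card_ne_zero)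
  have h2 : ∑ x : SpinWr Γ n, Complex.normSq (h.1 x) = 0 := by
    have h3 := h1.resolve_right hG
    have h4 : ∑ x : SpinWr Γ n, (Complex.normSq (h.1 x) : ℂ) = 0 := by
      rw [← h3]
      refine Finset.sum_congr rfl fun x _ => ?_
      rw [Complex.normSq_eq_conj_mul_self, ← sub_mul, mul_comm]
      rfl
    exact_mod_cast h4
  rw [Finset.sum_eq_zero_iff_of_nonneg fun x _ => Complex.normSq_nonneg _] at h2
  ext x
  exact sub_eq_zero.1 (Complex.normSq_eq_zero.1 (h2 x (Finset.mem_univ x)))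

/-- The multiplication is dual to the comultiplication with respect to the pairing. -/
theorem pairing_mulMap (f g w : RMinus Γ) :
    pairing Γ (mulMap Γ (f ⊗ₜ g)) w = dd (pairing Γ f) (pairing Γ g) (comulR Γ w) := by
  induction f using DirectSum.induction_on with
  | zero => simp [dd, TensorProduct.zero_tmul]
  | add f f' hf hf' =>
    simp only [dd, TensorProduct.add_tmul, map_add, LinearMap.add_apply] at hf hf' ⊢
    rw [hf, hf']
  | of k f =>
  induction g using DirectSum.induction_on with
  | zero => simp [dd, TensorProduct.tmul_zero]
  | add g g' hg hg' =>
    simp only [dd, TensorProduct.tmul_add, map_add, LinearMap.add_apply] at hg hg' ⊢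
    rw [hg, hg']
  | of l g =>
    change pairing Γ (mulMap Γ (incl Γ k f ⊗ₜ incl Γ l g)) w =
      dd (pairing Γ (incl Γ k f)) (pairing Γ (incl Γ l g)) (comulR Γ w)
    rw [mulMap_incl, pairing_incl, indEmb, frobenius, average_spinProd]
    have hp : ∀ (n : ℕ) (f : SpinSuper (SpinWr Γ n)), pairing Γ (incl Γ n f) =
        (Nat.card (SpinWr Γ n) : ℂ)⁻¹ • ∑ x : SpinWr Γ n, f.1 x • ev x := by
      intro n f
      refine LinearMap.ext fun g => ?_
      rw [pairing_incl, LinearMap.smul_apply, LinearMap.sum_apply]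
      rfl
    rw [hp, hp, dd, TensorProduct.smul_tmul_smul, TensorProduct.sum_tmul, map_smul, map_sum,
      LinearMap.smul_apply, LinearMap.sum_apply, smul_eq_mul]
    refine congrArg _ (Finset.sum_congr rfl fun x _ => ?_)
    rw [TensorProduct.tmul_sum, map_sum, LinearMap.sum_apply]
    refine Finset.sum_congr rfl fun y _ => ?_
    rw [TensorProduct.smul_tmul_smul, map_smul, LinearMap.smul_apply, dd_ev_comulR rfl,
      phi_tmul_mk, smul_eq_mul]
    rfl

/-- The convolution product of functionals on `R⁻_Γ` is associative. -/
theorem dd_comul_assoc (α β γ : Module.Dual ℂ (RMinus Γ)) (w : RMinus Γ) :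
    dd (dd α β ∘ₗ comulR Γ) γ (comulR Γ w) = dd α (dd β γ ∘ₗ comulR Γ) (comulR Γ w) := by
  have h := Coalgebra.coassoc_apply (R := ℂ) w
  have h1 := congrArg (TensorProduct.dualDistrib ℂ _ _ (α ⊗ₜ dd β γ)) h
  rw [dualDistrib_assoc, LinearMap.rTensor, LinearMap.lTensor, dualDistrib_map, dualDistrib_map,
    LinearMap.comp_id, LinearMap.comp_id] at h1
  exact h1

theorem dd_counit_left (α : Module.Dual ℂ (RMinus Γ)) (w : RMinus Γ) :
    dd (ev (1 : SpinWr Γ 0)) α (comulR Γ w) = α w := by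
  have h := Coalgebra.rTensor_counit_comul (R := ℂ) w
  have h1 := congrArg (TensorProduct.dualDistrib ℂ ℂ _ (LinearMap.id ⊗ₜ α)) h
  rw [LinearMap.rTensor, dualDistrib_map, LinearMap.comp_id, LinearMap.id_comp,
    TensorProduct.dualDistrib_apply, LinearMap.id_apply, one_mul] at h1
  exact h1

theorem dd_counit_right (α : Module.Dual ℂ (RMinus Γ)) (w : RMinus Γ) :
    dd α (ev (1 : SpinWr Γ 0)) (comulR Γ w) = α w := by
  have h := Coalgebra.lTensor_counit_comul (R := ℂ) w
  have h1 := congrArg (TensorProduct.dualDistrib ℂ _ ℂ (α ⊗ₜ LinearMap.id)) h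
  rw [LinearMap.lTensor, dualDistrib_map, LinearMap.comp_id, LinearMap.id_comp,
    TensorProduct.dualDistrib_apply, LinearMap.id_apply, mul_one] at h1
  exact h1

end Ring

/-! ### The unit and the algebra structure -/

section Unit

variable {Γ : Type u} [Group Γ]

open Classical in
variable (Γ) in
/-- The function on `Γ ≀ S̃_0 = {1, z}` with `1 ↦ 1`, `z ↦ -1`. -/
noncomputable def unitFun : SpinSuper (SpinWr Γ 0) :=
  ⟨fun c => if c = 1 then 1 else -1, by
    refine ⟨fun x y => ?_, fun x => ?_, fun x hx => ?_⟩
    · simp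
    · rcases SpinWr.eq_one_or_z x with rfl | rfl
      · simp [SpinWr.z_ne_one]
      · simp [SpinWr.z_ne_one, z_mul_z]
    · rcases SpinWr.eq_one_or_z x with rfl | rfl
      · rw [d_one] at hx
        exact absurd hx (by decide)
      · rw [d_z] at hx
        exact absurd hx (by decide)⟩

theorem unitFun_one : (unitFun Γ).1 1 = 1 := if_pos rfl

/-- A spin function on `{1, z}` is determined by its value at `1`. -/
theorem unitFun_mul_apply (f : SpinSuper (SpinWr Γ 0)) (c : SpinWr Γ 0) :
    (unitFun Γ).1 c * f.1 c = f.1 1 := by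
  rcases SpinWr.eq_one_or_z c with rfl | rfl
  · rw [unitFun_one, one_mul]
  · have h1 := (unitFun Γ).2.2.1 1
    have h2 := f.2.2.1 1
    rw [mul_one] at h1 h2
    rw [h1, h2, unitFun_one]
    simp

theorem unitFun_mul (c c' : SpinWr Γ 0) :
    (unitFun Γ).1 (c * c') = (unitFun Γ).1 c * (unitFun Γ).1 c' := by
  rcases SpinWr.eq_one_or_z c with rfl | rfl
  · rw [one_mul, unitFun_one, one_mul]
  · have h1 := (unitFun Γ).2.2.1 1
    rw [mul_one, unitFun_one] at h1
    rw [(unitFun Γ).2.2.1, h1, neg_one_mul]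

variable (Γ) in
/-- The unit of `R⁻_Γ`. -/
noncomputable def oneR : RMinus Γ := incl Γ 0 (unitFun Γ)

variable [Finite Γ]

theorem pairing_oneR (f : RMinus Γ) : pairing Γ (oneR Γ) f = ev (1 : SpinWr Γ 0) f := by
  have hG : (Nat.card (SpinWr Γ 0) : ℂ) ≠ 0 := by
    rw [Nat.card_eq_fintype_card]; exact_mod_cast Fintype.card_ne_zero
  rw [oneR, pairing_incl]
  simp only [unitFun_mul_apply]
  rw [Finset.sum_const, Finset.card_univ, ← Nat.card_eq_fintype_card, nsmul_eq_mul,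
    inv_mul_cancel_left₀ hG, ev_apply]

theorem pairing_apply_oneR (f : RMinus Γ) : pairing Γ f (oneR Γ) = ev (1 : SpinWr Γ 0) f := by
  have hG : (Nat.card (SpinWr Γ 0) : ℂ) ≠ 0 := by
    rw [Nat.card_eq_fintype_card]; exact_mod_cast Fintype.card_ne_zero
  rw [oneR, pairing_apply_incl]
  simp only [mul_comm _ ((unitFun Γ).1 _), unitFun_mul_apply]
  rw [Finset.sum_const, Finset.card_univ, ← Nat.card_eq_fintype_card, nsmul_eq_mul,
    inv_mul_cancel_left₀ hG, ev_apply]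

/-- The unit is group-like because `unitFun` is multiplicative. -/
theorem comulR_oneR : comulR Γ (oneR Γ) = oneR Γ ⊗ₜ oneR Γ := by
  refine eq_of_evSet₂ _ _ ?_
  rintro _ ⟨p, q, a, b, rfl⟩
  rw [dd_ev_comulR rfl, TensorProduct.dualDistrib_apply, oneR]
  by_cases h : p = 0 ∧ q = 0
  · obtain ⟨rfl, rfl⟩ := h
    rw [ev_incl, ev_incl, ev_incl (n := 0), SpinWr.emb_mk, ← unitFun_mul, SpinWr.shift_self]
    exact congrArg (fun c => (unitFun Γ).1 (a * c)) (SpinWr.shift_self b)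
  · rw [ev_incl_of_ne (by omega)]
    by_cases hp : p = 0
    · rw [ev_incl_of_ne (m := 0) (n := q) (by omega), mul_zero]
    · rw [ev_incl_of_ne (m := 0) (n := p) (by omega), zero_mul]

/-- Associativity is dual to coassociativity with respect to the pairing. -/
theorem mulMap_assoc (f g h : RMinus Γ) :
    mulMap Γ (mulMap Γ (f ⊗ₜ g) ⊗ₜ h) = mulMap Γ (f ⊗ₜ mulMap Γ (g ⊗ₜ h)) := by
  refine pairing_injective (LinearMap.ext fun w => ?_)
  have e : ∀ f g, pairing Γ (mulMap Γ (f ⊗ₜ g)) = dd (pairing Γ f) (pairing Γ g) ∘ₗ comulR Γ :=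
    fun f g => LinearMap.ext fun w => pairing_mulMap f g w
  rw [pairing_mulMap, pairing_mulMap, e, e, dd_comul_assoc]

theorem mulMap_one_left (f : RMinus Γ) : mulMap Γ (oneR Γ ⊗ₜ f) = f := by
  refine pairing_injective (LinearMap.ext fun w => ?_)
  have e : pairing Γ (oneR Γ) = ev (1 : SpinWr Γ 0) := LinearMap.ext pairing_oneR
  rw [pairing_mulMap, e, dd_counit_left]

theorem mulMap_one_right (f : RMinus Γ) : mulMap Γ (f ⊗ₜ oneR Γ) = f := by
  refine pairing_injective (LinearMap.ext fun w => ?_)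
  have e : pairing Γ (oneR Γ) = ev (1 : SpinWr Γ 0) := LinearMap.ext pairing_oneR
  rw [pairing_mulMap, e, dd_counit_right]

/-- The counit is the pairing with the unit, which is group-like. -/
theorem counit_mulMap (f g : RMinus Γ) :
    ev (1 : SpinWr Γ 0) (mulMap Γ (f ⊗ₜ g)) = ev (1 : SpinWr Γ 0) f * ev (1 : SpinWr Γ 0) g := by
  rw [← pairing_apply_oneR, pairing_mulMap, comulR_oneR, TensorProduct.dualDistrib_apply,
    pairing_apply_oneR, pairing_apply_oneR]

variable (Γ) in
/-- The ring structure of `R⁻_Γ`. -/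
@[reducible]
noncomputable def ringR : Ring (RMinus Γ) :=
  { (Module.addCommMonoidToAddCommGroup ℂ : AddCommGroup (RMinus Γ)) with
    mul := fun f g => mulMap Γ (f ⊗ₜ g)
    one := oneR Γ
    left_distrib := fun f g h => by
      change mulMap Γ (f ⊗ₜ (g + h)) = mulMap Γ (f ⊗ₜ g) + mulMap Γ (f ⊗ₜ h)
      rw [TensorProduct.tmul_add, map_add]
    right_distrib := fun f g h => by
      change mulMap Γ ((f + g) ⊗ₜ h) = mulMap Γ (f ⊗ₜ h) + mulMap Γ (g ⊗ₜ h)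
      rw [TensorProduct.add_tmul, map_add]
    zero_mul := fun f => by
      change mulMap Γ (0 ⊗ₜ f) = 0
      rw [TensorProduct.zero_tmul, map_zero]
    mul_zero := fun f => by
      change mulMap Γ (f ⊗ₜ 0) = 0
      rw [TensorProduct.tmul_zero, map_zero]
    mul_assoc := mulMap_assoc
    one_mul := mulMap_one_left
    mul_one := mulMap_one_right }

attribute [local instance] ringR

variable (Γ) in
/-- The algebra structure of `R⁻_Γ`. -/
@[reducible]
noncomputable def algebraR : Algebra ℂ (RMinus Γ) :=
  Algebra.ofModule
    (fun c f g => by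
      change mulMap Γ ((c • f) ⊗ₜ g) = c • mulMap Γ (f ⊗ₜ g)
      rw [← TensorProduct.smul_tmul', map_smul])
    (fun c f g => by
      change mulMap Γ (f ⊗ₜ (c • g)) = c • mulMap Γ (f ⊗ₜ g)
      rw [TensorProduct.tmul_smul, map_smul])

attribute [local instance] algebraR

theorem mul_eq_mulMap (f g : RMinus Γ) : f * g = mulMap Γ (f ⊗ₜ g) := rfl

end Unit

/-! ### Values of products -/

section Split

variable {Γ : Type u} [Group Γ]

namespace SpinWr

variable {n : ℕ}

/-- The permutation underlying `u` maps the initial segment of length `k` onto `A`. -/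
def IsFrame (u : SpinWr Γ n) (k : ℕ) (A : Finset (Fin n)) : Prop :=
  ∀ i : Fin n, perm Γ n u i ∈ A ↔ i.1 < k

theorem IsFrame.eq_image {u : SpinWr Γ n} {k : ℕ} {A : Finset (Fin n)} (h : IsFrame u k A) :
    A = (Finset.univ.filter fun i : Fin n => i.1 < k).image (perm Γ n u) := by
  ext j
  obtain ⟨i, rfl⟩ := (perm Γ n u).surjective j
  rw [h i, Finset.mem_image]
  constructor
  · intro hi
    exact ⟨i, by simpa using hi, rfl⟩
  · rintro ⟨i', hi', e⟩
    obtain rfl := (perm Γ n u).injective e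
    simpa using hi'

theorem isFrame_image (u : SpinWr Γ n) (k : ℕ) :
    IsFrame u k ((Finset.univ.filter fun i : Fin n => i.1 < k).image (perm Γ n u)) := by
  intro i
  rw [Finset.mem_image]
  constructor
  · rintro ⟨i', hi', e⟩
    obtain rfl := (perm Γ n u).injective e
    simpa using hi'
  · intro hi
    exact ⟨i, by simpa using hi, rfl⟩

theorem IsFrame.card_eq {u : SpinWr Γ n} {k : ℕ} {A : Finset (Fin n)} (h : IsFrame u k A)
    (hk : k ≤ n) : A.card = k := by
  rw [h.eq_image, Finset.card_image_of_injective _ (perm Γ n u).injective, Fin.card_filter_val_lt,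
    min_eq_right hk]

variable (Γ) in
/-- Every subset is the image of an initial segment, since `S̃_n → S_n` is surjective. -/
theorem exists_isFrame (A : Finset (Fin n)) : ∃ u : SpinWr Γ n, IsFrame u A.card A := by
  classical
  have hcard : Fintype.card {i : Fin n // i.1 < A.card} = Fintype.card {i : Fin n // i ∈ A} := by
    rw [Fintype.card_subtype, Fin.card_filter_val_lt, Fintype.card_coe, min_eq_right]
    simpa using A.card_le_univ
  let e := Fintype.equivOfCardEq hcard
  obtain ⟨w, hw⟩ := SpinSym.theta_surjective e.extendSubtype
  refine ⟨SemidirectProduct.inr w, fun i => ?_⟩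
  rw [perm_inr, hw]
  by_cases hi : i.1 < A.card
  · exact iff_of_true (e.extendSubtype_mem i hi) hi
  · exact iff_of_false (e.extendSubtype_not_mem i hi) hi

theorem IsFrame.exists_emb {u u' : SpinWr Γ n} {k l : ℕ} (h : k + l = n) {A : Finset (Fin n)}
    (hu : IsFrame u k A) (hu' : IsFrame u' k A) : ∃ q, u' = u * emb Γ k l n h q := by
  obtain ⟨x, y, hxy⟩ := mem_range_emb h (u⁻¹ * u') (by
    intro i hi
    rw [← hu, map_mul, map_inv, Equiv.Perm.mul_apply, ← Equiv.Perm.mul_apply, mul_inv_cancel,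
      Equiv.Perm.one_apply, hu' i]
    exact hi)
  exact ⟨_, by rw [hxy, mul_inv_cancel_left]⟩

theorem IsFrame.mul_emb {u : SpinWr Γ n} {k l : ℕ} (h : k + l = n) {A : Finset (Fin n)}
    (hu : IsFrame u k A) (q : SpinProd (SpinWr Γ k) (SpinWr Γ l)) :
    IsFrame (u * emb Γ k l n h q) k A := by
  intro i
  rw [map_mul, Equiv.Perm.mul_apply, hu, perm_emb_lt_iff]

end SpinWr

/-- The functional `f ⊗ g ↦ φ(f ⊗ g) q`, where `q` is an element of the spin product of
`Γ ≀ S̃_k` and `Γ ≀ S̃_l`. -/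
noncomputable def evProd {k l : ℕ} (q : SpinProd (SpinWr Γ k) (SpinWr Γ l)) :
    Module.Dual ℂ (RMinus Γ ⊗[ℂ] RMinus Γ) :=
  evalAt q ∘ₗ phi (SpinWr Γ k) (SpinWr Γ l) ∘ₗ
    TensorProduct.map (DirectSum.component ℂ ℕ (fun n => SpinSuper (SpinWr Γ n)) k)
      (DirectSum.component ℂ ℕ (fun n => SpinSuper (SpinWr Γ n)) l)

theorem evProd_tmul {k l : ℕ} (q : SpinProd (SpinWr Γ k) (SpinWr Γ l)) (f g : RMinus Γ) :
    evProd q (f ⊗ₜ g) = (phi (SpinWr Γ k) (SpinWr Γ l) (f k ⊗ₜ g l)).1 q := rfl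

theorem evProd_mk {k l : ℕ} (a : SpinWr Γ k) (b : SpinWr Γ l) :
    evProd (SpinProd.mk a b) = dd (ev a) (ev b) :=
  TensorProduct.ext' fun f g => by
    rw [evProd_tmul, phi_tmul_mk, TensorProduct.dualDistrib_apply, ev_apply, ev_apply]

theorem evProd_conj {k l : ℕ} (q r : SpinProd (SpinWr Γ k) (SpinWr Γ l)) :
    evProd (r * q * r⁻¹) = evProd q :=
  LinearMap.ext fun _ => (phi _ _ _).2.1 q r

open Classical in
/-- The functional `evProd q` if `y` is the image of the element `q` of the spin product, and `0`
if `y` does not lie in the image of the spin product. -/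
noncomputable def split {n : ℕ} (k l : ℕ) (h : k + l = n) (y : SpinWr Γ n) :
    Module.Dual ℂ (RMinus Γ ⊗[ℂ] RMinus Γ) :=
  if hy : ∃ q, SpinWr.emb Γ k l n h q = y then evProd hy.choose else 0

theorem split_emb {n k l : ℕ} (h : k + l = n) (q : SpinProd (SpinWr Γ k) (SpinWr Γ l)) :
    split k l h (SpinWr.emb Γ k l n h q) = evProd q := by
  have hy : ∃ q', SpinWr.emb Γ k l n h q' = SpinWr.emb Γ k l n h q := ⟨q, rfl⟩
  rw [split, dif_pos hy, SpinWr.emb_injective k l n h hy.choose_spec]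

theorem split_of_not {n k l : ℕ} (h : k + l = n) {y : SpinWr Γ n}
    (hy : ¬∃ q, SpinWr.emb Γ k l n h q = y) : split k l h y = 0 := dif_neg hy

theorem split_conj_emb {n k l : ℕ} (h : k + l = n) (q : SpinProd (SpinWr Γ k) (SpinWr Γ l))
    (y : SpinWr Γ n) :
    split k l h ((SpinWr.emb Γ k l n h q)⁻¹ * y * SpinWr.emb Γ k l n h q) = split k l h y := by
  by_cases hy : ∃ r, SpinWr.emb Γ k l n h r = y
  · obtain ⟨r, rfl⟩ := hy
    rw [← map_inv, ← map_mul, ← map_mul, split_emb, split_emb]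
    simpa using evProd_conj r q⁻¹
  · rw [split_of_not h hy, split_of_not]
    rintro ⟨r, hr⟩
    refine hy ⟨q * r * q⁻¹, ?_⟩
    rw [map_mul, map_mul, hr, map_inv]
    group

/-- The contribution of a subset `A` to the value at `c` of a product: if `u` moves an initial
segment to `A`, this is the functional `split` at `u⁻¹ c u`. It vanishes unless `c` preserves
`A`. -/
noncomputable def splitAt {n : ℕ} (c : SpinWr Γ n) (A : Finset (Fin n)) :
    Module.Dual ℂ (RMinus Γ ⊗[ℂ] RMinus Γ) :=
  split A.card (n - A.card) (Nat.add_sub_cancel' (by simpa using A.card_le_univ))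
    ((SpinWr.exists_isFrame Γ A).choose⁻¹ * c * (SpinWr.exists_isFrame Γ A).choose)

/-- `splitAt` does not depend on the choice of the conjugating element: two choices differ by an
element of the spin product, and `evProd` is invariant under conjugation. -/
theorem splitAt_eq {n k l : ℕ} (h : k + l = n) {u : SpinWr Γ n} {A : Finset (Fin n)}
    (hu : SpinWr.IsFrame u k A) (c : SpinWr Γ n) : splitAt c A = split k l h (u⁻¹ * c * u) := by
  obtain rfl := hu.card_eq (by omega)
  obtain rfl : l = n - A.card := by omega
  obtain ⟨q, hq⟩ := (SpinWr.exists_isFrame Γ A).choose_spec.exists_emb h hu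
  rw [splitAt, hq, ← split_conj_emb h q]
  congr 1
  group

theorem splitAt_incl_of_ne {n k l : ℕ} (c : SpinWr Γ n) (A : Finset (Fin n))
    (h : ¬(A.card = k ∧ n - A.card = l)) (f : SpinSuper (SpinWr Γ k)) (g : SpinSuper (SpinWr Γ l)) :
    splitAt c A (incl Γ k f ⊗ₜ incl Γ l g) = 0 := by
  rw [splitAt, split]
  split_ifs
  · rw [evProd_tmul]
    by_cases hk : k = A.card
    · rw [incl_apply_of_ne (m := l) (fun hl => h ⟨hk.symm, hl.symm⟩), TensorProduct.tmul_zero,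
        map_zero]
      rfl
    · rw [incl_apply_of_ne hk, TensorProduct.zero_tmul, map_zero]
      rfl
  · rfl

variable [Finite Γ]

theorem indEmb_apply {k l n : ℕ} (h : k + l = n) (f : SpinSuper (SpinWr Γ k))
    (g : SpinSuper (SpinWr Γ l)) (c : SpinWr Γ n) :
    (indEmb Γ k l n h (phi _ _ (f ⊗ₜ g))).1 c =
      (Nat.card (SpinProd (SpinWr Γ k) (SpinWr Γ l)) : ℂ)⁻¹ *
        ∑ u : SpinWr Γ n, split k l h (u⁻¹ * c * u) (incl Γ k f ⊗ₜ incl Γ l g) := by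
  classical
  change indFun _ _ c = _
  rw [indFun, finsum_eq_sum_of_fintype, Fintype.sum_prod_type]
  refine congrArg _ (Finset.sum_congr rfl fun u _ => ?_)
  by_cases hy : ∃ q, SpinWr.emb Γ k l n h q = u⁻¹ * c * u
  · obtain ⟨q, hq⟩ := hy
    simp only [← hq, (SpinWr.emb_injective k l n h).eq_iff]
    rw [split_emb, evProd_tmul, incl_apply_self, incl_apply_self, Finset.sum_ite_eq',
      if_pos (Finset.mem_univ _)]
  · rw [split_of_not h hy]
    refine Finset.sum_eq_zero fun q _ => if_neg fun hq => hy ⟨q, hq⟩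

/-- The value of a product at `c` is a sum over the subsets preserved by `c`. -/
theorem ev_mulMap {n : ℕ} (c : SpinWr Γ n) (t : RMinus Γ ⊗[ℂ] RMinus Γ) :
    ev c (mulMap Γ t) = ∑ A : Finset (Fin n), splitAt c A t := by
  classical
  induction t with
  | zero => simp
  | add t t' ht ht' => simp only [map_add, ht, ht', Finset.sum_add_distrib]
  | tmul f g =>
  induction f using DirectSum.induction_on with
  | zero => simp [TensorProduct.zero_tmul]
  | add f f' hf hf' => simp only [TensorProduct.add_tmul, map_add, hf, hf', Finset.sum_add_distrib]
  | of k f =>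
  induction g using DirectSum.induction_on with
  | zero => simp [TensorProduct.tmul_zero]
  | add g g' hg hg' => simp only [TensorProduct.tmul_add, map_add, hg, hg', Finset.sum_add_distrib]
  | of l g =>
    change ev c (mulMap Γ (incl Γ k f ⊗ₜ incl Γ l g)) =
      ∑ A : Finset (Fin n), splitAt c A (incl Γ k f ⊗ₜ incl Γ l g)
    rw [mulMap_incl]
    by_cases h : k + l = n
    · subst h
      rw [ev_incl, indEmb_apply]
      -- Group the conjugating elements by the image of the initial segment of length `k`.
      let im : SpinWr Γ (k + l) → Finset (Fin (k + l)) := fun u =>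
        (Finset.univ.filter fun i : Fin (k + l) => i.1 < k).image (SpinWr.perm Γ _ u)
      have hH : (Nat.card (SpinProd (SpinWr Γ k) (SpinWr Γ l)) : ℂ) ≠ 0 := by
        rw [Nat.card_eq_fintype_card]; exact_mod_cast Fintype.card_ne_zero
      rw [inv_mul_eq_iff_eq_mul₀ hH, ← Finset.sum_fiberwise Finset.univ im, Finset.mul_sum]
      refine Finset.sum_congr rfl fun A _ => ?_
      by_cases hA : A.card = k
      · obtain ⟨u₀, hu₀⟩ := SpinWr.exists_isFrame Γ A
        rw [hA] at hu₀
        have hfil : (Finset.univ.filter fun u => im u = A) =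
            Finset.univ.image fun q => u₀ * SpinWr.emb Γ k l _ rfl q := by
          ext u
          simp only [Finset.mem_filter, Finset.mem_univ, true_and, Finset.mem_image]
          constructor
          · intro hu
            obtain ⟨q, hq⟩ := hu₀.exists_emb rfl (u' := u) (hu ▸ SpinWr.isFrame_image u k)
            exact ⟨q, hq.symm⟩
          · rintro ⟨q, rfl⟩
            exact (hu₀.mul_emb rfl q).eq_image.symm
        have hcard : (Finset.univ.filter fun u => im u = A).card =
            Nat.card (SpinProd (SpinWr Γ k) (SpinWr Γ l)) := by
          rw [hfil, Finset.card_image_of_injective, Finset.card_univ, Nat.card_eq_fintype_card]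
          exact (mul_right_injective u₀).comp (SpinWr.emb_injective k l _ rfl)
        rw [← hcard, ← nsmul_eq_mul, ← Finset.sum_const]
        refine Finset.sum_congr rfl fun u hu => ?_
        have hu' : im u = A := (Finset.mem_filter.1 hu).2
        have hf : SpinWr.IsFrame u k A := hu' ▸ SpinWr.isFrame_image u k
        rw [splitAt_eq rfl hf]
      · rw [splitAt_incl_of_ne _ _ (fun hh => hA hh.1), mul_zero]
        refine Finset.sum_eq_zero fun u hu => ?_
        have hu' : im u = A := (Finset.mem_filter.1 hu).2
        have hf : SpinWr.IsFrame u k A := hu' ▸ SpinWr.isFrame_image u k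
        exact absurd (hf.card_eq (by omega)) hA
    · rw [ev_incl_of_ne h]
      refine (Finset.sum_eq_zero fun A _ => splitAt_incl_of_ne c A ?_ f g).symm
      have := A.card_le_univ
      rw [Fintype.card_fin] at this
      omega

end Split

/-! ### Multiplicativity of the comultiplication -/

/-- The permutation of `k₁ + k₂ + l₁ + l₂` points that turns the order of consecutive blocks of
lengths `k₁, k₂, l₁, l₂` into the order `k₁, l₁, k₂, l₂`. -/
def blockSwap (k₁ k₂ l₁ l₂ n : ℕ) (h : k₁ + k₂ + l₁ + l₂ = n) : Equiv.Perm (Fin n) where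
  toFun i := ⟨if i.1 < k₁ then i.1 else if i.1 < k₁ + k₂ then i.1 + l₁ else
    if i.1 < k₁ + k₂ + l₁ then i.1 - k₂ else i.1, by split_ifs <;> omega⟩
  invFun i := ⟨if i.1 < k₁ then i.1 else if i.1 < k₁ + l₁ then i.1 + k₂ else
    if i.1 < k₁ + l₁ + k₂ then i.1 - l₁ else i.1, by split_ifs <;> omega⟩
  left_inv i := by
    ext
    dsimp only
    split_ifs <;> omega
  right_inv i := by
    ext
    dsimp only
    split_ifs <;> omega

theorem mul_zpw_mul {G : Type*} [Group G] [SpinData G] {W B B' : G} {β : ZMod 2}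
    (e : W * B = B' * W * zpw β) (X : G) (α : ZMod 2) :
    X * W * zpw α * B = X * B' * W * zpw (β + α) := by
  rw [mul_assoc (X * W), zpw_comm, zpw_add]
  simp only [← mul_assoc]
  rw [mul_assoc X W B, e]
  simp only [← mul_assoc]

section Block

variable {Γ : Type u} [Group Γ] {k₁ k₂ l₁ l₂ p q k l n : ℕ}

theorem blockSwap_apply₁ (h : k₁ + k₂ + l₁ + l₂ = n) {i : ℕ} (hi : i < k₁) :
    blockSwap k₁ k₂ l₁ l₂ n h ⟨i, by omega⟩ = ⟨i, by omega⟩ := by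
  ext; simp only [blockSwap, Equiv.coe_fn_mk]; split_ifs; rfl

theorem blockSwap_apply₂ (h : k₁ + k₂ + l₁ + l₂ = n) {i : ℕ} (hi : i < k₂) :
    blockSwap k₁ k₂ l₁ l₂ n h ⟨k₁ + i, by omega⟩ = ⟨k₁ + l₁ + i, by omega⟩ := by
  ext; simp only [blockSwap, Equiv.coe_fn_mk]; split_ifs <;> omega

theorem blockSwap_apply₃ (h : k₁ + k₂ + l₁ + l₂ = n) {i : ℕ} (hi : i < l₁) :
    blockSwap k₁ k₂ l₁ l₂ n h ⟨k₁ + k₂ + i, by omega⟩ = ⟨k₁ + i, by omega⟩ := by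
  ext; simp only [blockSwap, Equiv.coe_fn_mk]; split_ifs <;> omega

theorem blockSwap_apply₄ (h : k₁ + k₂ + l₁ + l₂ = n) {i : ℕ} (hi : i < l₂) :
    blockSwap k₁ k₂ l₁ l₂ n h ⟨k₁ + k₂ + l₁ + i, by omega⟩ = ⟨k₁ + l₁ + k₂ + i, by omega⟩ := by
  ext; simp only [blockSwap, Equiv.coe_fn_mk]; split_ifs <;> omega

/-- Conjugation by the block permutation exchanges the two middle factors of a fourfold product, up
to a sign given by the parities. -/
theorem emb_emb_mul_inr (hp : k₁ + l₁ = p) (hq : k₂ + l₂ = q) (hk : k₁ + k₂ = k)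
    (hl : l₁ + l₂ = l) (hpq : p + q = n) (hkl : k + l = n) (w : SpinSym n)
    (hw : SpinSym.theta n w = blockSwap k₁ k₂ l₁ l₂ n (by omega))
    (a₁ : SpinWr Γ k₁) (a₂ : SpinWr Γ l₁) (b₁ : SpinWr Γ k₂) (b₂ : SpinWr Γ l₂) :
    (SemidirectProduct.inr w : SpinWr Γ n) *
        SpinWr.emb Γ k l n hkl (SpinProd.mk (SpinWr.emb Γ k₁ k₂ k hk (SpinProd.mk a₁ b₁))
          (SpinWr.emb Γ l₁ l₂ l hl (SpinProd.mk a₂ b₂))) =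
      SpinWr.emb Γ p q n hpq (SpinProd.mk (SpinWr.emb Γ k₁ l₁ p hp (SpinProd.mk a₁ a₂))
        (SpinWr.emb Γ k₂ l₂ q hq (SpinProd.mk b₁ b₂))) * SemidirectProduct.inr w *
        zpw (d w * (d a₁ + d a₂ + d b₁ + d b₂) + d a₂ * d b₁) := by
  subst hp hq hk hl
  have e1 := SpinWr.inr_mul_shift_eq 0 0 k₁ (by omega) (by omega) w
    (fun j => by simp only [hw, zero_add]; exact blockSwap_apply₁ _ j.2) a₁
  have e2 := SpinWr.inr_mul_shift_eq k₁ (k₁ + l₁) k₂ (by omega) (by omega) w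
    (fun j => by rw [hw]; exact blockSwap_apply₂ _ j.2) b₁
  have e3 := SpinWr.inr_mul_shift_eq (k₁ + k₂) k₁ l₁ (by omega) (by omega) w
    (fun j => by rw [hw]; exact blockSwap_apply₃ _ j.2) a₂
  have e4 := SpinWr.inr_mul_shift_eq (k₁ + k₂ + l₁) (k₁ + l₁ + k₂) l₂ (by omega) (by omega) w
    (fun j => by rw [hw]; exact blockSwap_apply₄ _ j.2) b₂
  -- The elements `a₂` and `b₁` are placed in disjoint blocks, hence commute up to sign.
  have e5 : SpinWr.shift Γ (k₁ + l₁) k₂ n (by omega) b₁ * SpinWr.shift Γ k₁ l₁ n (by omega) a₂ =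
      SpinWr.shift Γ k₁ l₁ n (by omega) a₂ * SpinWr.shift Γ (k₁ + l₁) k₂ n (by omega) b₁ *
        zpw (d a₂ * d b₁) := by
    have h := SpinWr.superCommute_shift Γ (k₁ + l₁) k₂ n (by omega) b₁
      (SpinWr.shift Γ k₁ l₁ (k₁ + l₁) (by omega) a₂)
    rw [SuperCommute, SpinWr.d_shift, SpinWr.d_shift, SpinWr.d_shift, SpinWr.shift_shift] at h
    simp only [zero_add] at h
    rw [h, mul_comm (d b₁)]
  simp only [SpinWr.emb_mk, map_mul, SpinWr.shift_shift, zero_add, add_zero, ← mul_assoc]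
  rw [e1]
  have f2 := mul_zpw_mul e2 (SpinWr.shift Γ 0 k₁ n (by omega) a₁) (d w * d a₁)
  rw [f2, mul_zpw_mul e3, mul_zpw_mul e4, mul_assoc (SpinWr.shift Γ 0 k₁ n _ a₁), e5]
  simp only [← mul_assoc]
  rw [mul_assoc _ (zpw _), zpw_comm, ← mul_assoc, mul_assoc _ (zpw _), zpw_comm, ← mul_assoc,
    mul_assoc _ (zpw _), ← zpw_add]
  congr 2
  ring

end Block

attribute [local instance] ringR algebraR

section Block

variable {Γ : Type u} [Group Γ] {k₁ k₂ l₁ l₂ p q k l n : ℕ}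

/-- If conjugation by the block permutation moves a pair `(a, b)` into the spin product
`(k₁ + k₂, l₁ + l₂)`, then both `a` and `b` split. -/
theorem exists_emb_of_conj (hp : k₁ + l₁ = p) (hq : k₂ + l₂ = q) (hk : k₁ + k₂ = k)
    (hpq : p + q = n) (hkl : k + l = n) (w : SpinSym n)
    (hw : SpinSym.theta n w = blockSwap k₁ k₂ l₁ l₂ n (by omega))
    (a : SpinWr Γ p) (b : SpinWr Γ q) (r : SpinProd (SpinWr Γ k) (SpinWr Γ l))
    (hr : (SemidirectProduct.inr w : SpinWr Γ n) * SpinWr.emb Γ k l n hkl r =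
      SpinWr.emb Γ p q n hpq (SpinProd.mk a b) * SemidirectProduct.inr w) :
    (∃ a₁ a₂, SpinWr.emb Γ k₁ l₁ p hp (SpinProd.mk a₁ a₂) = a) ∧
      ∃ b₁ b₂, SpinWr.emb Γ k₂ l₂ q hq (SpinProd.mk b₁ b₂) = b := by
  subst hp hq hk
  have hperm : ∀ i, blockSwap k₁ k₂ l₁ l₂ n (by omega)
        (SpinWr.perm Γ n (SpinWr.emb Γ _ l n hkl r) i) =
      SpinWr.perm Γ n (SpinWr.emb Γ _ _ n hpq (SpinProd.mk a b))
        (blockSwap k₁ k₂ l₁ l₂ n (by omega) i) := by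
    intro i
    have := congrArg (fun y => SpinWr.perm Γ n y i) hr
    simp only [map_mul, SpinWr.perm_inr, Equiv.Perm.mul_apply, hw] at this
    exact this
  refine ⟨SpinWr.mem_range_emb rfl a fun i hi => ?_, SpinWr.mem_range_emb rfl b fun i hi => ?_⟩
  · have h1 := hperm ⟨i.1, by omega⟩
    rw [blockSwap_apply₁ _ hi, SpinWr.perm_emb_left hpq a b i] at h1
    have h2 := (SpinWr.perm_emb_lt_iff hkl r ⟨i.1, by omega⟩).2 (by simp only; omega)
    generalize SpinWr.perm Γ n (SpinWr.emb Γ _ l n hkl r) ⟨i.1, by omega⟩ = m at h1 h2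
    by_cases hm : m.1 < k₁
    · rw [blockSwap_apply₁ _ hm, Fin.mk.injEq] at h1
      omega
    · have e := blockSwap_apply₂ (k₁ := k₁) (k₂ := k₂) (l₁ := l₁) (l₂ := l₂) (n := n) (by omega)
        (i := m.1 - k₁) (by omega)
      have e' : (⟨k₁ + (m.1 - k₁), by omega⟩ : Fin n) = m := by ext; simp only; omega
      rw [e', h1, Fin.mk.injEq] at e
      omega
  · have h1 := hperm ⟨k₁ + i.1, by omega⟩
    rw [blockSwap_apply₂ _ hi, SpinWr.perm_emb_right hpq a b i] at h1
    have h2 := (SpinWr.perm_emb_lt_iff hkl r ⟨k₁ + i.1, by omega⟩).2 (by simp only; omega)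
    generalize SpinWr.perm Γ n (SpinWr.emb Γ _ l n hkl r) ⟨k₁ + i.1, by omega⟩ = m at h1 h2
    by_cases hm : m.1 < k₁
    · rw [blockSwap_apply₁ _ hm, Fin.mk.injEq] at h1
      omega
    · have e := blockSwap_apply₂ (k₁ := k₁) (k₂ := k₂) (l₁ := l₁) (l₂ := l₂) (n := n) (by omega)
        (i := m.1 - k₁) (by omega)
      have e' : (⟨k₁ + (m.1 - k₁), by omega⟩ : Fin n) = m := by ext; simp only; omega
      rw [e', h1, Fin.mk.injEq] at e
      omega

/-- The union of a subset of the first `p` points and of a subset of the last `q` points. -/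
def joinSet (A₁ : Finset (Fin p)) (A₂ : Finset (Fin q)) : Finset (Fin (p + q)) :=
  (A₁.disjSum A₂).map finSumFinEquiv.toEmbedding

theorem castAdd_mem_joinSet (A₁ : Finset (Fin p)) (A₂ : Finset (Fin q)) (i : Fin p) :
    (⟨i.1, by omega⟩ : Fin (p + q)) ∈ joinSet A₁ A₂ ↔ i ∈ A₁ := by
  have : (⟨i.1, by omega⟩ : Fin (p + q)) = finSumFinEquiv.toEmbedding (Sum.inl i) := rfl
  rw [this, joinSet, Finset.mem_map', Finset.inl_mem_disjSum]

theorem natAdd_mem_joinSet (A₁ : Finset (Fin p)) (A₂ : Finset (Fin q)) (i : Fin q) :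
    (⟨p + i.1, by omega⟩ : Fin (p + q)) ∈ joinSet A₁ A₂ ↔ i ∈ A₂ := by
  have : (⟨p + i.1, by omega⟩ : Fin (p + q)) = finSumFinEquiv.toEmbedding (Sum.inr i) := rfl
  rw [this, joinSet, Finset.mem_map', Finset.inr_mem_disjSum]

theorem sum_joinSet {M : Type*} [AddCommMonoid M] (φ : Finset (Fin (p + q)) → M) :
    ∑ A, φ A = ∑ A₁, ∑ A₂, φ (joinSet A₁ A₂) := by
  rw [← Fintype.sum_prod_type']
  exact (Fintype.sum_equiv ((Finset.sumEquiv (α := Fin p) (β := Fin q)).symm.toEquiv.trans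
    finSumFinEquiv.finsetCongr) _ _ fun _ => rfl).symm

/-- Elements that move initial segments to `A₁` and `A₂`, preceded by a lift of the block
permutation, move an initial segment to the union of `A₁` and `A₂`. -/
theorem isFrame_joinSet (hp : k₁ + l₁ = p) (hq : k₂ + l₂ = q) {u₁ : SpinWr Γ p} {u₂ : SpinWr Γ q}
    {A₁ : Finset (Fin p)} {A₂ : Finset (Fin q)} (h₁ : u₁.IsFrame k₁ A₁) (h₂ : u₂.IsFrame k₂ A₂)
    (w : SpinSym (p + q))
    (hw : SpinSym.theta (p + q) w = blockSwap k₁ k₂ l₁ l₂ (p + q) (by omega)) :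
    SpinWr.IsFrame (SpinWr.emb Γ p q (p + q) rfl (SpinProd.mk u₁ u₂) * SemidirectProduct.inr w)
      (k₁ + k₂) (joinSet A₁ A₂) := by
  subst hp hq
  have c1 : ∀ m (hm : m < k₁ + l₁), SpinWr.perm Γ _ (SpinWr.emb Γ _ _ _ rfl (SpinProd.mk u₁ u₂))
      ⟨m, by omega⟩ ∈ joinSet A₁ A₂ ↔ m < k₁ := by
    intro m hm
    have := SpinWr.perm_emb_left rfl u₁ u₂ ⟨m, hm⟩
    rw [this, castAdd_mem_joinSet, h₁]
  have c2 : ∀ m (hm : m < k₂ + l₂), SpinWr.perm Γ _ (SpinWr.emb Γ _ _ _ rfl (SpinProd.mk u₁ u₂))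
      ⟨k₁ + l₁ + m, by omega⟩ ∈ joinSet A₁ A₂ ↔ m < k₂ := by
    intro m hm
    have := SpinWr.perm_emb_right rfl u₁ u₂ ⟨m, hm⟩
    rw [this, natAdd_mem_joinSet, h₂]
  rintro ⟨i, hi⟩
  rw [map_mul, Equiv.Perm.mul_apply, SpinWr.perm_inr, hw]
  by_cases i1 : i < k₁
  · rw [blockSwap_apply₁ _ i1, c1 _ (by omega)]
    simp only; omega
  by_cases i2 : i < k₁ + k₂
  · obtain ⟨j, rfl⟩ : ∃ j, i = k₁ + j := ⟨i - k₁, by omega⟩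
    rw [blockSwap_apply₂ _ (by omega), c2 _ (by omega)]
    simp only; omega
  by_cases i3 : i < k₁ + k₂ + l₁
  · obtain ⟨j, rfl⟩ : ∃ j, i = k₁ + k₂ + j := ⟨i - (k₁ + k₂), by omega⟩
    rw [blockSwap_apply₃ _ (by omega), c1 _ (by omega)]
    simp only; omega
  · obtain ⟨j, rfl⟩ : ∃ j, i = k₁ + k₂ + l₁ + j := ⟨i - (k₁ + k₂ + l₁), by omega⟩
    have := c2 (k₂ + j) (by omega)
    rw [blockSwap_apply₄ _ (by omega)]
    simp only [← add_assoc] at this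
    rw [this]
    simp only; omega

theorem split_mul_zpw (h : k + l = n) (r : SpinProd (SpinWr Γ k) (SpinWr Γ l)) (e : ZMod 2) :
    split k l h (SpinWr.emb Γ k l n h r * zpw e) = SpinSupermodule.sgn e • evProd r := by
  rcases zmod_two_cases e with rfl | rfl
  · rw [zpw_zero, mul_one, split_emb, SpinSupermodule.sgn_zero, one_smul]
  · rw [zpw_one, ← z_comm, ← SpinWr.emb_z Γ k l n h, ← map_mul, split_emb,
      SpinSupermodule.sgn_one]
    refine LinearMap.ext fun t => ?_
    rw [LinearMap.smul_apply, neg_one_smul]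
    exact (phi _ _ _).2.2.1 r

theorem ev_emb_odd_left (h : p + q = n) (a : SpinWr Γ p) (b : SpinWr Γ q) (ha : d a = 1) :
    ev (SpinWr.emb Γ p q n h (SpinProd.mk a b)) = 0 :=
  LinearMap.ext fun f => SpinSuper.apply_mk_odd_left (resEmb Γ p q n h (f n)) a b ha

theorem ev_emb_odd_right (h : p + q = n) (a : SpinWr Γ p) (b : SpinWr Γ q) (hb : d b = 1) :
    ev (SpinWr.emb Γ p q n h (SpinProd.mk a b)) = 0 :=
  LinearMap.ext fun f => SpinSuper.apply_mk_odd_right (resEmb Γ p q n h (f n)) a b hb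

theorem dualDistrib_tensorTensorTensorComm (α β γ δ : Module.Dual ℂ (RMinus Γ))
    (s s' : RMinus Γ ⊗[ℂ] RMinus Γ) :
    TensorProduct.dualDistrib ℂ _ _ (dd α β ⊗ₜ dd γ δ)
        (TensorProduct.tensorTensorTensorComm ℂ _ _ _ _ (s ⊗ₜ s')) = dd α γ s * dd β δ s' := by
  induction s with
  | zero => simp [TensorProduct.zero_tmul]
  | add s t hs ht => rw [TensorProduct.add_tmul, map_add, map_add, hs, ht, map_add, add_mul]
  | tmul x y =>
  induction s' with
  | zero => simp [TensorProduct.tmul_zero]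
  | add s t hs ht => rw [TensorProduct.tmul_add, map_add, map_add, hs, ht, map_add, mul_add]
  | tmul x' y' =>
    rw [TensorProduct.tensorTensorTensorComm_tmul]
    simp only [TensorProduct.dualDistrib_apply]
    ring

variable [Finite Γ]

/-- The case of initial segments of `splitAt_joinSet`. -/
theorem split_conj_blockSwap (hp : k₁ + l₁ = p) (hq : k₂ + l₂ = q)
    (hkl : k₁ + k₂ + (l₁ + l₂) = p + q) (w : SpinSym (p + q))
    (hw : SpinSym.theta (p + q) w = blockSwap k₁ k₂ l₁ l₂ (p + q) (by omega))
    (a : SpinWr Γ p) (b : SpinWr Γ q) (ha : d a = 0) (hb : d b = 0) (f g : RMinus Γ) :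
    split (k₁ + k₂) (l₁ + l₂) hkl ((SemidirectProduct.inr w)⁻¹ *
        SpinWr.emb Γ p q (p + q) rfl (SpinProd.mk a b) * SemidirectProduct.inr w) (f ⊗ₜ g) =
      TensorProduct.dualDistrib ℂ _ _ (split k₁ l₁ hp a ⊗ₜ split k₂ l₂ hq b)
        (TensorProduct.tensorTensorTensorComm ℂ _ _ _ _ (comulR Γ f ⊗ₜ comulR Γ g)) := by
  set W : SpinWr Γ (p + q) := SemidirectProduct.inr w with hW
  by_cases hs : (∃ a₁ a₂, SpinWr.emb Γ k₁ l₁ p hp (SpinProd.mk a₁ a₂) = a) ∧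
      ∃ b₁ b₂, SpinWr.emb Γ k₂ l₂ q hq (SpinProd.mk b₁ b₂) = b
  · obtain ⟨⟨a₁, a₂, rfl⟩, b₁, b₂, rfl⟩ := hs
    have key := emb_emb_mul_inr hp hq rfl rfl rfl hkl w hw a₁ a₂ b₁ b₂
    set e := d w * (d a₁ + d a₂ + d b₁ + d b₂) + d a₂ * d b₁ with he
    have key' := congrArg (fun y => W⁻¹ * y * zpw e) key
    simp only [mul_assoc, zpw_mul_self, mul_one] at key'
    rw [← hW, inv_mul_cancel_left, ← mul_assoc W⁻¹] at key'
    rw [← key', split_mul_zpw, split_emb, split_emb, evProd_mk, evProd_mk, evProd_mk,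
      dualDistrib_tensorTensorTensorComm, dd_ev_comulR (n := k₁ + k₂) rfl a₁ b₁ f,
      dd_ev_comulR (n := l₁ + l₂) rfl a₂ b₂ g]
    change SpinSupermodule.sgn e * dd _ _ (f ⊗ₜ g) = _
    rw [TensorProduct.dualDistrib_apply]
    have hda : d a₁ + d a₂ = 0 := by rw [← ha, SpinWr.d_emb, SpinProd.d_mk]
    have hdb : d b₁ + d b₂ = 0 := by rw [← hb, SpinWr.d_emb, SpinProd.d_mk]
    -- As `a` is even, `a₁` and `a₂` have the same parity. If it is even, the sign is `1`; if it is
    -- odd, both sides vanish.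
    rcases zmod_two_cases (d a₁) with h | h
    · have h2 : d a₂ = 0 := by rwa [h, zero_add] at hda
      have h0 : e = 0 := by rw [he, add_assoc (d a₁ + d a₂), hda, hdb, h2]; simp
      rw [h0, SpinSupermodule.sgn_zero, one_mul]
    · rw [ev_emb_odd_left _ _ _ h]
      simp
  · have h1 : split (k₁ + k₂) (l₁ + l₂) hkl (W⁻¹ * SpinWr.emb Γ p q (p + q) rfl
        (SpinProd.mk a b) * W) = 0 := by
      refine split_of_not hkl ?_
      rintro ⟨r, hr⟩
      refine hs (exists_emb_of_conj hp hq rfl rfl hkl w hw a b r ?_)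
      rw [hr, ← hW]
      group
    have h2 : split k₁ l₁ hp a ⊗ₜ[ℂ] split k₂ l₂ hq b = 0 := by
      by_cases hsa : ∃ r, SpinWr.emb Γ k₁ l₁ p hp r = a
      · rw [split_of_not hq, TensorProduct.tmul_zero]
        rintro ⟨r', hr'⟩
        obtain ⟨r, hr⟩ := hsa
        obtain ⟨a₁, a₂, rfl⟩ := SpinProd.exists_mk r
        obtain ⟨b₁, b₂, rfl⟩ := SpinProd.exists_mk r'
        exact hs ⟨⟨a₁, a₂, hr⟩, b₁, b₂, hr'⟩
      · rw [split_of_not hp hsa, TensorProduct.zero_tmul]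
    rw [h1, h2, map_zero]
    rfl

/-- Splitting an even pair `(a, b)` along a union of subsets amounts to splitting `a` and `b`
separately. -/
theorem splitAt_joinSet (a : SpinWr Γ p) (b : SpinWr Γ q) (ha : d a = 0) (hb : d b = 0)
    (A₁ : Finset (Fin p)) (A₂ : Finset (Fin q)) (f g : RMinus Γ) :
    splitAt (SpinWr.emb Γ p q (p + q) rfl (SpinProd.mk a b)) (joinSet A₁ A₂) (f ⊗ₜ g) =
      TensorProduct.dualDistrib ℂ _ _ (splitAt a A₁ ⊗ₜ splitAt b A₂)
        (TensorProduct.tensorTensorTensorComm ℂ _ _ _ _ (comulR Γ f ⊗ₜ comulR Γ g)) := by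
  obtain ⟨u₁, h₁⟩ := SpinWr.exists_isFrame Γ A₁
  obtain ⟨u₂, h₂⟩ := SpinWr.exists_isFrame Γ A₂
  obtain ⟨l₁, hp⟩ : ∃ l₁, A₁.card + l₁ = p :=
    ⟨p - A₁.card, Nat.add_sub_cancel' (by simpa using A₁.card_le_univ)⟩
  obtain ⟨l₂, hq⟩ : ∃ l₂, A₂.card + l₂ = q :=
    ⟨q - A₂.card, Nat.add_sub_cancel' (by simpa using A₂.card_le_univ)⟩
  generalize A₁.card = k₁ at h₁ hp
  generalize A₂.card = k₂ at h₂ hq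
  obtain ⟨w, hw⟩ := SpinSym.theta_surjective (blockSwap k₁ k₂ l₁ l₂ (p + q) (by omega))
  have hu := isFrame_joinSet hp hq h₁ h₂ w hw
  have hkl : k₁ + k₂ + (l₁ + l₂) = p + q := by omega
  set U := SpinWr.emb Γ p q (p + q) rfl (SpinProd.mk u₁ u₂) with hU
  have ha' : d (u₁⁻¹ * a * u₁) = 0 := by
    rw [d_mul, d_mul, d_inv, ha, add_zero, show ∀ x : ZMod 2, x + x = 0 by decide]
  have hb' : d (u₂⁻¹ * b * u₂) = 0 := by
    rw [d_mul, d_mul, d_inv, hb, add_zero, show ∀ x : ZMod 2, x + x = 0 by decide]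
  have hconj : SpinWr.emb Γ p q (p + q) rfl (SpinProd.mk a b) * U =
      U * SpinWr.emb Γ p q (p + q) rfl (SpinProd.mk (u₁⁻¹ * a * u₁) (u₂⁻¹ * b * u₂)) := by
    rw [hU, ← map_mul, ← map_mul, SpinProd.mk_mul_mk, SpinProd.mk_mul_mk, hb, ha', zero_mul,
      mul_zero, zpw_zero, mul_one, mul_one]
    congr 2 <;> group
  have hy : (U * SemidirectProduct.inr w)⁻¹ *
        SpinWr.emb Γ p q (p + q) rfl (SpinProd.mk a b) * (U * SemidirectProduct.inr w) =
      (SemidirectProduct.inr w)⁻¹ *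
        SpinWr.emb Γ p q (p + q) rfl (SpinProd.mk (u₁⁻¹ * a * u₁) (u₂⁻¹ * b * u₂)) *
        SemidirectProduct.inr w := by
    rw [mul_assoc, ← mul_assoc _ U _, hconj]
    group
  rw [splitAt_eq hkl hu, splitAt_eq hp h₁, splitAt_eq hq h₂, hy]
  exact split_conj_blockSwap hp hq hkl w hw _ _ ha' hb' f g

theorem dd_ev_mul (a : SpinWr Γ p) (b : SpinWr Γ q) (s s' : RMinus Γ ⊗[ℂ] RMinus Γ) :
    dd (ev a) (ev b) (s * s') = ∑ A₁, ∑ A₂,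
      TensorProduct.dualDistrib ℂ _ _ (splitAt a A₁ ⊗ₜ splitAt b A₂)
        (TensorProduct.tensorTensorTensorComm ℂ _ _ _ _ (s ⊗ₜ s')) := by
  induction s with
  | zero => simp [TensorProduct.zero_tmul]
  | add s t hs ht =>
    simp only [add_mul, TensorProduct.add_tmul, map_add, hs, ht, Finset.sum_add_distrib]
  | tmul x y =>
  induction s' with
  | zero => simp [TensorProduct.tmul_zero]
  | add s t hs ht =>
    simp only [mul_add, TensorProduct.tmul_add, map_add, hs, ht, Finset.sum_add_distrib]
  | tmul x' y' =>
    rw [Algebra.TensorProduct.tmul_mul_tmul, TensorProduct.dualDistrib_apply, mul_eq_mulMap,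
      mul_eq_mulMap, ev_mulMap, ev_mulMap, Finset.sum_mul_sum]
    simp only [TensorProduct.tensorTensorTensorComm_tmul, TensorProduct.dualDistrib_apply]

/-- The comultiplication is multiplicative. At an even pair `(a, b)` both sides are sums over the
subsets of `{1, …, p + q}`, that is, over pairs of subsets, with equal terms; at other pairs both
sides vanish. -/
theorem comulR_mul (f g : RMinus Γ) : comulR Γ (f * g) = comulR Γ f * comulR Γ g := by
  refine eq_of_evSet₂ _ _ ?_
  rintro _ ⟨p, q, a, b, rfl⟩
  rw [dd_ev_comulR rfl]
  rcases zmod_two_cases (d a) with ha | ha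
  · rcases zmod_two_cases (d b) with hb | hb
    · rw [mul_eq_mulMap, ev_mulMap, sum_joinSet, dd_ev_mul]
      exact Finset.sum_congr rfl fun A₁ _ => Finset.sum_congr rfl fun A₂ _ =>
        splitAt_joinSet a b ha hb A₁ A₂ f g
    · rw [ev_emb_odd_right _ _ _ hb, ev_of_odd b hb, dd, TensorProduct.tmul_zero, map_zero]
      rfl
  · rw [ev_emb_odd_left _ _ _ ha, ev_of_odd a ha, dd, TensorProduct.zero_tmul, map_zero]
    rfl

end Block

/-! ### The bialgebra and its antipode -/

section Antipode

theorem conv_ext {Γ : Type u} [Group Γ]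
    {f g : WithConv (RMinus Γ →ₗ[ℂ] RMinus Γ)}
    (h : ∀ n x, f (incl Γ n x) = g (incl Γ n x)) : f = g :=
  WithConv.ext (DirectSum.linearMap_ext ℂ fun n => LinearMap.ext fun x => h n x)

variable (Γ : Type u) [Group Γ] [Finite Γ]

/-- The bialgebra structure of `R⁻_Γ`. -/
@[reducible]
noncomputable def bialgebraR : Bialgebra ℂ (RMinus Γ) :=
  Bialgebra.mk' ℂ (RMinus Γ)
    (show ev (1 : SpinWr Γ 0) (oneR Γ) = 1 by rw [oneR, ev_incl, unitFun_one])
    (fun {f g} => counit_mulMap f g)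
    (comulR_oneR.trans Algebra.TensorProduct.one_def.symm)
    (fun {f g} => comulR_mul f g)

attribute [local instance] bialgebraR

open WithConv

variable {Γ}

/-- The convolution product `f * g` on the component of degree `n` only involves the values of
`f` and `g` on components whose degrees add up to `n`. -/
theorem convMul_congr {n : ℕ} {f g f' g' : WithConv (RMinus Γ →ₗ[ℂ] RMinus Γ)}
    (h : ∀ p q, p + q = n → ∀ (a : SpinSuper (SpinWr Γ p)) (b : SpinSuper (SpinWr Γ q)),
      f (incl Γ p a) * g (incl Γ q b) = f' (incl Γ p a) * g' (incl Γ q b))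
    (x : SpinSuper (SpinWr Γ n)) : (f * g) (incl Γ n x) = (f' * g') (incl Γ n x) := by
  rw [LinearMap.convMul_apply, LinearMap.convMul_apply]
  change LinearMap.mul' ℂ _ (TensorProduct.map _ _ (comulR Γ (incl Γ n x))) =
    LinearMap.mul' ℂ _ (TensorProduct.map _ _ (comulR Γ (incl Γ n x)))
  rw [comulR_incl]
  simp only [map_sum]
  refine Finset.sum_congr rfl fun p _ => ?_
  have aux : ∀ t : SpinSuper (SpinWr Γ p.1.1) ⊗[ℂ] SpinSuper (SpinWr Γ p.1.2),
      LinearMap.mul' ℂ (RMinus Γ) (TensorProduct.map f.ofConv g.ofConv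
        (TensorProduct.map (incl Γ p.1.1) (incl Γ p.1.2) t)) =
      LinearMap.mul' ℂ (RMinus Γ) (TensorProduct.map f'.ofConv g'.ofConv
        (TensorProduct.map (incl Γ p.1.1) (incl Γ p.1.2) t)) := by
    intro t
    induction t with
    | zero => simp only [map_zero]
    | add s t hs ht => simp only [map_add, hs, ht]
    | tmul a b =>
      simp only [TensorProduct.map_tmul, LinearMap.mul'_apply]
      exact h _ _ (Finset.HasAntidiagonal.mem_antidiagonal.1 p.2) a b
  exact aux _

variable (Γ) in
/-- The element `1 - id` of the convolution algebra, the negative of the projection of `R⁻_Γ` onto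
its components of positive degree. -/
noncomputable def oneSubId : WithConv (RMinus Γ →ₗ[ℂ] RMinus Γ) := 1 - toConv LinearMap.id

/-- The component of degree `0` is spanned by the unit. -/
theorem oneSubId_incl_zero (x : SpinSuper (SpinWr Γ 0)) : oneSubId Γ (incl Γ 0 x) = 0 := by
  change algebraMap ℂ (RMinus Γ) (ev (1 : SpinWr Γ 0) (incl Γ 0 x)) - incl Γ 0 x = 0
  rw [sub_eq_zero, ev_incl, Algebra.algebraMap_eq_smul_one]
  change x.1 1 • incl Γ 0 (unitFun Γ) = _
  rw [← map_smul]
  congr 1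
  refine Subtype.ext (funext fun c => ?_)
  change x.1 1 * (unitFun Γ).1 c = x.1 c
  rw [← unitFun_mul_apply x c, mul_right_comm, unitFun_mul_apply, unitFun_one, one_mul]

/-- Convolution powers of `oneSubId` vanish in degrees smaller than the exponent, as each factor
vanishes in degree `0`. -/
theorem oneSubId_pow_incl {m n : ℕ} (h : n < m) (x : SpinSuper (SpinWr Γ n)) :
    (oneSubId Γ ^ m) (incl Γ n x) = 0 := by
  induction m generalizing n with
  | zero => omega
  | succ m ih =>
    have key : (oneSubId Γ ^ m * oneSubId Γ) (incl Γ n x) =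
        ((0 : WithConv (RMinus Γ →ₗ[ℂ] RMinus Γ)) * oneSubId Γ) (incl Γ n x) := by
      refine convMul_congr (fun p q hpq a b => ?_) x
      rcases Nat.eq_zero_or_pos q with rfl | hq
      · rw [oneSubId_incl_zero, mul_zero, mul_zero]
      · rw [ih (by omega), zero_mul]
        exact (zero_mul _).symm
    rw [pow_succ, key, zero_mul]
    rfl

variable (Γ) in
/-- The antipode of `R⁻_Γ`, the convolution inverse of `id = 1 - oneSubId`: in degree `n` it is the
truncation `∑_{i ≤ n} oneSubId ^ i` of the geometric series. -/
noncomputable def antipodeR : RMinus Γ →ₗ[ℂ] RMinus Γ :=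
  DirectSum.toModule ℂ ℕ _ fun n =>
    (∑ i ∈ Finset.range (n + 1), oneSubId Γ ^ i).ofConv ∘ₗ incl Γ n

/-- Up to degree `n` the antipode is the truncation of the geometric series at the exponent `n`, as
the additional terms vanish there. -/
theorem antipodeR_incl {p n : ℕ} (h : p ≤ n) (x : SpinSuper (SpinWr Γ p)) :
    toConv (antipodeR Γ) (incl Γ p x) =
      (∑ i ∈ Finset.range (n + 1), oneSubId Γ ^ i) (incl Γ p x) := by
  induction n, h using Nat.le_induction with
  | base => exact DirectSum.toModule_lof ..
  | succ n hn ih =>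
    rw [Finset.sum_range_succ, ih]
    have h0 := oneSubId_pow_incl (Nat.lt_succ_of_le hn) x
    exact ((congrArg _ h0).trans (add_zero _)).symm

theorem one_sub_oneSubId : 1 - oneSubId Γ = toConv LinearMap.id := sub_sub_cancel _ _

theorem one_sub_oneSubId_pow_incl (n : ℕ) (x : SpinSuper (SpinWr Γ n)) :
    (1 - oneSubId Γ ^ (n + 1)) (incl Γ n x) =
      (1 : WithConv (RMinus Γ →ₗ[ℂ] RMinus Γ)) (incl Γ n x) := by
  have h := congrArg (fun f : WithConv (RMinus Γ →ₗ[ℂ] RMinus Γ) => f (incl Γ n x))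
    (sub_add_cancel 1 (oneSubId Γ ^ (n + 1)))
  refine ((add_zero _).symm.trans ?_).trans h
  exact congrArg _ (oneSubId_pow_incl n.lt_succ_self x).symm

/-- The component of degree `n` of the left hand side only involves degrees up to `n`, so that the
antipode may be replaced by a truncated geometric series. -/
theorem antipodeR_mul_id : toConv (antipodeR Γ) * toConv LinearMap.id = 1 := by
  refine conv_ext fun n x => ?_
  have key : (toConv (antipodeR Γ) * toConv LinearMap.id :
        WithConv (RMinus Γ →ₗ[ℂ] RMinus Γ)) (incl Γ n x) =
      ((∑ i ∈ Finset.range (n + 1), oneSubId Γ ^ i) * toConv LinearMap.id :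
        WithConv (RMinus Γ →ₗ[ℂ] RMinus Γ)) (incl Γ n x) :=
    convMul_congr (fun p q h a b => by rw [antipodeR_incl (n := n) (by omega)]) x
  rw [key, ← one_sub_oneSubId, geom_sum_mul_neg, one_sub_oneSubId_pow_incl]

theorem id_mul_antipodeR : toConv LinearMap.id * toConv (antipodeR Γ) = 1 := by
  refine conv_ext fun n x => ?_
  have key : (toConv LinearMap.id * toConv (antipodeR Γ) :
        WithConv (RMinus Γ →ₗ[ℂ] RMinus Γ)) (incl Γ n x) =
      (toConv LinearMap.id * (∑ i ∈ Finset.range (n + 1), oneSubId Γ ^ i) :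
        WithConv (RMinus Γ →ₗ[ℂ] RMinus Γ)) (incl Γ n x) :=
    convMul_congr (fun p q h a b => by rw [antipodeR_incl (n := n) (by omega)]) x
  rw [key, ← one_sub_oneSubId, mul_neg_geom_sum, one_sub_oneSubId_pow_incl]

variable (Γ) in
/-- The Hopf algebra structure of `R⁻_Γ`. -/
@[reducible]
noncomputable def hopfAlgebraR : HopfAlgebra ℂ (RMinus Γ) :=
  HopfAlgebra.ofConvInverse (antipodeR Γ) antipodeR_mul_id id_mul_antipodeR

end Antipode

end SpinWreath

open SpinWreath

theorem mainTheorem3 (Γ : Type u) [Group Γ] [Finite Γ] :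
    (∀ (k l n : ℕ) (h : k + l = n), Function.Injective (SpinWr.emb Γ k l n h)) ∧
    ∃ hphi : ∀ k l : ℕ, Function.Bijective (phi (SpinWr Γ k) (SpinWr Γ l)),
      (∀ (k l : ℕ) (U V : Type w) [AddCommGroup U] [Module ℂ U] [FiniteDimensional ℂ U]
        [AddCommGroup V] [Module ℂ V] [FiniteDimensional ℂ V]
        (M : SpinSupermodule (SpinWr Γ k) U) (N : SpinSupermodule (SpinWr Γ l) V)
        (x : SpinProd (SpinWr Γ k) (SpinWr Γ l)),
        (phi (SpinWr Γ k) (SpinWr Γ l) (M.character ⊗ₜ[ℂ] N.character)).1 x =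
          LinearMap.trace ℂ (U ⊗[ℂ] V) (M.superTensor N x)) ∧
      ∃ (A : Type u) (_ : Ring A) (_ : HopfAlgebra ℂ A) (e : RMinus Γ ≃ₗ[ℂ] A),
        (∀ x y : RMinus Γ, e (mulMap Γ (x ⊗ₜ[ℂ] y)) = e x * e y) ∧
        (∀ x : RMinus Γ,
          TensorProduct.map e.toLinearMap e.toLinearMap (comulMap Γ hphi x) =
            Coalgebra.comul (R := ℂ) (e x)) := by
  refine ⟨fun k l n h => SpinWr.emb_injective k l n h, fun _ _ => phi_bijective,
    fun k l U V _ _ _ _ _ _ M N x => phi_character M N x, RMinus Γ, ringR Γ, hopfAlgebraR Γ,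
    LinearEquiv.refl ℂ _, fun _ _ => rfl, fun x => ?_⟩
  exact LinearMap.congr_fun TensorProduct.map_id _
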